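/- Let $\mathcal M=\mathbb R$, $\hat{\mathcal M}=\mathbb R$, or $\mathcal M=\mathbb T=\mathbb R/2\pi\mathbb Z$, $\hat{\mathcal M}=\mathbb Z$; integrals over $\hat{\mathcal M}=\mathbb Z$ are sums. Let $\hat u(\xi)=\frac1{\sqrt{2\pi}}\int_{\mathcal M}u(x)e^{-i\xi x}\,dx$, $\mathcal F u=\hat u$, $S(t)=\mathcal F^{-1}e^{-it\xi^2}\mathcal F$, $\check\omega=\mathcal F^{-1}\omega$, $\langle\xi\rangle=(1+\xi^2)^{1/2}$ and $\omega^*(\xi)=\overline{\omega(-\xi)}$. Fix a smooth $\eta:\mathbb R\to\mathbb R$ with $\mathbf 1_{[-5/4,5/4]}\le\eta\le\mathbf 1_{[-8/5,8/5]}$ and put $\psi_1(\xi)=\eta(|\xi|)$, $\psi_N(\xi)=\eta(|\xi|/N)-\eta(2|\xi|/N)$ for dyadic integers $N\in\{2,4,8,\dots\}$, and $P_N=\mathcal F^{-1}\psi_N\mathcal F$. Let $$\|f\|_{\hat H^s}=\|\langle\xi\rangle^sf\|_{L^2(\hat{\mathcal M})},\quad \|u\|_{H^s}=\|\hat u\|_{\hat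 H^s},\quad \|u\|_{B^s_{p,q}}=\big\|N^s\|P_Nu\|_{L^p(\mathcal M)}\big\|_{\ell^q_N},$$ let the norm of an intersection $X\cap Y$ be $\|\cdot\|_X+\|\cdot\|_Y$, and let $\|u\|_{X+Y}=\inf_{u=g+h}(\|g\|_X+\|h\|_Y)$. With $\xi_{j3}=\xi_j+\xi_3$ and $\phi=\xi^2-\xi_1^2-\xi_2^2+\xi_3^2$ define, for $t\in\mathbb R$, $$\mathcal N[\omega](\xi)=e^{it\xi^2}\mathcal F\big[(S(t)\check\omega)^2\,\partial_x\overline{S(t)\check\omega}\big](\xi)-\frac1{2\pi}\int_{\substack{\xi=\xi_1+\xi_2+\xi_3\\ \min(|\xi_{13}|,|\xi_{23}|)<1}}e^{it\phi}\,i\xi_3\,\omega(\xi_1)\omega(\xi_2)\omega^*(\xi_3),$$ where the Fourier transform of the product of $v^2$ and $\partial_x\bar v$ is $\frac{1}{\sqrt{2\pi}}$ times the convolution of their Fourier transforms, and, for dyadic integers $N,N_1,N_2,N_3\ge1$, $$\mathcal N_{N,N_1,N_2,N_3}[\omega](\xi)=\frac{\psi_N(\xi)}{2\pi}\int_{\substack{\xi=\xi_1+\xi_2+\xi_3\\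 \min(|\xi_{13}|,|\xi_{23}|)\ge1}}e^{it\phi}\,i\xi_3\,(\psi_{N_1}\omega)(\xi_1)(\psi_{N_2}\omega)(\xi_2)(\psi_{N_3}\omega)^*(\xi_3).$$ **Proposition.** (1) For every $\varepsilon>0$ there is a constant $C$ such that, for all $w\in H^{1/2}\cap B^{\varepsilon}_{\infty,1}$ and $t\in\mathbb R$, with $\omega=\mathcal FS(-t)w$, $$\|S(t)\mathcal F^{-1}\mathcal N[\omega]\|_{H^{-1/2}+B^0_{1,\infty}}\le C\,\|w\|_{H^{1/2}}^2\,\|w\|_{H^{1/2}\cap B^{\varepsilon}_{\infty,1}}.$$ (2) Write $X\gg Y$ for $X\ge AY$ and $X\sim Y$ for $D^{-1}Y\le X\le DY$. There is $K\ge1$ such that for all $A,D\ge K$ and all $\varepsilon>0$ there are $\delta>0$ and a constant $C$ such that, for all $w\in H^{1/2}\cap B^{\varepsilon}_{\infty,1}$ and $t\in\mathbb R$, with $\omega=\mathcal FS(-t)w$, the two sums $$\Sigma_1=\sum_{N\sim N_3\gg N_1,N_2}\mathcal N_{N,N_1,N_2,N_3}[\omega],\qquad \Sigma_2=\sum_{\max(N_1,N_2)\sim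 N_3\gg N\gg\min(N_1,N_2)}\mathcal N_{N,N_1,N_2,N_3}[\omega]$$ converge absolutely at almost every $\xi\in\hat{\mathcal M}$, and $$\big\|\mathcal N[\omega]-(\Sigma_1+\Sigma_2)\big\|_{\hat H^{-1/2+\delta}}+\|\Sigma_1\|_{\hat H^{-1/2}}+\|S(t)\mathcal F^{-1}\Sigma_2\|_{B^0_{1,\infty}}\le C\,\|w\|_{H^{1/2}\cap B^{\varepsilon}_{\infty,1}}\,\|w\|_{H^{1/2}}^2.$$ The constants $K,\delta,C$ do not depend on $w$ or $t$. -/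

import Mathlib

open MeasureTheory
open scoped ENNReal NNReal

namespace CubicDNLS

noncomputable section

/-- The spatial domain `𝓜`: the real line `ℝ` or the torus `𝕋 = ℝ / 2πℤ`. -/
inductive Domain : Type where
  | line : Domain
  | torus : Domain

/-- The measure `dx` on `𝓜`. Functions on the torus are functions on the fundamental domain
`(0, 2π]`. -/
def Domain.space : Domain → Measure ℝ
  | .line => volume
  | .torus => volume.restrict (Set.Ioc 0 (2 * Real.pi))

/-- The measure `dξ` on the set of frequencies, which is `ℝ` for the line and `ℤ ⊆ ℝ` for the torus:
Lebesgue measure, respectively the counting measure of `ℤ`, so that `∫ f ∂M.freq` is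
`∫_ℝ f(ξ) dξ`, respectively `∑_{ξ ∈ ℤ} f(ξ)`. -/
def Domain.freq : Domain → Measure ℝ
  | .line => volume
  | .torus => Measure.sum fun n : ℤ => Measure.dirac (n : ℝ)

/-- The Fourier transform `ŵ(ξ) = (2π)^{-1/2} ∫ w(x) e^{-iξx} dx` of `w ∈ L²(𝓜)`. On the line it is
the Plancherel extension: Mathlib's `𝓕` has the kernel `e^{-2πixξ}`, whence the rescaling. -/
def fourierL2 : (M : Domain) → Lp ℂ 2 M.space → ℝ → ℂ
  | .line, w => fun ξ =>
      ((Real.sqrt (2 * Real.pi))⁻¹ : ℂ) *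
        (FourierTransform.fourier (show Lp ℂ 2 (volume : Measure ℝ) from w) :
          Lp ℂ 2 (volume : Measure ℝ)) (ξ / (2 * Real.pi))
  | .torus, w => fun ξ =>
      ((Real.sqrt (2 * Real.pi))⁻¹ : ℂ) *
        ∫ x, w x * Complex.exp (-(Complex.I * ξ * x)) ∂(Domain.torus.space)

/-- The multiplier of `S(t) = e^{it∂ₓ²}`: if `f = û`, then `schrodinger t f` is the Fourier transform
of `S(t)u`. -/
def schrodinger (t : ℝ) (f : ℝ → ℂ) (ξ : ℝ) : ℂ :=
  Complex.exp (-(Complex.I * t * ξ ^ 2)) * f ξ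

/-- `ω = 𝓕 S(-t) w`. -/
def profile (M : Domain) (t : ℝ) (w : Lp ℂ 2 M.space) : ℝ → ℂ :=
  schrodinger (-t) (fourierL2 M w)

/-- `f*(ξ)`, the complex conjugate of `f(-ξ)`; if `f = û`, this is the Fourier transform of `ū`. -/
def conjReflect (f : ℝ → ℂ) (ξ : ℝ) : ℂ := (starRingEnd ℂ) (f (-ξ))

/-- The Littlewood-Paley cutoff `ψ_N` with `N = 2 ^ k`. -/
def lpCutoff (η : ℝ → ℝ) : ℕ → ℝ → ℝ
  | 0, ξ => η |ξ|
  | k + 1, ξ => η (|ξ| / 2 ^ (k + 1)) - η (2 * |ξ| / 2 ^ (k + 1))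

/-- `ψ_N f` with `N = 2 ^ k`. -/
def localize (η : ℝ → ℝ) (k : ℕ) (f : ℝ → ℂ) (ξ : ℝ) : ℂ := (lpCutoff η k ξ : ℂ) * f ξ

/-- `P_N u` as a function of `x`, in terms of `f = û`:
`(P_N u)(x) = (2π)^{-1/2} ∫ ψ_N(ξ) û(ξ) e^{iξx} dξ` with `N = 2 ^ k`. -/
def lpProj (M : Domain) (η : ℝ → ℝ) (k : ℕ) (f : ℝ → ℂ) (x : ℝ) : ℂ :=
  ((Real.sqrt (2 * Real.pi))⁻¹ : ℂ) *
    ∫ ξ, localize η k f ξ * Complex.exp (Complex.I * ξ * x) ∂M.freq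

open Classical in
/-- `‖f‖_{Ĥ^s} = ‖⟨ξ⟩^s f‖_{L²}`, which is `‖u‖_{H^s}` if `f = û`.
It is `∞` if `f` is not measurable. -/
def hatSobolevNorm (M : Domain) (s : ℝ) (f : ℝ → ℂ) : ℝ≥0∞ :=
  if AEStronglyMeasurable f M.freq then
    eLpNorm (fun ξ => (((1 + ξ ^ 2) ^ (s / 2) : ℝ) : ℂ) * f ξ) 2 M.freq
  else ∞

open Classical in
/-- `‖u‖_{B^s_{p,q}}`, the `ℓ^q` norm over dyadic `N` of `N^s ‖P_N u‖_{L^p}`, for a distribution `u`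
whose Fourier transform is the locally integrable function `f`. (Every element of `H^s` and of
`B^s_{1,q}` has such a Fourier transform.) It is `∞` if `f` is not locally integrable. -/
def besovNorm (M : Domain) (η : ℝ → ℝ) (s : ℝ) (p q : ℝ≥0∞) (f : ℝ → ℂ) : ℝ≥0∞ :=
  if LocallyIntegrable f M.freq then
    eLpNorm (fun k : ℕ => ((2 : ℝ≥0∞) ^ k) ^ s * eLpNorm (lpProj M η k f) p M.space) q Measure.count
  else ∞

/-- The norm of `H^s + B^σ_{p,q}`: the infimum of `‖g‖_{H^s} + ‖h‖_{B^σ_{p,q}}` over all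
decompositions `u = g + h`, where `u, g, h` are given by their Fourier transforms. -/
def sumNorm (M : Domain) (η : ℝ → ℝ) (s σ : ℝ) (p q : ℝ≥0∞) (f : ℝ → ℂ) : ℝ≥0∞ :=
  ⨅ (g : ℝ → ℂ) (h : ℝ → ℂ) (_ : f =ᵐ[M.freq] fun ξ => g ξ + h ξ),
    hatSobolevNorm M s g + besovNorm M η σ p q h

/-- The Fourier transform `(2π)^{-1/2} ∫ f(ξ-ζ) g(ζ) dζ` of the product of two distributions whose
Fourier transforms are the functions `f` and `g`. (If `f ∈ Ĥ^s` and `g ∈ Ĥ^{-s}`, the integral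
converges absolutely for every `ξ`.) -/
def fourierMul (M : Domain) (f g : ℝ → ℂ) (ξ : ℝ) : ℂ :=
  ((Real.sqrt (2 * Real.pi))⁻¹ : ℂ) * ∫ ζ, f (ξ - ζ) * g ζ ∂M.freq

/-- `𝓕[v² ∂ₓv̄]` in terms of `f = v̂`: the product of `v²` and `∂ₓv̄`. -/
def cubicFourier (M : Domain) (f : ℝ → ℂ) : ℝ → ℂ :=
  fourierMul M (fourierMul M f f) (fun ξ => Complex.I * ξ * conjReflect f ξ)

/-- The phase `φ = ξ² - ξ₁² - ξ₂² + ξ₃²` where `ξ = ξ₁ + ξ₂ + ξ₃`. -/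
def phase (ξ₁ ξ₂ ξ₃ : ℝ) : ℝ := (ξ₁ + ξ₂ + ξ₃) ^ 2 - ξ₁ ^ 2 - ξ₂ ^ 2 + ξ₃ ^ 2

/-- `min(|ξ₁ + ξ₃|, |ξ₂ + ξ₃|)`. -/
def resonance (ξ₁ ξ₂ ξ₃ : ℝ) : ℝ := min |ξ₁ + ξ₃| |ξ₂ + ξ₃|

/-- `(2π)⁻¹ ∫ e^{itφ} iξ₃ f(ξ₁) g(ξ₂) h*(ξ₃)` over those `ξ = ξ₁ + ξ₂ + ξ₃` for which
`R ξ₁ ξ₂ ξ₃` holds. The variables of integration are `p = (ξ₁, ξ₂)`. -/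
def trilinear (M : Domain) (t : ℝ) (R : ℝ → ℝ → ℝ → Prop) (f g h : ℝ → ℂ) (ξ : ℝ) : ℂ :=
  ((2 * Real.pi)⁻¹ : ℂ) *
    ∫ p in {p : ℝ × ℝ | R p.1 p.2 (ξ - p.1 - p.2)},
      Complex.exp (Complex.I * t * phase p.1 p.2 (ξ - p.1 - p.2)) *
        (Complex.I * ((ξ - p.1 - p.2 : ℝ) : ℂ)) *
        f p.1 * g p.2 * conjReflect h (ξ - p.1 - p.2) ∂(M.freq.prod M.freq)

/-- The cubic nonlinearity `𝓝ᵗ[ω] = e^{itξ²} 𝓕[(S(t)ω̌)² ∂ₓ(conj S(t)ω̌)]` minus its resonant part,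
the part with `min(|ξ₁ + ξ₃|, |ξ₂ + ξ₃|) < 1`. -/
def nonlin (M : Domain) (t : ℝ) (ω : ℝ → ℂ) (ξ : ℝ) : ℂ :=
  schrodinger (-t) (cubicFourier M (schrodinger t ω)) ξ -
    trilinear M t (fun ξ₁ ξ₂ ξ₃ => resonance ξ₁ ξ₂ ξ₃ < 1) ω ω ω ξ

/-- A quadruple of dyadic integers `N = 2 ^ k`, `N_j = 2 ^ k_j`. -/
structure Quad where
  /-- exponent of `N` -/
  k : ℕ
  /-- exponent of `N₁` -/
  k₁ : ℕ
  /-- exponent of `N₂` -/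
  k₂ : ℕ
  /-- exponent of `N₃` -/
  k₃ : ℕ

/-- The output frequency `N`. -/
def Quad.N (Q : Quad) : ℝ := 2 ^ Q.k
/-- The input frequency `N₁`. -/
def Quad.N₁ (Q : Quad) : ℝ := 2 ^ Q.k₁
/-- The input frequency `N₂`. -/
def Quad.N₂ (Q : Quad) : ℝ := 2 ^ Q.k₂
/-- The input frequency `N₃`. -/
def Quad.N₃ (Q : Quad) : ℝ := 2 ^ Q.k₃

/-- The localized nonlinearity `𝓝ᵗ_{N,N₁,N₂,N₃}[ω]`. -/
def nonlinPiece (M : Domain) (η : ℝ → ℝ) (t : ℝ) (Q : Quad) (ω : ℝ → ℂ) : ℝ → ℂ :=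
  localize η Q.k
    (trilinear M t (fun ξ₁ ξ₂ ξ₃ => 1 ≤ resonance ξ₁ ξ₂ ξ₃)
      (localize η Q.k₁ ω) (localize η Q.k₂ ω) (localize η Q.k₃ ω))

/-- `X ≫ Y` with the constant `A`. -/
def MuchGreater (A X Y : ℝ) : Prop := A * Y ≤ X

/-- `X ∼ Y` with the constant `D`. -/
def Comparable (D X Y : ℝ) : Prop := X ≤ D * Y ∧ Y ≤ D * X

/-- The interactions `N ∼ N₃ ≫ N₁, N₂`. -/
def highOutput (A D : ℝ) : Set Quad :=
  {Q | Comparable D Q.N Q.N₃ ∧ MuchGreater A Q.N₃ Q.N₁ ∧ MuchGreater A Q.N₃ Q.N₂}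

/-- The interactions `max(N₁, N₂) ∼ N₃ ≫ N ≫ min(N₁, N₂)`. -/
def midOutput (A D : ℝ) : Set Quad :=
  {Q | Comparable D (max Q.N₁ Q.N₂) Q.N₃ ∧ MuchGreater A Q.N₃ Q.N ∧
    MuchGreater A Q.N (min Q.N₁ Q.N₂)}

/-- The sum of the localized nonlinearities over a set of interactions, at each frequency `ξ`. -/
def nonlinSum (M : Domain) (η : ℝ → ℝ) (t : ℝ) (S : Set Quad) (ω : ℝ → ℂ) (ξ : ℝ) : ℂ :=
  ∑' Q : S, nonlinPiece M η t Q.1 ω ξ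

end

end CubicDNLS

open CubicDNLS

/-! The time dependence is only apparent. The factor e^{itφ} cancels the oscillation of the profiles
exactly (`trilinear_schrodinger`), so with f = ŵ every term is e^{itξ²} times its value at t = 0,
and all estimates concern the Fourier transform of w² ∂ₓw̄. No oscillation in time is exploited.

The product is expanded, without restriction on resonance, into blocks P_N(P_{N₁}w P_{N₂}w ∂ₓ conj
P_{N₃}w), with absolute convergence at each frequency (`hasSum_quadBlock`). For the interactions of
Σ₁ and Σ₂ the condition min(|ξ₁₃|, |ξ₂₃|) ≥ 1 holds by itself (`nonlinPiece_eq_quadBlock`). Hence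
𝓝[ω] - Σ₁ - Σ₂ is, up to the phase, the sum of the other unrestricted blocks minus the whole
resonant part. In the resonant part ξ₃ lies within distance 1 of -ξ₁ or -ξ₂, so half of the
derivative can be moved to that factor; what remains is an average over a unit ball, and this part
even lies in L² (`eLpNorm_resonantPart_le`).

The blocks have two basic bounds. Write h_N = N^{1/2}‖P_N w‖_{L²}, a square summable sequence. (a)
With one factor in L^∞ and two in L², both the L¹ norm and the supremum of the Fourier transform are
at most a multiple of N₃^{1/2} N₁^{-1/2} h_{N₃} h_{N₁} ‖P_{N₂}w‖_∞, or the same with N₁ and N₂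
exchanged. If N₃ ≲ N₁, a Schur test sums over N₁ and N₃ (`tsum_schur_le`), and summability of the
L^∞ norms sums over N₂. (b) With two factors in L^∞, the L² norm is at most a multiple of N₃^{1/2}
h_{N₃} ‖P_{N₁}w‖_∞ ‖P_{N₂}w‖_∞.

Σ₂ is estimated by (a) for each fixed N; nothing is gained in N, which is why the norm is B^0_{1,∞}.
Σ₁ is estimated by (b), with an ℓ² sum over N ∼ N₃. Every other nonzero block has N₃ ≲ N₁ and N ≲
N₂, or the same with N₁ and N₂ exchanged, or N₃ ≲ N ≲ max(N₁, N₂) (`quad_cases`). In all these cases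
N is controlled by the frequency of a factor placed in L^∞, and the decay of its norm pays for the
additional N^δ.

To have only one power of the larger norm in a cubic bound, `blockSup_le` interpolates between
Bernstein's inequality and the Besov norm: ‖P_N w‖_∞ ≲ L N^{-4δ} with L² = H(H + B), where H and B
are the H^{1/2} and B^ε_{∞,1} norms. Then two factors in L^∞ cost L², linear in H + B, and one costs
L ≤ H + B. Statement (1) is (2) for one choice of A and D. -/

open scoped FourierTransform SchwartzMap

/-! ### Invariance of the frequency measure, for the line and the torus together -/

/-- The frequencies of the domain: all of `ℝ` for the line, `ℤ` for the torus. -/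
def IsFreq : Domain → ℝ → Prop
  | .line, _ => True
  | .torus, ξ => ∃ n : ℤ, ξ = n

lemma IsFreq.sub {M : Domain} {a b : ℝ} (ha : IsFreq M a) (hb : IsFreq M b) :
    IsFreq M (a - b) := by
  cases M with
  | line => trivial
  | torus =>
    obtain ⟨m, rfl⟩ := ha
    obtain ⟨n, rfl⟩ := hb
    exact ⟨m - n, by push_cast; rfl⟩

lemma isFreq_zero (M : Domain) : IsFreq M 0 := by
  cases M with
  | line => trivial
  | torus => exact ⟨0, by simp⟩

lemma measurableEmbedding_intCast_real : MeasurableEmbedding (fun n : ℤ => (n : ℝ)) :=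
  Int.isClosedEmbedding_coe_real.measurableEmbedding

lemma freq_torus : Domain.torus.freq = Measure.map (fun n : ℤ => (n : ℝ)) Measure.count := by
  rw [Measure.count, Measure.map_sum measurableEmbedding_intCast_real.measurable.aemeasurable]
  simp only [Domain.freq]
  congr 1
  funext n
  rw [Measure.map_dirac' measurableEmbedding_intCast_real.measurable]

lemma ae_isFreq (M : Domain) : ∀ᵐ ξ ∂M.freq, IsFreq M ξ := by
  cases M with
  | line => exact Filter.Eventually.of_forall fun _ => trivial
  | torus =>
    rw [freq_torus, measurableEmbedding_intCast_real.ae_map_iff]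
    exact Filter.Eventually.of_forall fun n => ⟨n, rfl⟩

/-- On the torus the reflection preserves ℤ only if ξ is an integer. This is why pointwise estimates
are stated under `IsFreq`, which holds almost everywhere by `ae_isFreq`. -/
lemma measurePreserving_sub_left_freq {M : Domain} {ξ : ℝ} (hξ : IsFreq M ξ) :
    MeasurePreserving (fun ζ => ξ - ζ) M.freq M.freq := by
  cases M with
  | line => exact Measure.measurePreserving_sub_left volume ξ
  | torus =>
    obtain ⟨m, rfl⟩ := hξ
    refine ⟨by fun_prop, ?_⟩
    rw [freq_torus, Measure.map_map (by fun_prop) (by fun_prop)]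
    have h : (fun ζ : ℝ => (m : ℝ) - ζ) ∘ (fun n : ℤ => (n : ℝ)) =
        (fun n : ℤ => (n : ℝ)) ∘ (Equiv.subLeft m) := by
      funext n; simp
    rw [h, ← Measure.map_map (by fun_prop) (by fun_prop)]
    congr 1
    ext s hs
    rw [Measure.map_apply (by fun_prop) hs, Measure.count_apply (by measurability),
      Measure.count_apply hs, ← Equiv.image_symm_eq_preimage]
    exact congrArg _ ((Equiv.subLeft m).symm.injective.encard_image s)

lemma measurePreserving_neg_freq (M : Domain) :
    MeasurePreserving (fun ζ => -ζ) M.freq M.freq := by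
  simpa using measurePreserving_sub_left_freq (isFreq_zero M)

lemma measurePreserving_sub_right_freq {M : Domain} {ζ : ℝ} (hζ : IsFreq M ζ) :
    MeasurePreserving (fun ξ => ξ - ζ) M.freq M.freq := by
  have h := (measurePreserving_neg_freq M).comp (measurePreserving_sub_left_freq hζ)
  have e : (fun ζ => -ζ) ∘ (fun ξ => ζ - ξ) = fun ξ : ℝ => ξ - ζ := by funext ξ; simp
  rwa [e] at h

lemma measurableEmbedding_sub_left (ξ : ℝ) : MeasurableEmbedding (fun ζ : ℝ => ξ - ζ) :=
  (Homeomorph.subLeft ξ).measurableEmbedding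

lemma measurableEmbedding_sub_right (ξ : ℝ) : MeasurableEmbedding (fun ζ : ℝ => ζ - ξ) :=
  (Homeomorph.subRight ξ).measurableEmbedding

/-- The summand 1 accounts for counting both endpoints on ℤ; with it one bound serves both domains.
-/
lemma freq_Icc_le (M : Domain) (a b : ℝ) (hab : a ≤ b) :
    M.freq (Set.Icc a b) ≤ ENNReal.ofReal (b - a + 1) := by
  cases M with
  | line =>
    simp only [Domain.freq, Real.volume_Icc]
    exact ENNReal.ofReal_le_ofReal (by linarith)
  | torus =>
    rw [freq_torus, measurableEmbedding_intCast_real.map_apply]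
    have h : (fun n : ℤ => (n : ℝ)) ⁻¹' Set.Icc a b = ↑(Finset.Icc ⌈a⌉ ⌊b⌋) := by
      ext n; simp [Int.ceil_le, Int.le_floor]
    rw [h, Measure.count_apply_finset, Int.card_Icc, ← ENNReal.ofReal_natCast]
    apply ENNReal.ofReal_le_ofReal
    have h1 := Int.le_ceil a
    have h2 := Int.floor_le b
    have h3 : (((⌊b⌋ + 1 - ⌈a⌉).toNat : ℤ) : ℝ) ≤ b - a + 1 := by
      rw [Int.toNat_eq_max]
      push_cast
      apply max_le <;> linarith
    exact_mod_cast h3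

lemma freq_Ioo_unit_le (M : Domain) (ξ : ℝ) :
    M.freq {ζ | |ξ - ζ| < 1} ≤ 3 := by
  calc M.freq {ζ | |ξ - ζ| < 1} ≤ M.freq (Set.Icc (ξ - 1) (ξ + 1)) := by
        apply measure_mono
        intro ζ hζ
        have := abs_lt.1 (show |ξ - ζ| < 1 from hζ)
        constructor <;> linarith [this.1, this.2]
    _ ≤ ENNReal.ofReal (ξ + 1 - (ξ - 1) + 1) := freq_Icc_le M _ _ (by linarith)
    _ = 3 := by
        rw [show ξ + 1 - (ξ - 1) + 1 = 3 by ring]; norm_num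

instance isLocallyFiniteMeasure_freq (M : Domain) : IsLocallyFiniteMeasure M.freq :=
  ⟨fun x => ⟨Set.Icc (x - 1) (x + 1), Icc_mem_nhds (by linarith) (by linarith),
    (freq_Icc_le M _ _ (by linarith)).trans_lt ENNReal.ofReal_lt_top⟩⟩

instance sigmaFinite_freq (M : Domain) : SigmaFinite M.freq := inferInstance

instance sigmaFinite_space (M : Domain) : SigmaFinite M.space := by
  cases M <;> simp only [Domain.space] <;> infer_instance

/-- By Fubini, the preimage of a null set is null on almost every fibre. Functions known only up to
null sets may therefore be composed with differences of frequencies. -/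
lemma quasiMeasurePreserving_sub_freq (M : Domain) :
    Measure.QuasiMeasurePreserving (fun p : ℝ × ℝ => p.1 - p.2) (M.freq.prod M.freq) M.freq := by
  refine ⟨by fun_prop, Measure.AbsolutelyContinuous.mk fun s hs h0 => ?_⟩
  rw [Measure.map_apply (by fun_prop) hs,
    Measure.measure_prod_null (measurableSet_preimage (by fun_prop) hs)]
  filter_upwards [ae_isFreq M] with ξ hξ
  exact (measurePreserving_sub_left_freq hξ).measure_preimage hs.nullMeasurableSet |>.trans h0

/-! ### Convolutions of functions of bounded support and their inverse transforms -/

/-- The inverse Fourier transform `(2π)^{-1/2} ∫ h(ξ) e^{iξx} dξ`. -/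
noncomputable def invFT (M : Domain) (h : ℝ → ℂ) (x : ℝ) : ℂ :=
  ((Real.sqrt (2 * Real.pi))⁻¹ : ℂ) * ∫ ξ, h ξ * Complex.exp (Complex.I * ξ * x) ∂M.freq

lemma lpProj_eq_invFT (M : Domain) (η : ℝ → ℝ) (k : ℕ) (f : ℝ → ℂ) :
    lpProj M η k f = invFT M (localize η k f) := rfl

/-- Square integrable functions of bounded support on the set of frequencies. -/
structure BddL2 (M : Domain) (h : ℝ → ℂ) : Prop where
  memLp : MemLp h 2 M.freq
  supp : ∃ R : ℝ, ∀ ξ, R < |ξ| → h ξ = 0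

lemma BddL2.aesm {M : Domain} {h : ℝ → ℂ} (hh : BddL2 M h) : AEStronglyMeasurable h M.freq :=
  hh.memLp.1

lemma BddL2.integrable {M : Domain} {h : ℝ → ℂ} (hh : BddL2 M h) : Integrable h M.freq := by
  obtain ⟨R, hR⟩ := hh.supp
  have h1 : MemLp h 1 (M.freq.restrict (Set.Icc (-R) R)) := by
    have : IsFiniteMeasure (M.freq.restrict (Set.Icc (-R) R)) := by
      refine ⟨?_⟩
      rw [Measure.restrict_apply_univ]
      exact isCompact_Icc.measure_lt_top
    exact (hh.memLp.restrict _).mono_exponent (by norm_num)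
  rw [memLp_one_iff_integrable] at h1
  have h2 : IntegrableOn h (Set.Icc (-R) R) M.freq := h1
  rw [integrableOn_iff_integrable_of_support_subset] at h2
  · exact h2
  · intro ξ hξ
    by_contra hc
    refine hξ (hR ξ ?_)
    by_contra h3
    exact hc (abs_le.1 (not_lt.1 h3))

lemma BddL2.of_bound {M : Domain} {h : ℝ → ℂ} (hm : AEStronglyMeasurable h M.freq) (C R : ℝ)
    (hC : ∀ᵐ ξ ∂M.freq, ‖h ξ‖ ≤ C) (hR : ∀ ξ, R < |ξ| → h ξ = 0) : BddL2 M h := by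
  refine ⟨?_, R, hR⟩
  have hs : h = (Set.Icc (-R) R).indicator h := by
    funext ξ
    by_cases hξ : ξ ∈ Set.Icc (-R) R
    · rw [Set.indicator_of_mem hξ]
    · rw [Set.indicator_of_notMem hξ]
      apply hR
      by_contra h3
      exact hξ (abs_le.1 (not_lt.1 h3))
  rw [hs, memLp_indicator_iff_restrict measurableSet_Icc]
  have : IsFiniteMeasure (M.freq.restrict (Set.Icc (-R) R)) := by
    refine ⟨?_⟩
    rw [Measure.restrict_apply_univ]
    exact isCompact_Icc.measure_lt_top
  exact MemLp.of_bound hm.restrict C (ae_restrict_of_ae hC)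

lemma norm_cexp_I_mul (a b : ℝ) : ‖Complex.exp (Complex.I * a * b)‖ = 1 := by
  rw [show Complex.I * a * b = ((a * b : ℝ) : ℂ) * Complex.I by push_cast; ring]
  exact Complex.norm_exp_ofReal_mul_I _

lemma integrable_mul_cexp {M : Domain} {h : ℝ → ℂ} (hh : Integrable h M.freq) (x : ℝ) :
    Integrable (fun ξ : ℝ => h ξ * Complex.exp (Complex.I * ξ * x)) M.freq := by
  refine hh.mul_bdd (c := 1) ?_ (Filter.Eventually.of_forall fun ξ => (norm_cexp_I_mul ξ x).le)
  exact Continuous.aestronglyMeasurable (by fun_prop)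

lemma integrable_conv {M : Domain} {a b : ℝ → ℂ} (ha : Integrable a M.freq)
    (hb : Integrable b M.freq) :
    Integrable (fun p : ℝ × ℝ => a (p.1 - p.2) * b p.2) (M.freq.prod M.freq) := by
  have hm : AEStronglyMeasurable (fun p : ℝ × ℝ => a (p.1 - p.2) * b p.2)
      (M.freq.prod M.freq) :=
    (ha.1.comp_quasiMeasurePreserving (quasiMeasurePreserving_sub_freq M)).mul hb.1.comp_snd
  rw [integrable_prod_iff' hm]
  constructor
  · filter_upwards [ae_isFreq M] with ζ hζ
    exact ((measurePreserving_sub_right_freq hζ).integrable_comp_of_integrable ha).mul_const _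
  · have h : (fun ζ => ∫ ξ, ‖a (ξ - ζ) * b ζ‖ ∂M.freq) =ᵐ[M.freq]
        fun ζ => (∫ ξ, ‖a ξ‖ ∂M.freq) * ‖b ζ‖ := by
      filter_upwards [ae_isFreq M] with ζ hζ
      simp only [norm_mul, integral_mul_const]
      congr 1
      exact (measurePreserving_sub_right_freq hζ).integral_comp
        (measurableEmbedding_sub_right ζ) (fun ξ => ‖a ξ‖)
    exact (hb.norm.const_mul _).congr h.symm

/-- Fubini's theorem and a translation of the inner variable. The factor (2π)^{-1/2} in `fourierMul`
makes the identity exact. -/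
lemma invFT_fourierMul {M : Domain} {a b : ℝ → ℂ} (ha : Integrable a M.freq)
    (hb : Integrable b M.freq) (x : ℝ) :
    invFT M (fourierMul M a b) x = invFT M a x * invFT M b x := by
  unfold invFT fourierMul
  have h1 : ∀ ξ : ℝ, ((Real.sqrt (2 * Real.pi))⁻¹ : ℂ) * (∫ ζ, a (ξ - ζ) * b ζ ∂M.freq) *
      Complex.exp (Complex.I * ξ * x) = ((Real.sqrt (2 * Real.pi))⁻¹ : ℂ) *
        ∫ ζ, (a (ξ - ζ) * b ζ) * Complex.exp (Complex.I * ξ * x) ∂M.freq := by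
    intro ξ
    rw [integral_mul_const, mul_assoc]
  simp only [h1]
  rw [integral_const_mul, integral_integral_swap]
  · have h2 : ∀ᵐ ζ ∂M.freq, ∫ ξ, a (ξ - ζ) * b ζ * Complex.exp (Complex.I * ξ * x) ∂M.freq =
        (∫ ξ, a ξ * Complex.exp (Complex.I * ξ * x) ∂M.freq) *
          (b ζ * Complex.exp (Complex.I * ζ * x)) := by
      filter_upwards [ae_isFreq M] with ζ hζ
      rw [← (measurePreserving_sub_right_freq hζ).integral_comp
        (measurableEmbedding_sub_right ζ) (fun ξ : ℝ => a ξ * Complex.exp (Complex.I * ξ * x)),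
        ← integral_mul_const]
      congr 1
      funext ξ
      rw [show Complex.I * (ξ : ℂ) * x = Complex.I * ((ξ - ζ : ℝ) : ℂ) * x + Complex.I * ζ * x by
        push_cast; ring, Complex.exp_add]
      ring
    rw [integral_congr_ae h2, integral_const_mul]
    ring
  · refine (integrable_conv ha hb).mul_bdd (c := 1) ?_
      (Filter.Eventually.of_forall fun p => (norm_cexp_I_mul p.1 x).le)
    exact Continuous.aestronglyMeasurable (by fun_prop)

lemma fourierMul_comm {M : Domain} (a b : ℝ → ℂ) {ξ : ℝ} (hξ : IsFreq M ξ) :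
    fourierMul M a b ξ = fourierMul M b a ξ := by
  unfold fourierMul
  congr 1
  rw [← (measurePreserving_sub_left_freq hξ).integral_comp (measurableEmbedding_sub_left ξ)]
  congr 1
  funext ζ
  rw [sub_sub_cancel, mul_comm]

lemma norm_sqrt_two_pi_inv_le : ‖((Real.sqrt (2 * Real.pi))⁻¹ : ℂ)‖ₑ ≤ 1 := by
  have h : ‖((Real.sqrt (2 * Real.pi))⁻¹ : ℂ)‖ ≤ 1 := by
    rw [norm_inv, Complex.norm_real, Real.norm_of_nonneg (Real.sqrt_nonneg _)]
    apply inv_le_one_of_one_le₀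
    rw [Real.one_le_sqrt]
    linarith [Real.pi_gt_three]
  rw [← ofReal_norm]
  exact ENNReal.ofReal_le_one.2 h

lemma eLpNorm_comp_sub_left {M : Domain} {a : ℝ → ℂ} (ha : AEStronglyMeasurable a M.freq)
    (p : ℝ≥0∞) {ξ : ℝ} (hξ : IsFreq M ξ) :
    eLpNorm (fun ζ => a (ξ - ζ)) p M.freq = eLpNorm a p M.freq :=
  eLpNorm_comp_measurePreserving ha (measurePreserving_sub_left_freq hξ)

lemma lintegral_mul_le_eLpNorm_two {α : Type*} [MeasurableSpace α] {μ : Measure α} {a b : α → ℂ}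
    (ha : AEStronglyMeasurable a μ) (hb : AEStronglyMeasurable b μ) :
    ∫⁻ ζ, ‖a ζ‖ₑ * ‖b ζ‖ₑ ∂μ ≤ eLpNorm a 2 μ * eLpNorm b 2 μ := by
  have h := eLpNorm_smul_le_mul_eLpNorm (p := 2) (q := 2) (r := 1) hb ha
  rw [eLpNorm_one_eq_lintegral_enorm] at h
  simpa [enorm_mul] using h

lemma lintegral_conv_le {M : Domain} {a b : ℝ → ℂ} (ha : AEStronglyMeasurable a M.freq)
    (hb : AEStronglyMeasurable b M.freq) {ξ : ℝ} (hξ : IsFreq M ξ) :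
    ∫⁻ ζ, ‖a (ξ - ζ)‖ₑ * ‖b ζ‖ₑ ∂M.freq ≤ eLpNorm a 2 M.freq * eLpNorm b 2 M.freq := by
  rw [← eLpNorm_comp_sub_left ha 2 hξ]
  exact lintegral_mul_le_eLpNorm_two
    (ha.comp_measurePreserving (measurePreserving_sub_left_freq hξ)) hb

lemma enorm_fourierMul_le_lintegral {M : Domain} (a b : ℝ → ℂ) (ξ : ℝ) :
    ‖fourierMul M a b ξ‖ₑ ≤ ∫⁻ ζ, ‖a (ξ - ζ)‖ₑ * ‖b ζ‖ₑ ∂M.freq := by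
  unfold fourierMul
  rw [enorm_mul]
  calc _ ≤ 1 * ∫⁻ ζ, ‖a (ξ - ζ) * b ζ‖ₑ ∂M.freq := by
        gcongr
        · exact norm_sqrt_two_pi_inv_le
        · exact enorm_integral_le_lintegral_enorm _
    _ = _ := by simp only [one_mul, enorm_mul]

lemma enorm_fourierMul_le {M : Domain} {a b : ℝ → ℂ} (ha : AEStronglyMeasurable a M.freq)
    (hb : AEStronglyMeasurable b M.freq) {ξ : ℝ} (hξ : IsFreq M ξ) :
    ‖fourierMul M a b ξ‖ₑ ≤ eLpNorm a 2 M.freq * eLpNorm b 2 M.freq :=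
  (enorm_fourierMul_le_lintegral a b ξ).trans (lintegral_conv_le ha hb hξ)

lemma aesm_fourierMul {M : Domain} {a b : ℝ → ℂ} (ha : AEStronglyMeasurable a M.freq)
    (hb : AEStronglyMeasurable b M.freq) : AEStronglyMeasurable (fourierMul M a b) M.freq := by
  refine AEStronglyMeasurable.const_mul ?_ _
  exact AEStronglyMeasurable.integral_prod_right' (f := fun p : ℝ × ℝ => a (p.1 - p.2) * b p.2)
    ((ha.comp_quasiMeasurePreserving (quasiMeasurePreserving_sub_freq M)).mul hb.comp_snd)

lemma exists_of_fourierMul_ne_zero {M : Domain} {a b : ℝ → ℂ} {ξ : ℝ}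
    (h : fourierMul M a b ξ ≠ 0) : ∃ ζ, a (ξ - ζ) ≠ 0 ∧ b ζ ≠ 0 := by
  by_contra hc
  push Not at hc
  apply h
  unfold fourierMul
  have : ∀ ζ, a (ξ - ζ) * b ζ = 0 := fun ζ => by
    by_cases h0 : a (ξ - ζ) = 0
    · rw [h0, zero_mul]
    · rw [hc ζ h0, mul_zero]
  simp [this]

/-- The convolution is bounded by Cauchy–Schwarz and has bounded support, so it is again square
integrable. This stability permits iterated products. -/
lemma BddL2.fourierMul {M : Domain} {a b : ℝ → ℂ} (ha : BddL2 M a) (hb : BddL2 M b) :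
    BddL2 M (fourierMul M a b) := by
  obtain ⟨R, hR⟩ := ha.supp
  obtain ⟨S, hS⟩ := hb.supp
  refine BddL2.of_bound (aesm_fourierMul ha.aesm hb.aesm)
    (eLpNorm a 2 M.freq * eLpNorm b 2 M.freq).toReal (R + S) ?_ ?_
  · filter_upwards [ae_isFreq M] with ξ hξ
    rw [← toReal_enorm]
    exact ENNReal.toReal_mono (ENNReal.mul_ne_top ha.memLp.2.ne hb.memLp.2.ne)
      (enorm_fourierMul_le ha.aesm hb.aesm hξ)
  · intro ξ hξ
    by_contra hc
    obtain ⟨ζ, h1, h2⟩ := exists_of_fourierMul_ne_zero hc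
    have h3 : |ξ - ζ| ≤ R := by
      by_contra h; exact h1 (hR _ (not_le.1 h))
    have h4 : |ζ| ≤ S := by
      by_contra h; exact h2 (hS _ (not_le.1 h))
    have := abs_add_le (ξ - ζ) ζ
    rw [sub_add_cancel] at this
    linarith

/-! ### Plancherel's identity on the line and on the torus -/

/-- The Fourier integral and the L² extension define the same distribution: against a test function
φ, both give ∫ φ̂ h. -/
lemma fourier_ae_eq_Lp {h : ℝ → ℂ} (h1 : Integrable h) (h2 : MemLp h 2) :
    𝓕 h =ᵐ[volume] (𝓕 (h2.toLp h) : Lp ℂ 2 (volume : Measure ℝ)) := by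
  apply ae_eq_of_integral_contDiff_smul_eq
  · exact (VectorFourier.fourierIntegral_continuous Real.continuous_fourierChar
      (L := innerₗ ℝ) continuous_inner h1).locallyIntegrable
  · exact (Lp.memLp _).locallyIntegrable (by norm_num)
  intro g hg hgs
  have hgs' : HasCompactSupport (fun x => (g x : ℂ)) :=
    hgs.comp_left (g := fun y : ℝ => (y : ℂ)) (by simp)
  have hg' : ContDiff ℝ ((⊤ : ℕ∞) : WithTop ℕ∞) (fun x => (g x : ℂ)) :=
    Complex.ofRealCLM.contDiff.comp hg
  let φ : 𝓢(ℝ, ℂ) := hgs'.toSchwartzMap hg'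
  have h3 := congrArg (fun T => T φ) (Lp.fourier_toTemperedDistribution_eq (h2.toLp h))
  simp only [TemperedDistribution.fourier_apply, Lp.toTemperedDistribution_apply] at h3
  have h4 : ∫ x, g x • 𝓕 h x = ∫ x, φ x • 𝓕 h x := rfl
  have h5 : ∫ x, g x • (𝓕 (h2.toLp h) : Lp ℂ 2 (volume : Measure ℝ)) x =
      ∫ x, φ x • (𝓕 (h2.toLp h) : Lp ℂ 2 (volume : Measure ℝ)) x := rfl
  rw [h4, h5, ← h3]
  have h6 : ∫ x, (𝓕 φ) x • (h2.toLp h) x = ∫ x, (𝓕 φ) x • h x := by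
    apply integral_congr_ae
    filter_upwards [h2.coeFn_toLp] with x hx
    rw [hx]
  rw [h6]
  symm
  have := VectorFourier.integral_fourierIntegral_smul_eq_flip (L := innerₗ ℝ) (f := φ) (g := h) (μ := volume) (ν := volume)
    Real.continuous_fourierChar continuous_inner φ.integrable h1
  simpa using! this

lemma eLpNorm_fourier_eq {h : ℝ → ℂ} (h1 : Integrable h) (h2 : MemLp h 2) :
    eLpNorm (𝓕 h) 2 volume = eLpNorm h 2 volume := by
  rw [eLpNorm_congr_ae (fourier_ae_eq_Lp h1 h2), ← eLpNorm_congr_ae h2.coeFn_toLp,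
    ← Lp.enorm_def, ← Lp.enorm_def, ← ofReal_norm, ← ofReal_norm, Lp.norm_fourier_eq]

lemma eLpNorm_two_comp_mul_left {g : ℝ → ℂ} (hg : AEStronglyMeasurable g) {a : ℝ} (ha : a ≠ 0) :
    eLpNorm (fun x => g (a * x)) 2 volume =
      ENNReal.ofReal |a⁻¹| ^ (1 / 2 : ℝ) * eLpNorm g 2 volume := by
  have h := Real.map_volume_mul_left ha
  have hg' : AEStronglyMeasurable g (Measure.map (fun x => a * x) volume) := by
    rw [h]; exact hg.smul_measure _
  have h2 := eLpNorm_map_measure (p := 2) hg' (by fun_prop)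
  rw [h, eLpNorm_smul_measure_of_ne_top (by norm_num)] at h2
  rw [show (fun x => g (a * x)) = g ∘ fun x => a * x from rfl, ← h2]
  simp

lemma eLpNorm_invFT_line {h : ℝ → ℂ} (hh : BddL2 .line h) :
    eLpNorm (invFT .line h) 2 Domain.line.space = eLpNorm h 2 Domain.line.freq := by
  have h1 : Integrable h volume := hh.integrable
  have h2 : MemLp h 2 volume := hh.memLp
  have hc : Continuous (𝓕 h) := VectorFourier.fourierIntegral_continuous
    Real.continuous_fourierChar (L := innerₗ ℝ) continuous_inner h1
  -- The kernel e^{iξx} is Mathlib's kernel at the point -x/(2π). The dilation contributes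
  -- (2π)^{1/2} to the L² norm and cancels the prefactor.
  have e : invFT .line h = ((Real.sqrt (2 * Real.pi))⁻¹ : ℂ) •
      fun x => 𝓕 h (-(2 * Real.pi)⁻¹ * x) := by
    funext x
    simp only [invFT, Domain.freq, Pi.smul_apply, smul_eq_mul]
    congr 1
    rw [Real.fourier_eq']
    congr 1
    funext ξ
    rw [smul_eq_mul, mul_comm]
    congr 2
    simp only [RCLike.inner_apply, conj_trivial]
    push_cast
    field_simp
  rw [e, eLpNorm_const_smul]
  simp only [Domain.space, Domain.freq]
  rw [eLpNorm_two_comp_mul_left hc.aestronglyMeasurable (by simp [Real.pi_ne_zero]),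
    eLpNorm_fourier_eq h1 h2, ← mul_assoc]
  have hp := Real.pi_pos
  have : ‖((Real.sqrt (2 * Real.pi))⁻¹ : ℂ)‖ₑ *
      ENNReal.ofReal |(-(2 * Real.pi)⁻¹)⁻¹| ^ (1 / 2 : ℝ) = 1 := by
    rw [← ofReal_norm, norm_inv, Complex.norm_real, Real.norm_of_nonneg (Real.sqrt_nonneg _),
      ENNReal.ofReal_rpow_of_nonneg (abs_nonneg _) (by norm_num),
      ← ENNReal.ofReal_mul (by positivity), ← Real.sqrt_eq_rpow]
    rw [inv_neg, inv_inv, abs_neg, abs_of_pos (by positivity), inv_mul_cancel₀ (by positivity)]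
    simp
  rw [this, one_mul]

lemma lintegral_freq_torus (F : ℝ → ℝ≥0∞) : ∫⁻ ξ, F ξ ∂Domain.torus.freq = ∑' n : ℤ, F n := by
  rw [freq_torus, measurableEmbedding_intCast_real.lintegral_map, lintegral_count]

lemma integral_freq_torus {F : ℝ → ℂ} (s : Finset ℤ) (hs : ∀ n : ℤ, n ∉ s → F n = 0) :
    ∫ ξ, F ξ ∂Domain.torus.freq = ∑ n ∈ s, F n := by
  rw [freq_torus, measurableEmbedding_intCast_real.integral_map]
  have hi : Integrable (fun n : ℤ => F n) Measure.count := by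
    refine ⟨(measurable_of_countable _).aestronglyMeasurable, hasFiniteIntegral_count_iff.2 ?_⟩
    exact summable_of_ne_finset_zero (s := s) fun n hn => by rw [hs n hn, norm_zero]
  rw [integral_countable hi, tsum_eq_sum (s := s)]
  · simp [Measure.real]
  · intro n hn
    rw [hs n hn, smul_zero]

lemma integral_cexp_int_sub (n m : ℤ) :
    ∫ x in Set.Ioc 0 (2 * Real.pi), Complex.exp (Complex.I * ((n - m : ℤ) : ℂ) * x) =
      if n = m then ((2 * Real.pi : ℝ) : ℂ) else 0 := by
  rw [← intervalIntegral.integral_of_le (by positivity)]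
  split_ifs with h
  · subst h; simp
  · have hc : Complex.I * ((n - m : ℤ) : ℂ) ≠ 0 :=
      mul_ne_zero Complex.I_ne_zero (by exact_mod_cast sub_ne_zero.2 h)
    rw [integral_exp_mul_complex hc]
    have : Complex.exp (Complex.I * ((n - m : ℤ) : ℂ) * ((2 * Real.pi : ℝ) : ℂ)) = 1 := by
      rw [show Complex.I * ((n - m : ℤ) : ℂ) * ((2 * Real.pi : ℝ) : ℂ) =
        ((n - m : ℤ) : ℂ) * (2 * Real.pi * Complex.I) by push_cast; ring]
      exact Complex.exp_int_mul_two_pi_mul_I _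
    rw [this]; simp

lemma integral_norm_sq_trigPoly (s : Finset ℤ) (a : ℤ → ℂ) :
    ∫ x in Set.Ioc 0 (2 * Real.pi), ‖∑ n ∈ s, a n * Complex.exp (Complex.I * n * x)‖ ^ 2 =
      2 * Real.pi * ∑ n ∈ s, ‖a n‖ ^ 2 := by
  have key : ∫ x in Set.Ioc 0 (2 * Real.pi),
      ((‖∑ n ∈ s, a n * Complex.exp (Complex.I * n * x)‖ ^ 2 : ℝ) : ℂ) =
      ((2 * Real.pi * ∑ n ∈ s, ‖a n‖ ^ 2 : ℝ) : ℂ) := by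
    have h1 : ∀ x : ℝ, ((‖∑ n ∈ s, a n * Complex.exp (Complex.I * n * x)‖ ^ 2 : ℝ) : ℂ) =
        ∑ n ∈ s, ∑ m ∈ s, a n * (starRingEnd ℂ) (a m) *
          Complex.exp (Complex.I * ((n - m : ℤ) : ℂ) * x) := by
      intro x
      push_cast
      rw [← Complex.mul_conj', map_sum, Finset.sum_mul_sum]
      refine Finset.sum_congr rfl fun n _ => Finset.sum_congr rfl fun m _ => ?_
      rw [map_mul, ← Complex.exp_conj]
      simp only [map_mul, Complex.conj_I, map_intCast, Complex.conj_ofReal]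
      rw [show Complex.I * ((n : ℂ) - m) * x = Complex.I * n * x + -Complex.I * m * x by ring,
        Complex.exp_add]
      ring
    simp only [h1]
    have hi : ∀ n m : ℤ, Integrable (fun x : ℝ => a n * (starRingEnd ℂ) (a m) *
        Complex.exp (Complex.I * ((n - m : ℤ) : ℂ) * x))
        (volume.restrict (Set.Ioc 0 (2 * Real.pi))) := fun n m =>
      ((Continuous.integrableOn_Icc (by fun_prop)).mono_set Set.Ioc_subset_Icc_self)
    rw [integral_finsetSum _ fun n _ => integrable_finsetSum _ fun m _ => hi n m]
    rw [Complex.ofReal_mul, Complex.ofReal_sum, Finset.mul_sum]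
    refine Finset.sum_congr rfl fun n hn => ?_
    rw [integral_finsetSum _ fun m _ => hi n m]
    simp only [integral_const_mul, integral_cexp_int_sub, mul_ite, mul_zero]
    rw [Finset.sum_ite_eq s n, if_pos hn, Complex.mul_conj']
    push_cast; ring
  rw [integral_complex_ofReal] at key
  exact_mod_cast key

/-- Bounded support leaves finitely many integer frequencies, so orthogonality of the exponentials
in a trigonometric polynomial suffices. -/
lemma eLpNorm_invFT_torus {h : ℝ → ℂ} (hh : BddL2 .torus h) :
    eLpNorm (invFT .torus h) 2 Domain.torus.space = eLpNorm h 2 Domain.torus.freq := by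
  obtain ⟨R, hR⟩ := hh.supp
  set s : Finset ℤ := Finset.Icc ⌈-R⌉ ⌊R⌋ with hs
  have hs0 : ∀ n : ℤ, n ∉ s → h n = 0 := by
    intro n hn
    apply hR
    by_contra hc
    rw [not_lt, abs_le] at hc
    exact hn (Finset.mem_Icc.2 ⟨Int.ceil_le.2 hc.1, Int.le_floor.2 hc.2⟩)
  have e : ∀ x, invFT .torus h x = ((Real.sqrt (2 * Real.pi))⁻¹ : ℂ) *
      ∑ n ∈ s, h n * Complex.exp (Complex.I * n * x) := by
    intro x
    unfold invFT
    rw [integral_freq_torus s fun n hn => by rw [hs0 n hn, zero_mul]]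
    simp
  have hp := Real.pi_pos
  have hL : ∫⁻ x, ‖invFT .torus h x‖ₑ ^ (2 : ℝ) ∂Domain.torus.space =
      ENNReal.ofReal (∑ n ∈ s, ‖h n‖ ^ 2) := by
    have h1 : ∀ x, ‖invFT .torus h x‖ₑ ^ (2 : ℝ) = ENNReal.ofReal ((2 * Real.pi)⁻¹ *
        ‖∑ n ∈ s, h n * Complex.exp (Complex.I * n * x)‖ ^ 2) := by
      intro x
      rw [e, ← ofReal_norm, ENNReal.ofReal_rpow_of_nonneg (norm_nonneg _) (by norm_num),
        norm_mul, norm_inv, Complex.norm_real, Real.norm_of_nonneg (Real.sqrt_nonneg _)]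
      congr 1
      rw [Real.rpow_two, mul_pow, inv_pow, Real.sq_sqrt (by positivity)]
    simp only [h1, Domain.space]
    rw [← ofReal_integral_eq_lintegral_ofReal, integral_const_mul, integral_norm_sq_trigPoly,
      inv_mul_cancel_left₀ (by positivity)]
    · exact ((Continuous.integrableOn_Icc (by fun_prop)).mono_set Set.Ioc_subset_Icc_self)
    · exact Filter.Eventually.of_forall fun x => by positivity
  rw [eLpNorm_eq_lintegral_rpow_enorm_toReal (by norm_num) (by norm_num),
    eLpNorm_eq_lintegral_rpow_enorm_toReal (by norm_num) (by norm_num)]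
  congr 1
  rw [ENNReal.toReal_ofNat, hL, lintegral_freq_torus, tsum_eq_sum (s := s)]
  · rw [ENNReal.ofReal_sum_of_nonneg fun n _ => by positivity]
    refine Finset.sum_congr rfl fun n _ => ?_
    rw [← ofReal_norm, ENNReal.ofReal_rpow_of_nonneg (norm_nonneg _) (by norm_num), Real.rpow_two]
  · intro n hn
    rw [hs0 n hn]; simp

/-- Plancherel's theorem for square integrable functions of bounded support. -/
lemma eLpNorm_invFT {M : Domain} {h : ℝ → ℂ} (hh : BddL2 M h) :
    eLpNorm (invFT M h) 2 M.space = eLpNorm h 2 M.freq := by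
  cases M with
  | line => exact eLpNorm_invFT_line hh
  | torus => exact eLpNorm_invFT_torus hh

/-! ### The cutoff and its convolution kernel -/

/-- A smooth function with `1_{[-5/4,5/4]} ≤ η ≤ 1_{[-8/5,8/5]}`. -/
structure IsCutoff (η : ℝ → ℝ) : Prop where
  smooth : ContDiff ℝ ((⊤ : ℕ∞) : WithTop ℕ∞) η
  lower : ∀ x, (Set.Icc (-(5 / 4 : ℝ)) (5 / 4)).indicator (fun _ => (1 : ℝ)) x ≤ η x
  upper : ∀ x, η x ≤ (Set.Icc (-(8 / 5 : ℝ)) (8 / 5)).indicator (fun _ => (1 : ℝ)) x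

namespace IsCutoff

variable {η : ℝ → ℝ}

lemma nonneg (hη : IsCutoff η) (x : ℝ) : 0 ≤ η x :=
  (Set.indicator_nonneg (fun _ _ => zero_le_one) x).trans (hη.lower x)

lemma le_one (hη : IsCutoff η) (x : ℝ) : η x ≤ 1 :=
  (hη.upper x).trans (Set.indicator_le_self' (fun _ _ => zero_le_one) x)

lemma eq_one (hη : IsCutoff η) {x : ℝ} (hx : |x| ≤ 5 / 4) : η x = 1 := by
  refine le_antisymm (hη.le_one x) ?_
  have := hη.lower x
  rwa [Set.indicator_of_mem (show x ∈ Set.Icc (-(5 / 4 : ℝ)) (5 / 4) from abs_le.1 hx)] at this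

lemma eq_zero (hη : IsCutoff η) {x : ℝ} (hx : 8 / 5 < |x|) : η x = 0 := by
  refine le_antisymm ?_ (hη.nonneg x)
  have := hη.upper x
  rwa [Set.indicator_of_notMem (show x ∉ Set.Icc (-(8 / 5 : ℝ)) (8 / 5) from
    fun h => absurd (abs_le.2 h) (not_le.2 hx))] at this

/-- The kink of |ξ| at the origin is harmless because η equals 1 near 0. -/
lemma contDiff_comp_abs (hη : IsCutoff η) :
    ContDiff ℝ ((⊤ : ℕ∞) : WithTop ℕ∞) (fun ξ => η |ξ|) := by
  rw [contDiff_iff_contDiffAt]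
  intro ξ
  by_cases h : ξ = 0
  · subst h
    have : (fun ξ => η |ξ|) =ᶠ[nhds 0] fun _ => 1 := by
      filter_upwards [Metric.ball_mem_nhds (0 : ℝ) one_pos] with x hx
      rw [Metric.mem_ball, dist_zero_right, Real.norm_eq_abs] at hx
      exact hη.eq_one (by rw [abs_abs]; linarith)
    exact contDiffAt_const.congr_of_eventuallyEq this
  · exact hη.smooth.contDiffAt.comp ξ (contDiffAt_abs h)

lemma hasCompactSupport_comp_abs (hη : IsCutoff η) : HasCompactSupport (fun ξ => η |ξ|) := by
  refine HasCompactSupport.intro (K := Set.Icc (-(8 / 5)) (8 / 5)) isCompact_Icc fun x hx => ?_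
  apply hη.eq_zero
  rw [abs_abs]
  by_contra hc
  exact hx (abs_le.1 (not_lt.1 hc))

/-- η(|ξ|) is a test function, hence the Fourier transform of an integrable Schwartz function. It is
thus a superposition of characters, and as a multiplier it averages translates. -/
lemma exists_kernel (hη : IsCutoff η) : ∃ K : ℝ → ℂ, Integrable K ∧ Continuous K ∧ ∀ ξ : ℝ,
    ((η |ξ| : ℝ) : ℂ) = ∫ y, K y * Complex.exp (Complex.I * ξ * (-(2 * Real.pi * y) : ℝ)) := by
  have h1 : HasCompactSupport (fun ξ => ((η |ξ| : ℝ) : ℂ)) :=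
    hη.hasCompactSupport_comp_abs.comp_left (g := fun y : ℝ => (y : ℂ)) (by simp)
  have h2 : ContDiff ℝ ((⊤ : ℕ∞) : WithTop ℕ∞) (fun ξ => ((η |ξ| : ℝ) : ℂ)) :=
    Complex.ofRealCLM.contDiff.comp hη.contDiff_comp_abs
  let φ : 𝓢(ℝ, ℂ) := h1.toSchwartzMap h2
  refine ⟨(𝓕⁻ φ : 𝓢(ℝ, ℂ)), (𝓕⁻ φ).integrable, (𝓕⁻ φ).continuous, fun ξ => ?_⟩
  have h3 : ((η |ξ| : ℝ) : ℂ) = φ ξ := rfl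
  rw [h3]
  have h4 : φ = 𝓕 (𝓕⁻ φ : 𝓢(ℝ, ℂ)) := (FourierTransform.fourier_fourierInv_eq φ).symm
  rw [h4, SchwartzMap.fourier_coe, Real.fourier_eq', ← h4]
  congr 1
  funext y
  rw [smul_eq_mul, mul_comm]
  congr 2
  simp only [RCLike.inner_apply, conj_trivial]
  push_cast
  ring

end IsCutoff

/-! ### L¹ bounds for dilated cutoffs -/

lemma continuous_invFT {M : Domain} {h : ℝ → ℂ} (hh : Integrable h M.freq) :
    Continuous (invFT M h) := by
  refine Continuous.mul continuous_const ?_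
  refine continuous_of_dominated (bound := fun ξ => ‖h ξ‖) ?_ ?_ hh.norm ?_
  · exact fun x => (integrable_mul_cexp hh x).1
  · intro x
    refine Filter.Eventually.of_forall fun ξ => ?_
    rw [norm_mul, norm_cexp_I_mul, mul_one]
  · exact Filter.Eventually.of_forall fun ξ => by fun_prop

lemma periodic_invFT_torus (h : ℝ → ℂ) : Function.Periodic (invFT .torus h) (2 * Real.pi) := by
  intro x
  unfold invFT
  congr 1
  apply integral_congr_ae
  filter_upwards [ae_isFreq .torus] with ξ hξ
  obtain ⟨n, rfl⟩ := hξ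
  congr 1
  rw [Complex.exp_eq_exp_iff_exists_int]
  exact ⟨n, by push_cast; ring⟩

/-- The torus is modelled by a fundamental domain, which translations do not preserve; the integral
is invariant because integer frequencies make the function 2π-periodic. -/
lemma lintegral_invFT_sub {M : Domain} {h : ℝ → ℂ} (hh : Integrable h M.freq) (s : ℝ) :
    ∫⁻ x, ‖invFT M h (x - s)‖ₑ ∂M.space = ∫⁻ x, ‖invFT M h x‖ₑ ∂M.space := by
  have hc := continuous_invFT hh
  cases M with
  | line => exact lintegral_sub_right_eq_self (μ := volume) (fun x => ‖invFT .line h x‖ₑ) s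
  | torus =>
    have hp := Real.pi_pos
    have key : ∀ u : ℝ → ℂ, Continuous u → ∫⁻ x, ‖u x‖ₑ ∂Domain.torus.space =
        ENNReal.ofReal (∫ x in (0 : ℝ)..(2 * Real.pi), ‖u x‖) := by
      intro u hu
      rw [intervalIntegral.integral_of_le (by positivity),
        ofReal_integral_norm_eq_lintegral_enorm]
      · rfl
      · exact hu.integrableOn_Icc.mono_set Set.Ioc_subset_Icc_self
    rw [key _ (by fun_prop), key _ hc,
      intervalIntegral.integral_comp_sub_right (fun x => ‖invFT .torus h x‖) s]
    have hper : Function.Periodic (fun x => ‖invFT .torus h x‖) (2 * Real.pi) := fun x => by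
      simp only [periodic_invFT_torus h x]
    have := hper.intervalIntegral_add_eq (0 - s) 0
    rw [zero_add] at this
    rw [← this]
    congr 2
    ring

lemma invFT_dilate_cutoff {M : Domain} {η : ℝ → ℝ} {K : ℝ → ℂ} (hK : Integrable K)
    (hKη : ∀ ξ : ℝ, ((η |ξ| : ℝ) : ℂ) =
      ∫ y, K y * Complex.exp (Complex.I * ξ * (-(2 * Real.pi * y) : ℝ)))
    {h : ℝ → ℂ} (hh : Integrable h M.freq) (r : ℝ) (x : ℝ) :
    invFT M (fun ξ => ((η |ξ * r| : ℝ) : ℂ) * h ξ) x =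
      ∫ y, K y * invFT M h (x - 2 * Real.pi * y * r) := by
  unfold invFT
  have h1 : ∀ ξ : ℝ, ((η |ξ * r| : ℝ) : ℂ) * h ξ * Complex.exp (Complex.I * ξ * x) =
      ∫ y, K y * (h ξ * Complex.exp (Complex.I * ξ * (x - 2 * Real.pi * y * r : ℝ))) := by
    intro ξ
    rw [hKη, mul_assoc, ← integral_mul_const]
    congr 1
    funext y
    rw [show Complex.I * (ξ : ℂ) * (x - 2 * Real.pi * y * r : ℝ) =
      Complex.I * (ξ * r : ℝ) * (-(2 * Real.pi * y) : ℝ) + Complex.I * ξ * x by push_cast; ring,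
      Complex.exp_add]
    ring
  simp only [h1]
  rw [integral_integral_swap, ← integral_const_mul]
  · congr 1
    funext y
    rw [integral_const_mul]
    ring
  · have h2 := hh.mul_prod hK
    have h3 : Integrable (fun p : ℝ × ℝ => h p.1 * K p.2 *
        Complex.exp (Complex.I * p.1 * (x - 2 * Real.pi * p.2 * r : ℝ)))
        (M.freq.prod volume) := by
      refine h2.mul_bdd (c := 1) ?_
        (Filter.Eventually.of_forall fun p => (norm_cexp_I_mul p.1 _).le)
      exact Continuous.aestronglyMeasurable (by fun_prop)
    refine h3.congr (Filter.Eventually.of_forall fun p => ?_)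
    simp only [Function.uncurry]
    ring

/-- The dilation parameter r only rescales the translations, which do not change the L¹ norm. The
bound ‖K‖_{L¹} is therefore uniform in r. -/
lemma lintegral_invFT_dilate_cutoff_le {M : Domain} {η : ℝ → ℝ} {K : ℝ → ℂ} (hK : Integrable K)
    (hKη : ∀ ξ : ℝ, ((η |ξ| : ℝ) : ℂ) =
      ∫ y, K y * Complex.exp (Complex.I * ξ * (-(2 * Real.pi * y) : ℝ)))
    {h : ℝ → ℂ} (hh : Integrable h M.freq) (r : ℝ) :
    ∫⁻ x, ‖invFT M (fun ξ => ((η |ξ * r| : ℝ) : ℂ) * h ξ) x‖ₑ ∂M.space ≤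
      (∫⁻ y, ‖K y‖ₑ) * ∫⁻ x, ‖invFT M h x‖ₑ ∂M.space := by
  have hc := continuous_invFT hh
  calc ∫⁻ x, ‖invFT M (fun ξ => ((η |ξ * r| : ℝ) : ℂ) * h ξ) x‖ₑ ∂M.space
      ≤ ∫⁻ x, (∫⁻ y, ‖K y‖ₑ * ‖invFT M h (x - 2 * Real.pi * y * r)‖ₑ) ∂M.space := by
        refine lintegral_mono fun x => ?_
        rw [invFT_dilate_cutoff hK hKη hh]
        refine (enorm_integral_le_lintegral_enorm _).trans_eq ?_
        simp only [enorm_mul]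
    _ = ∫⁻ y, (∫⁻ x, ‖K y‖ₑ * ‖invFT M h (x - 2 * Real.pi * y * r)‖ₑ ∂M.space) := by
        rw [lintegral_lintegral_swap]
        have h1 : AEMeasurable (fun p : ℝ × ℝ => ‖K p.2‖ₑ) (M.space.prod volume) :=
          (hK.1.comp_snd (μ := M.space)).enorm
        have h2 : AEMeasurable (fun p : ℝ × ℝ => ‖invFT M h (p.1 - 2 * Real.pi * p.2 * r)‖ₑ)
            (M.space.prod volume) := (Continuous.aestronglyMeasurable (by fun_prop)).enorm
        exact h1.mul h2
    _ = ∫⁻ y, ‖K y‖ₑ * ∫⁻ x, ‖invFT M h x‖ₑ ∂M.space := by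
        refine lintegral_congr fun y => ?_
        rw [lintegral_const_mul _ (Continuous.measurable (by fun_prop)), lintegral_invFT_sub hh]
    _ = _ := lintegral_mul_const'' _ hK.1.enorm

/-! ### The dyadic partition of unity -/

lemma lpCutoff_succ_eq (η : ℝ → ℝ) (k : ℕ) (ξ : ℝ) :
    lpCutoff η (k + 1) ξ = η |ξ * (2 ^ (k + 1))⁻¹| - η |ξ * (2 ^ k)⁻¹| := by
  have h : (0 : ℝ) < 2 ^ k := by positivity
  rw [lpCutoff, abs_mul, abs_mul, abs_of_pos (inv_pos.2 h),
    abs_of_pos (inv_pos.2 (by positivity : (0 : ℝ) < 2 ^ (k + 1)))]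
  congr 2
  rw [pow_succ]
  field_simp

lemma sum_lpCutoff (η : ℝ → ℝ) (J : ℕ) (ξ : ℝ) :
    ∑ k ∈ Finset.range (J + 1), lpCutoff η k ξ = η |ξ * (2 ^ J)⁻¹| := by
  induction J with
  | zero => simp [lpCutoff]
  | succ n ih => rw [Finset.sum_range_succ, ih, lpCutoff_succ_eq]; ring

lemma lpCutoff_neg (η : ℝ → ℝ) (k : ℕ) (ξ : ℝ) : lpCutoff η k (-ξ) = lpCutoff η k ξ := by
  cases k <;> simp [lpCutoff]

namespace IsCutoff

variable {η : ℝ → ℝ}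

lemma continuous_lpCutoff (hη : IsCutoff η) (k : ℕ) : Continuous (lpCutoff η k) := by
  have h := hη.smooth.continuous
  cases k with
  | zero => exact h.comp continuous_abs
  | succ k => exact (h.comp (by fun_prop)).sub (h.comp (by fun_prop))

lemma abs_lpCutoff_le (hη : IsCutoff η) (k : ℕ) (ξ : ℝ) : |lpCutoff η k ξ| ≤ 1 := by
  cases k with
  | zero => exact abs_le.2 ⟨by linarith [hη.nonneg |ξ|, show lpCutoff η 0 ξ = η |ξ| from rfl],
      hη.le_one _⟩
  | succ k =>
    rw [lpCutoff_succ_eq, abs_le]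
    constructor <;> linarith [hη.nonneg |ξ * (2 ^ (k + 1))⁻¹|, hη.le_one |ξ * (2 ^ (k + 1))⁻¹|,
      hη.nonneg |ξ * (2 ^ k)⁻¹|, hη.le_one |ξ * (2 ^ k)⁻¹|]

lemma abs_le_of_lpCutoff_ne_zero (hη : IsCutoff η) {k : ℕ} {ξ : ℝ} (h : lpCutoff η k ξ ≠ 0) :
    |ξ| ≤ 8 / 5 * 2 ^ k := by
  by_contra hc
  rw [not_le] at hc
  apply h
  have hk : (0 : ℝ) < 2 ^ k := by positivity
  cases k with
  | zero => exact hη.eq_zero (by rw [abs_abs]; simpa using hc)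
  | succ k =>
    have h2 : (0 : ℝ) < 2 ^ k := by positivity
    rw [lpCutoff, hη.eq_zero, hη.eq_zero, sub_zero]
    · rw [abs_of_nonneg (by positivity), lt_div_iff₀ hk]
      linarith
    · rw [abs_of_nonneg (by positivity), lt_div_iff₀ hk]
      linarith

lemma le_abs_of_lpCutoff_ne_zero (hη : IsCutoff η) {k : ℕ} {ξ : ℝ}
    (h : lpCutoff η (k + 1) ξ ≠ 0) : 5 / 8 * 2 ^ (k + 1) ≤ |ξ| := by
  by_contra hc
  rw [not_le] at hc
  apply h
  have hk : (0 : ℝ) < 2 ^ (k + 1) := by positivity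
  rw [lpCutoff, hη.eq_one, hη.eq_one, sub_self]
  · rw [abs_of_nonneg (by positivity), div_le_iff₀ hk]
    linarith
  · rw [abs_of_nonneg (by positivity), div_le_iff₀ hk]
    linarith

lemma le_abs_of_lpCutoff_ne_zero' (hη : IsCutoff η) {k : ℕ} (hk : 1 ≤ k) {ξ : ℝ}
    (h : lpCutoff η k ξ ≠ 0) : 5 / 8 * 2 ^ k ≤ |ξ| := by
  obtain ⟨m, rfl⟩ : ∃ m, k = m + 1 := ⟨k - 1, by omega⟩
  exact hη.le_abs_of_lpCutoff_ne_zero h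

/-- If the sizes of two frequencies are related, so are their dyadic blocks. -/
lemma le_of_lpCutoff_ne_zero (hη : IsCutoff η) {k m : ℕ} {ξ : ℝ}
    (hm : lpCutoff η m ξ ≠ 0) (hk : lpCutoff η k ξ ≠ 0) : m ≤ k + 1 := by
  by_contra hc
  have h1 := hη.abs_le_of_lpCutoff_ne_zero hk
  have h2 := hη.le_abs_of_lpCutoff_ne_zero' (by omega) hm
  have h3 : (2 : ℝ) ^ (k + 2) ≤ 2 ^ m := pow_le_pow_right₀ (by norm_num) (by omega)
  rw [pow_add] at h3
  have h4 : (0 : ℝ) < 2 ^ k := by positivity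
  linarith

/-- The first block that sees ξ, and the one after it, are the only candidates: by
`le_of_lpCutoff_ne_zero`, two blocks that see the same frequency have adjacent or equal indices. -/
lemma exists_lpCutoff_eq_zero (hη : IsCutoff η) (ξ : ℝ) :
    ∃ j : ℕ, ∀ k, k ≠ j → k ≠ j + 1 → lpCutoff η k ξ = 0 := by
  classical
  by_cases h : ∃ k, lpCutoff η k ξ ≠ 0
  · refine ⟨Nat.find h, fun k h1 h2 => ?_⟩
    by_contra hk
    have h3 := hη.le_of_lpCutoff_ne_zero hk (Nat.find_spec h)
    have h4 := Nat.find_min' h hk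
    omega
  · push Not at h
    exact ⟨0, fun k _ _ => h k⟩

lemma sum_lpCutoff_eq_one (hη : IsCutoff η) {j : ℕ} {ξ : ℝ}
    (hj : ∀ k, k ≠ j → k ≠ j + 1 → lpCutoff η k ξ = 0) :
    lpCutoff η j ξ + lpCutoff η (j + 1) ξ = 1 := by
  obtain ⟨J, hJ⟩ := pow_unbounded_of_one_lt |ξ| (one_lt_two (α := ℝ))
  have h1 : ∑ k ∈ Finset.range (J + j + 2 + 1), lpCutoff η k ξ = 1 := by
    rw [sum_lpCutoff]
    apply hη.eq_one
    have h2 : (2 : ℝ) ^ J ≤ 2 ^ (J + j + 2) := pow_le_pow_right₀ (by norm_num) (by omega)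
    have h3 : (0 : ℝ) < 2 ^ (J + j + 2) := by positivity
    rw [abs_abs, abs_mul, abs_of_pos (inv_pos.2 h3), ← div_eq_mul_inv, div_le_iff₀ h3]
    linarith
  rw [← h1, ← Finset.sum_subset (s₁ := {j, j + 1})]
  · rw [Finset.sum_pair (by omega)]
  · intro k hk
    simp only [Finset.mem_insert, Finset.mem_singleton] at hk
    exact Finset.mem_range.2 (by omega)
  · intro k _ hk
    simp only [Finset.mem_insert, Finset.mem_singleton, not_or] at hk
    exact hj k hk.1 hk.2

lemma localize_bddL2 (hη : IsCutoff η) {M : Domain} {h : ℝ → ℂ} (hh : MemLp h 2 M.freq)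
    (k : ℕ) : BddL2 M (localize η k h) := by
  have hc := hη.continuous_lpCutoff k
  refine ⟨hh.of_le ((Continuous.aestronglyMeasurable (by fun_prop)).mul hh.1)
    (Filter.Eventually.of_forall fun ξ => ?_), 8 / 5 * 2 ^ k, fun ξ hξ => ?_⟩
  · rw [localize, norm_mul, Complex.norm_real, Real.norm_eq_abs]
    exact mul_le_of_le_one_left (norm_nonneg _) (hη.abs_lpCutoff_le k ξ)
  · rw [localize]
    by_cases h0 : lpCutoff η k ξ = 0
    · simp [h0]
    · exact absurd (hη.abs_le_of_lpCutoff_ne_zero h0) (not_le.2 hξ)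

/-- The Littlewood-Paley projections are bounded on `L¹`, uniformly in the frequency. -/
lemma exists_lpProj_bound (hη : IsCutoff η) (M : Domain) : ∃ C : ℝ≥0, ∀ (h : ℝ → ℂ) (k : ℕ),
    Integrable h M.freq →
    eLpNorm (lpProj M η k h) 1 M.space ≤ C * eLpNorm (invFT M h) 1 M.space := by
  obtain ⟨K, hK, -, hKη⟩ := hη.exists_kernel
  have hfin : ∫⁻ y, ‖K y‖ₑ ≠ ∞ := hK.2.ne
  -- The factor 2 appears because ψ_N is a difference of two dilated cutoffs.
  refine ⟨2 * (∫⁻ y, ‖K y‖ₑ).toNNReal, fun h k hh => ?_⟩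
  rw [eLpNorm_one_eq_lintegral_enorm, eLpNorm_one_eq_lintegral_enorm]
  push_cast
  rw [ENNReal.coe_toNNReal hfin, lpProj_eq_invFT]
  have hb := fun r => lintegral_invFT_dilate_cutoff_le hK hKη hh r
  have hc : Continuous fun ξ => η |ξ| := hη.contDiff_comp_abs.continuous
  have hint : ∀ r : ℝ, Integrable (fun ξ => ((η |ξ * r| : ℝ) : ℂ) * h ξ) M.freq := by
    intro r
    refine hh.bdd_mul (c := 1) ?_ (Filter.Eventually.of_forall fun ξ => ?_)
    · exact (Complex.continuous_ofReal.comp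
        (hc.comp (continuous_mul_const r))).aestronglyMeasurable
    · rw [Complex.norm_real, Real.norm_of_nonneg (hη.nonneg _)]
      exact hη.le_one _
  cases k with
  | zero =>
    have e : localize η 0 h = fun ξ => ((η |ξ * 1| : ℝ) : ℂ) * h ξ := by
      funext ξ; simp [localize, lpCutoff]
    rw [e]
    refine (hb 1).trans ?_
    gcongr
    rw [two_mul]
    exact le_self_add
  | succ k =>
    have e : ∀ x, invFT M (localize η (k + 1) h) x =
        invFT M (fun ξ => ((η |ξ * (2 ^ (k + 1))⁻¹| : ℝ) : ℂ) * h ξ) x -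
        invFT M (fun ξ => ((η |ξ * (2 ^ k)⁻¹| : ℝ) : ℂ) * h ξ) x := by
      intro x
      unfold invFT
      rw [← mul_sub, ← integral_sub (integrable_mul_cexp (hint _) x)
        (integrable_mul_cexp (hint _) x)]
      congr 2
      funext ξ
      rw [localize, lpCutoff_succ_eq]
      push_cast
      ring
    calc ∫⁻ x, ‖invFT M (localize η (k + 1) h) x‖ₑ ∂M.space
        ≤ ∫⁻ x, (‖invFT M (fun ξ => ((η |ξ * (2 ^ (k + 1))⁻¹| : ℝ) : ℂ) * h ξ) x‖ₑ +
          ‖invFT M (fun ξ => ((η |ξ * (2 ^ k)⁻¹| : ℝ) : ℂ) * h ξ) x‖ₑ) ∂M.space := by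
          refine lintegral_mono fun x => ?_
          rw [e]
          exact enorm_sub_le
      _ ≤ _ := by
          rw [lintegral_add_left (continuous_invFT (hint _)).enorm.measurable, two_mul, add_mul]
          exact add_le_add (hb _) (hb _)

end IsCutoff

/-! ### Hölder and Bernstein estimates for trilinear blocks -/

lemma eLpNorm_two_sq {α ε : Type*} [MeasurableSpace α] {μ : Measure α} [ENorm ε] (g : α → ε) :
    eLpNorm g 2 μ ^ 2 = ∫⁻ x, ‖g x‖ₑ ^ 2 ∂μ := by
  have h := eLpNorm_nnreal_pow_eq_lintegral (f := g) (μ := μ) (p := 2) (by norm_num)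
  simpa using h

/-- By Plancherel this is Hölder's inequality L^∞ · L² ⊂ L² for the product in physical space. -/
lemma eLpNorm_fourierMul_le {M : Domain} {a b : ℝ → ℂ} (ha : BddL2 M a) (hb : BddL2 M b) :
    eLpNorm (fourierMul M a b) 2 M.freq ≤
      eLpNorm (invFT M a) ∞ M.space * eLpNorm b 2 M.freq := by
  rw [← eLpNorm_invFT (ha.fourierMul hb), ← eLpNorm_invFT hb,
    show invFT M (fourierMul M a b) = invFT M a • invFT M b from
      funext fun x => invFT_fourierMul ha.integrable hb.integrable x]
  exact eLpNorm_smul_le_eLpNorm_top_mul_eLpNorm 2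
    (continuous_invFT hb.integrable).aestronglyMeasurable _

lemma eLpNorm_top_invFT_fourierMul_le {M : Domain} {a b : ℝ → ℂ} (ha : BddL2 M a)
    (hb : BddL2 M b) :
    eLpNorm (invFT M (fourierMul M a b)) ∞ M.space ≤
      eLpNorm (invFT M a) ∞ M.space * eLpNorm (invFT M b) ∞ M.space := by
  rw [show invFT M (fourierMul M a b) = invFT M a • invFT M b from
      funext fun x => invFT_fourierMul ha.integrable hb.integrable x]
  exact eLpNorm_smul_le_eLpNorm_top_mul_eLpNorm ∞
    (continuous_invFT hb.integrable).aestronglyMeasurable _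

lemma eLpNorm_one_invFT_fourierMul_le {M : Domain} {a b : ℝ → ℂ} (ha : BddL2 M a)
    (hb : BddL2 M b) :
    eLpNorm (invFT M (fourierMul M a b)) 1 M.space ≤
      eLpNorm a 2 M.freq * eLpNorm b 2 M.freq := by
  rw [← eLpNorm_invFT ha, ← eLpNorm_invFT hb, eLpNorm_one_eq_lintegral_enorm]
  simp only [invFT_fourierMul ha.integrable hb.integrable, enorm_mul]
  exact lintegral_mul_le_eLpNorm_two (continuous_invFT ha.integrable).aestronglyMeasurable
    (continuous_invFT hb.integrable).aestronglyMeasurable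

lemma eLpNorm_fourierMul_comm {M : Domain} (a b : ℝ → ℂ) (p : ℝ≥0∞) :
    eLpNorm (fourierMul M a b) p M.freq = eLpNorm (fourierMul M b a) p M.freq := by
  apply eLpNorm_congr_ae
  filter_upwards [ae_isFreq M] with ξ hξ
  exact fourierMul_comm a b hξ

/-- The Fourier transform of `∂ₓ ū` in terms of `f = û`. -/
noncomputable def derivConj (f : ℝ → ℂ) (ζ : ℝ) : ℂ := Complex.I * ζ * conjReflect f ζ

lemma aesm_conjReflect {M : Domain} {f : ℝ → ℂ} (hf : AEStronglyMeasurable f M.freq) :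
    AEStronglyMeasurable (conjReflect f) M.freq :=
  Complex.continuous_conj.comp_aestronglyMeasurable
    (hf.comp_measurePreserving (measurePreserving_neg_freq M))

lemma aesm_derivConj {M : Domain} {f : ℝ → ℂ} (hf : AEStronglyMeasurable f M.freq) :
    AEStronglyMeasurable (derivConj f) M.freq :=
  (Continuous.aestronglyMeasurable (by fun_prop)).mul (aesm_conjReflect hf)

lemma enorm_conjReflect (f : ℝ → ℂ) (ζ : ℝ) : ‖conjReflect f ζ‖ₑ = ‖f (-ζ)‖ₑ := by
  rw [conjReflect, ← ofReal_norm, RCLike.norm_conj, ofReal_norm]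

lemma enorm_derivConj (f : ℝ → ℂ) (ζ : ℝ) : ‖derivConj f ζ‖ₑ = ‖ζ‖ₑ * ‖f (-ζ)‖ₑ := by
  rw [derivConj, enorm_mul, enorm_mul, enorm_conjReflect, ← ofReal_norm Complex.I,
    Complex.norm_I, ← ofReal_norm (ζ : ℂ), Complex.norm_real, ofReal_norm]
  simp

lemma eLpNorm_neg_freq {M : Domain} {f : ℝ → ℂ} (hf : AEStronglyMeasurable f M.freq) :
    eLpNorm (fun ζ => f (-ζ)) 2 M.freq = eLpNorm f 2 M.freq :=
  eLpNorm_comp_measurePreserving hf (measurePreserving_neg_freq M)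

lemma derivConj_localize_ne_zero {η : ℝ → ℝ} {k : ℕ} {f : ℝ → ℂ} {ζ : ℝ}
    (h : derivConj (localize η k f) ζ ≠ 0) : lpCutoff η k ζ ≠ 0 := by
  intro h0
  apply h
  simp [derivConj, conjReflect, localize, lpCutoff_neg, h0]

lemma localize_ne_zero {η : ℝ → ℝ} {k : ℕ} {f : ℝ → ℂ} {ζ : ℝ}
    (h : localize η k f ζ ≠ 0) : lpCutoff η k ζ ≠ 0 := by
  intro h0
  apply h
  simp [localize, h0]

/-- `‖P_N u‖_{L²}` in terms of `f = û`. -/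
noncomputable def blockL2 (M : Domain) (η : ℝ → ℝ) (f : ℝ → ℂ) (k : ℕ) : ℝ≥0∞ :=
  eLpNorm (localize η k f) 2 M.freq

/-- `‖P_N u‖_{L^∞}` in terms of `f = û`. -/
noncomputable def blockSup (M : Domain) (η : ℝ → ℝ) (f : ℝ → ℂ) (k : ℕ) : ℝ≥0∞ :=
  eLpNorm (lpProj M η k f) ∞ M.space

/-- The Fourier transform of `P_{N₁}u P_{N₂}u ∂ₓ (conj P_{N₃}u)` in terms of `f = û`. -/
noncomputable def triBlock (M : Domain) (η : ℝ → ℝ) (f : ℝ → ℂ) (k₁ k₂ k₃ : ℕ) : ℝ → ℂ :=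
  fourierMul M (fourierMul M (localize η k₁ f) (localize η k₂ f)) (derivConj (localize η k₃ f))

/-- The product of the `L²` norms of `P_{N₁}u P_{N₂}u` and of `∂ₓ P_{N₃}u`. -/
noncomputable def triSize (M : Domain) (η : ℝ → ℝ) (f : ℝ → ℂ) (k₁ k₂ k₃ : ℕ) : ℝ≥0∞ :=
  eLpNorm (fourierMul M (localize η k₁ f) (localize η k₂ f)) 2 M.freq *
    eLpNorm (derivConj (localize η k₃ f)) 2 M.freq

section blocks

variable {M : Domain} {η : ℝ → ℝ} {f : ℝ → ℂ}

lemma eLpNorm_derivConj_localize_le (hη : IsCutoff η) (hf : MemLp f 2 M.freq) (k : ℕ) :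
    eLpNorm (derivConj (localize η k f)) 2 M.freq ≤ 2 * 2 ^ k * blockL2 M η f k := by
  rw [blockL2, ← eLpNorm_neg_freq (hη.localize_bddL2 hf k).aesm]
  have h : ∀ ζ : ℝ, ‖derivConj (localize η k f) ζ‖ ≤ 2 * 2 ^ k * ‖localize η k f (-ζ)‖ := by
    intro ζ
    have e : ‖derivConj (localize η k f) ζ‖ = |ζ| * ‖localize η k f (-ζ)‖ := by
      simp [derivConj, conjReflect]
    rw [e]
    by_cases h0 : localize η k f (-ζ) = 0
    · simp [h0]
    · have h1 := hη.abs_le_of_lpCutoff_ne_zero (localize_ne_zero h0)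
      rw [abs_neg] at h1
      have h2 : (0 : ℝ) < 2 ^ k := by positivity
      gcongr
      linarith
  refine (eLpNorm_le_mul_eLpNorm_of_ae_le_mul (Filter.Eventually.of_forall h) 2).trans_eq ?_
  congr 1
  rw [ENNReal.ofReal_mul (by norm_num), ENNReal.ofReal_pow (by norm_num)]
  norm_num

lemma bddL2_derivConj_localize (hη : IsCutoff η) (hf : MemLp f 2 M.freq) (k : ℕ) :
    BddL2 M (derivConj (localize η k f)) := by
  refine ⟨⟨aesm_derivConj (hη.localize_bddL2 hf k).aesm, ?_⟩, 8 / 5 * 2 ^ k, fun ξ hξ => ?_⟩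
  · refine (eLpNorm_derivConj_localize_le hη hf k).trans_lt ?_
    exact ENNReal.mul_lt_top (ENNReal.mul_lt_top (by norm_num)
      (ENNReal.pow_lt_top (by norm_num))) (hη.localize_bddL2 hf k).memLp.2
  · by_contra hc
    exact absurd (hη.abs_le_of_lpCutoff_ne_zero (derivConj_localize_ne_zero hc)) (not_le.2 hξ)

lemma bddL2_triBlock (hη : IsCutoff η) (hf : MemLp f 2 M.freq) (k₁ k₂ k₃ : ℕ) :
    BddL2 M (triBlock M η f k₁ k₂ k₃) :=
  ((hη.localize_bddL2 hf k₁).fourierMul (hη.localize_bddL2 hf k₂)).fourierMul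
    (bddL2_derivConj_localize hη hf k₃)

lemma triSize_comm (k₁ k₂ k₃ : ℕ) : triSize M η f k₁ k₂ k₃ = triSize M η f k₂ k₁ k₃ := by
  rw [triSize, triSize, eLpNorm_fourierMul_comm]

/-- The factor P_{N₂}u is taken in L^∞. By `triSize_comm` the roles of N₁ and N₂ can be exchanged,
so the larger of the two can always be left in L². -/
lemma triSize_le (hη : IsCutoff η) (hf : MemLp f 2 M.freq) (k₁ k₂ k₃ : ℕ) :
    triSize M η f k₁ k₂ k₃ ≤
      (blockL2 M η f k₁ * blockSup M η f k₂) * (2 * 2 ^ k₃ * blockL2 M η f k₃) := by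
  rw [triSize_comm, triSize, mul_comm (blockL2 M η f k₁)]
  gcongr
  · exact eLpNorm_fourierMul_le (hη.localize_bddL2 hf k₂) (hη.localize_bddL2 hf k₁)
  · exact eLpNorm_derivConj_localize_le hη hf k₃

/-- Cauchy–Schwarz in the convolution integral. The same quantity bounds the L¹ norm in
`eLpNorm_one_invFT_triBlock_le`, by Cauchy–Schwarz in x. -/
lemma enorm_triBlock_le (hη : IsCutoff η) (hf : MemLp f 2 M.freq) (k₁ k₂ k₃ : ℕ) {ξ : ℝ}
    (hξ : IsFreq M ξ) : ‖triBlock M η f k₁ k₂ k₃ ξ‖ₑ ≤ triSize M η f k₁ k₂ k₃ :=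
  enorm_fourierMul_le ((hη.localize_bddL2 hf k₁).fourierMul (hη.localize_bddL2 hf k₂)).aesm
    (bddL2_derivConj_localize hη hf k₃).aesm hξ

lemma eLpNorm_triBlock_le (hη : IsCutoff η) (hf : MemLp f 2 M.freq) (k₁ k₂ k₃ : ℕ) :
    eLpNorm (triBlock M η f k₁ k₂ k₃) 2 M.freq ≤
      blockSup M η f k₁ * blockSup M η f k₂ * (2 * 2 ^ k₃ * blockL2 M η f k₃) := by
  have h1 := hη.localize_bddL2 hf k₁
  have h2 := hη.localize_bddL2 hf k₂
  refine (eLpNorm_fourierMul_le (h1.fourierMul h2) (bddL2_derivConj_localize hη hf k₃)).trans ?_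
  exact mul_le_mul' (eLpNorm_top_invFT_fourierMul_le h1 h2)
    (eLpNorm_derivConj_localize_le hη hf k₃)

lemma eLpNorm_one_invFT_triBlock_le (hη : IsCutoff η) (hf : MemLp f 2 M.freq) (k₁ k₂ k₃ : ℕ) :
    eLpNorm (invFT M (triBlock M η f k₁ k₂ k₃)) 1 M.space ≤ triSize M η f k₁ k₂ k₃ :=
  eLpNorm_one_invFT_fourierMul_le
    ((hη.localize_bddL2 hf k₁).fourierMul (hη.localize_bddL2 hf k₂))
    (bddL2_derivConj_localize hη hf k₃)

lemma freq_support_lpCutoff_le (k : ℕ) :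
    M.freq (Set.Icc (-(8 / 5 * 2 ^ k)) (8 / 5 * 2 ^ k)) ≤ 5 * 2 ^ k := by
  have h2 : (1 : ℝ) ≤ 2 ^ k := one_le_pow₀ (by norm_num)
  refine (freq_Icc_le M _ _ (by linarith)).trans ?_
  calc ENNReal.ofReal (8 / 5 * 2 ^ k - -(8 / 5 * 2 ^ k) + 1) ≤ ENNReal.ofReal (5 * 2 ^ k) :=
        ENNReal.ofReal_le_ofReal (by linarith)
    _ = 5 * 2 ^ k := by
        rw [ENNReal.ofReal_mul (by norm_num), ENNReal.ofReal_pow (by norm_num)]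
        norm_num

lemma localize_eq_indicator (hη : IsCutoff η) (k : ℕ) (h : ℝ → ℂ) :
    localize η k h =
      (Set.Icc (-(8 / 5 * 2 ^ k)) (8 / 5 * 2 ^ k) : Set ℝ).indicator (localize η k h) := by
  funext ξ
  by_cases hξ : ξ ∈ (Set.Icc (-(8 / 5 * 2 ^ k)) (8 / 5 * 2 ^ k) : Set ℝ)
  · rw [Set.indicator_of_mem hξ]
  · rw [Set.indicator_of_notMem hξ]
    by_contra hc
    exact hξ (abs_le.1 (hη.abs_le_of_lpCutoff_ne_zero (localize_ne_zero hc)))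

lemma enorm_localize_le (hη : IsCutoff η) (k : ℕ) (h : ℝ → ℂ) (ξ : ℝ) :
    ‖localize η k h ξ‖ₑ ≤ ‖h ξ‖ₑ := by
  rw [localize, enorm_mul]
  refine mul_le_of_le_one_left zero_le ?_
  rw [← ofReal_norm, Complex.norm_real, Real.norm_eq_abs]
  exact ENNReal.ofReal_le_one.2 (hη.abs_lpCutoff_le k ξ)

lemma sq_eLpNorm_localize_le_of_bound (hη : IsCutoff η) (k : ℕ) {h : ℝ → ℂ} {B : ℝ≥0∞}
    (hB : ∀ ξ, IsFreq M ξ → ‖h ξ‖ₑ ≤ B) :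
    eLpNorm (localize η k h) 2 M.freq ^ 2 ≤ B ^ 2 * (5 * 2 ^ k) := by
  rw [eLpNorm_two_sq]
  calc ∫⁻ ξ, ‖localize η k h ξ‖ₑ ^ 2 ∂M.freq
      ≤ ∫⁻ ξ, (Set.Icc (-(8 / 5 * 2 ^ k)) (8 / 5 * 2 ^ k) : Set ℝ).indicator
          (fun _ => B ^ 2) ξ ∂M.freq := by
        refine lintegral_mono_ae ?_
        filter_upwards [ae_isFreq M] with ξ hξ
        rw [localize_eq_indicator hη]
        by_cases h1 : ξ ∈ (Set.Icc (-(8 / 5 * 2 ^ k)) (8 / 5 * 2 ^ k) : Set ℝ)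
        · rw [Set.indicator_of_mem h1, Set.indicator_of_mem h1]
          gcongr
          exact (enorm_localize_le hη k h ξ).trans (hB ξ hξ)
        · rw [Set.indicator_of_notMem h1]
          simp
    _ ≤ _ := by
        rw [lintegral_indicator_const measurableSet_Icc]
        gcongr
        exact freq_support_lpCutoff_le k

/-- Bernstein's inequality: |P_N u| is at most the L¹ norm of ψ_N û, and Cauchy–Schwarz on the
support, of measure at most 5N, gives the L² norm. -/
lemma sq_blockSup_le (hη : IsCutoff η) (hf : MemLp f 2 M.freq) (k : ℕ) :
    blockSup M η f k ^ 2 ≤ 5 * 2 ^ k * blockL2 M η f k ^ 2 := by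
  have hb := hη.localize_bddL2 hf k
  set S : Set ℝ := Set.Icc (-(8 / 5 * 2 ^ k)) (8 / 5 * 2 ^ k) with hS
  have hfin : M.freq S ≠ ∞ := isCompact_Icc.measure_lt_top.ne
  have h1 : ∫⁻ ξ, ‖localize η k f ξ‖ₑ ∂M.freq ≤ eLpNorm (S.indicator fun _ => (1 : ℂ)) 2 M.freq *
      blockL2 M η f k := by
    refine le_trans (lintegral_mono fun ξ => ?_) (lintegral_mul_le_eLpNorm_two
      ((memLp_indicator_const 2 measurableSet_Icc 1 (Or.inr hfin)).1) hb.aesm)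
    rw [localize_eq_indicator hη, ← hS]
    by_cases h1 : ξ ∈ S
    · simp [Set.indicator_of_mem h1]
    · simp [Set.indicator_of_notMem h1]
  have h2 : blockSup M η f k ≤ ∫⁻ ξ, ‖localize η k f ξ‖ₑ ∂M.freq := by
    refine eLpNormEssSup_le_of_ae_enorm_bound (Filter.Eventually.of_forall fun x => ?_)
    rw [lpProj_eq_invFT, invFT, enorm_mul]
    calc _ ≤ 1 * ∫⁻ ξ, ‖localize η k f ξ * Complex.exp (Complex.I * ξ * x)‖ₑ ∂M.freq := by
          gcongr
          · exact norm_sqrt_two_pi_inv_le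
          · exact enorm_integral_le_lintegral_enorm _
      _ = _ := by
          rw [one_mul]
          refine lintegral_congr fun ξ => ?_
          rw [enorm_mul, ← ofReal_norm (Complex.exp _), norm_cexp_I_mul]
          simp
  have h3 : eLpNorm (S.indicator fun _ => (1 : ℂ)) 2 M.freq ^ 2 ≤ 5 * 2 ^ k := by
    rw [eLpNorm_two_sq]
    refine le_trans (le_of_eq ?_) (freq_support_lpCutoff_le (M := M) k)
    rw [← lintegral_indicator_one measurableSet_Icc]
    refine lintegral_congr fun ξ => ?_
    by_cases h1 : ξ ∈ S
    · simp [Set.indicator_of_mem h1, ← hS]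
    · simp [Set.indicator_of_notMem h1, ← hS]
  calc blockSup M η f k ^ 2
      ≤ (eLpNorm (S.indicator fun _ => (1 : ℂ)) 2 M.freq * blockL2 M η f k) ^ 2 := by
        gcongr
        exact h2.trans h1
    _ ≤ _ := by
        rw [mul_pow]
        gcongr

end blocks

/-! ### A discrete Schur test -/

/-- `2^{1/2}` as an extended nonnegative real. -/
noncomputable def sqrtTwo : ℝ≥0∞ := 2 ^ (1 / 2 : ℝ)

lemma sqrtTwo_sq : sqrtTwo * sqrtTwo = 2 := by
  rw [sqrtTwo, ← ENNReal.rpow_add _ _ (by norm_num) (by norm_num)]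
  norm_num

lemma sqrtTwo_ne_zero : sqrtTwo ≠ 0 := by simp [sqrtTwo]

lemma sqrtTwo_ne_top : sqrtTwo ≠ ∞ := by simp [sqrtTwo]

lemma sqrtTwo_inv_mul_pow (k : ℕ) : sqrtTwo⁻¹ ^ k * sqrtTwo ^ k = 1 := by
  rw [← mul_pow, ENNReal.inv_mul_cancel sqrtTwo_ne_zero sqrtTwo_ne_top, one_pow]

lemma sqrtTwo_pow_sq (k : ℕ) : sqrtTwo ^ k * sqrtTwo ^ k = 2 ^ k := by
  rw [← mul_pow, sqrtTwo_sq]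

lemma one_lt_sqrtTwo : 1 < sqrtTwo := ENNReal.one_lt_rpow (by norm_num) (by norm_num)

lemma sqrtTwo_inv_lt_one : sqrtTwo⁻¹ < 1 := ENNReal.inv_lt_one.2 one_lt_sqrtTwo

lemma tsum_geometric_ne_top {q : ℝ≥0∞} (hq : q < 1) : ∑' s : ℕ, q ^ s ≠ ∞ := by
  rw [ENNReal.tsum_geometric]
  exact ENNReal.inv_ne_top.2 (tsub_pos_of_lt hq).ne'

lemma tsum_ite_add_eq_le_one (s c : ℕ) : ∑' k : ℕ, (if s + k = c then (1 : ℝ≥0∞) else 0) ≤ 1 := by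
  by_cases h : s ≤ c
  · rw [tsum_eq_single (c - s)]
    · split_ifs <;> simp
    · intro k hk
      rw [if_neg (by omega)]
  · have : ∀ k : ℕ, (if s + k = c then (1 : ℝ≥0∞) else 0) = 0 := fun k => if_neg (by omega)
    simp [this]

/-- The gap s = n + a - m is made a summation variable. For fixed n and s at most one m is left, so
only the geometric series in s and the sum over n remain. -/
lemma tsum_mul_add_eq_le (q : ℝ≥0∞) (g : ℕ → ℝ≥0∞) (a : ℕ) :
    ∑' m : ℕ, ∑' n : ℕ, ∑' s : ℕ, (if s + m = n + a then q ^ s * g n else 0) ≤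
      (∑' s : ℕ, q ^ s) * ∑' n, g n := by
  calc ∑' m : ℕ, ∑' n : ℕ, ∑' s : ℕ, (if s + m = n + a then q ^ s * g n else 0)
      = ∑' n : ℕ, ∑' s : ℕ, ∑' m : ℕ, q ^ s * g n * (if s + m = n + a then 1 else 0) := by
        rw [ENNReal.tsum_comm]
        refine tsum_congr fun n => ?_
        rw [ENNReal.tsum_comm]
        simp only [mul_ite, mul_one, mul_zero]
    _ ≤ ∑' n : ℕ, ∑' s : ℕ, q ^ s * g n := by
        refine ENNReal.tsum_le_tsum fun n => ENNReal.tsum_le_tsum fun s => ?_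
        rw [ENNReal.tsum_mul_left]
        exact mul_le_of_le_one_right zero_le (tsum_ite_add_eq_le_one _ _)
    _ = _ := by
        simp only [ENNReal.tsum_mul_right]
        rw [ENNReal.tsum_mul_left]

lemma tsum_mul_add_eq_le' (q : ℝ≥0∞) (g : ℕ → ℝ≥0∞) (a : ℕ) :
    ∑' m : ℕ, ∑' n : ℕ, ∑' s : ℕ, (if s + m = n + a then q ^ s * g m else 0) ≤
      (∑' s : ℕ, q ^ s) * ∑' n, g n := by
  calc ∑' m : ℕ, ∑' n : ℕ, ∑' s : ℕ, (if s + m = n + a then q ^ s * g m else 0)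
      = ∑' m : ℕ, ∑' s : ℕ, ∑' n : ℕ, q ^ s * g m * (if s + m = n + a then 1 else 0) := by
        refine tsum_congr fun n => ?_
        rw [ENNReal.tsum_comm]
        simp only [mul_ite, mul_one, mul_zero]
    _ ≤ ∑' m : ℕ, ∑' s : ℕ, q ^ s * g m := by
        refine ENNReal.tsum_le_tsum fun n => ENNReal.tsum_le_tsum fun s => ?_
        rw [ENNReal.tsum_mul_left]
        refine mul_le_of_le_one_right zero_le (le_trans ?_ (tsum_ite_add_eq_le_one a (s + n)))
        refine ENNReal.tsum_le_tsum fun k => le_of_eq ?_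
        congr 1
        rw [eq_iff_iff]
        omega
    _ = _ := by
        simp only [ENNReal.tsum_mul_right]
        rw [ENNReal.tsum_mul_left]

lemma ENNReal.mul_le_sq_add_sq (x y : ℝ≥0∞) : x * y ≤ x ^ 2 + y ^ 2 := by
  rcases le_total x y with h | h
  · calc x * y ≤ y * y := by gcongr
      _ = y ^ 2 := (sq y).symm
      _ ≤ _ := le_add_self
  · calc x * y ≤ x * x := by gcongr
      _ = x ^ 2 := (sq x).symm
      _ ≤ _ := le_self_add

/-- A discrete Schur test for a one-sided geometric kernel. -/
lemma tsum_schur_le (h : ℕ → ℝ≥0∞) (a : ℕ) :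
    ∑' m : ℕ, ∑' n : ℕ, (if m ≤ n + a then (sqrtTwo ^ m * h m) * (sqrtTwo⁻¹ ^ n * h n) else 0) ≤
      sqrtTwo ^ a * (2 * ∑' s : ℕ, sqrtTwo⁻¹ ^ s) * ∑' k, h k ^ 2 := by
  set q := sqrtTwo⁻¹ with hq
  have h1 : ∀ m n : ℕ, (if m ≤ n + a then (sqrtTwo ^ m * h m) * (q ^ n * h n) else 0) ≤
      sqrtTwo ^ a * ((∑' s : ℕ, if s + m = n + a then q ^ s * h n ^ 2 else 0) +
        ∑' s : ℕ, if s + m = n + a then q ^ s * h m ^ 2 else 0) := by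
    intro m n
    split_ifs with hmn
    -- With s = n + a - m the kernel 2^{m/2} 2^{-n/2} equals 2^{a/2} 2^{-s/2}: it decays
    -- geometrically in the gap.
    · obtain ⟨s, hs⟩ := Nat.exists_eq_add_of_le hmn
      have e : sqrtTwo ^ m * q ^ n = sqrtTwo ^ a * q ^ s := by
        have e1 : sqrtTwo ^ a * q ^ s = sqrtTwo ^ a * q ^ s * (q ^ n * sqrtTwo ^ n) := by
          rw [sqrtTwo_inv_mul_pow, mul_one]
        have e2 : sqrtTwo ^ m * q ^ n = sqrtTwo ^ m * q ^ n * (q ^ s * sqrtTwo ^ s) := by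
          rw [sqrtTwo_inv_mul_pow, mul_one]
        have e3 : sqrtTwo ^ a * sqrtTwo ^ n = sqrtTwo ^ m * sqrtTwo ^ s := by
          rw [← pow_add, ← pow_add]; congr 1; omega
        calc _ = q ^ n * q ^ s * (sqrtTwo ^ m * sqrtTwo ^ s) := by rw [e2]; ring
          _ = _ := by rw [← e3, e1]; ring
      calc sqrtTwo ^ m * h m * (q ^ n * h n) = sqrtTwo ^ m * q ^ n * (h n * h m) := by ring
        _ = sqrtTwo ^ a * (q ^ s * (h n * h m)) := by rw [e]; ring
        _ ≤ sqrtTwo ^ a * (q ^ s * (h n ^ 2 + h m ^ 2)) := by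
            gcongr
            exact ENNReal.mul_le_sq_add_sq _ _
        _ = sqrtTwo ^ a * (q ^ s * h n ^ 2 + q ^ s * h m ^ 2) := by ring
        _ ≤ _ := by
            gcongr
            · refine le_trans (le_of_eq ?_) (ENNReal.le_tsum s)
              rw [if_pos (by omega)]
            · refine le_trans (le_of_eq ?_) (ENNReal.le_tsum s)
              rw [if_pos (by omega)]
    · exact zero_le
  calc _ ≤ ∑' m : ℕ, ∑' n : ℕ, sqrtTwo ^ a *
        ((∑' s : ℕ, if s + m = n + a then q ^ s * h n ^ 2 else 0) +
        ∑' s : ℕ, if s + m = n + a then q ^ s * h m ^ 2 else 0) :=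
        ENNReal.tsum_le_tsum fun m => ENNReal.tsum_le_tsum fun n => h1 m n
    _ = sqrtTwo ^ a *
        ((∑' m : ℕ, ∑' n : ℕ, ∑' s : ℕ, if s + m = n + a then q ^ s * h n ^ 2 else 0) +
        ∑' m : ℕ, ∑' n : ℕ, ∑' s : ℕ, if s + m = n + a then q ^ s * h m ^ 2 else 0) := by
        simp only [ENNReal.tsum_mul_left, ENNReal.tsum_add]
    _ ≤ sqrtTwo ^ a * ((∑' s : ℕ, q ^ s) * (∑' n, h n ^ 2) + (∑' s : ℕ, q ^ s) * ∑' n, h n ^ 2) := by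
        gcongr
        · exact tsum_mul_add_eq_le q (fun n => h n ^ 2) a
        · exact tsum_mul_add_eq_le' q (fun n => h n ^ 2) a
    _ = _ := by ring

/-! ### Frequency relations in a nonzero block, and decomposition of u² -/

/-- `N^{1/2} ‖P_N u‖_{L²}` in terms of `f = û`. -/
noncomputable def blockHalf (M : Domain) (η : ℝ → ℝ) (f : ℝ → ℂ) (k : ℕ) : ℝ≥0∞ :=
  sqrtTwo ^ k * blockL2 M η f k

section

variable {M : Domain} {η : ℝ → ℝ} {f : ℝ → ℂ}

lemma blockL2_eq (k : ℕ) : blockL2 M η f k = sqrtTwo⁻¹ ^ k * blockHalf M η f k := by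
  rw [blockHalf, ← mul_assoc, sqrtTwo_inv_mul_pow, one_mul]

lemma two_pow_mul_blockL2 (k : ℕ) :
    2 ^ k * blockL2 M η f k = sqrtTwo ^ k * blockHalf M η f k := by
  rw [blockHalf, ← mul_assoc, sqrtTwo_pow_sq]

/-- The derivative falls on P_{N₃}u; half of it is absorbed by `blockHalf`, and the kernel N₃^{1/2}
N₁^{-1/2} of `tsum_schur_le` remains. -/
lemma triSize_le_half (hη : IsCutoff η) (hf : MemLp f 2 M.freq) (k₁ k₂ k₃ : ℕ) :
    triSize M η f k₁ k₂ k₃ ≤ 2 * ((sqrtTwo ^ k₃ * blockHalf M η f k₃) *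
      (sqrtTwo⁻¹ ^ k₁ * blockHalf M η f k₁)) * blockSup M η f k₂ := by
  refine (triSize_le hη hf k₁ k₂ k₃).trans_eq ?_
  rw [mul_assoc 2, two_pow_mul_blockL2, blockL2_eq]
  ring

/-- If k exceeded every kⱼ by at least 3, then |ξ| ≥ (5/8) 2^k, whereas the other three frequencies
add up to at most 3 · (8/5) · 2^k / 8 = (3/5) 2^k. -/
lemma le_add_two_of_lpCutoff_ne_zero (hη : IsCutoff η) {k k₁ k₂ k₃ : ℕ} {ξ ξ₁ ξ₂ ξ₃ : ℝ}
    (h : |ξ| ≤ |ξ₁| + |ξ₂| + |ξ₃|) (hk : lpCutoff η k ξ ≠ 0) (h1 : |ξ₁| ≤ 8 / 5 * 2 ^ k₁)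
    (h2 : |ξ₂| ≤ 8 / 5 * 2 ^ k₂) (h3 : |ξ₃| ≤ 8 / 5 * 2 ^ k₃) :
    k ≤ k₁ + 2 ∨ k ≤ k₂ + 2 ∨ k ≤ k₃ + 2 := by
  by_contra hc
  push Not at hc
  have h0 := hη.le_abs_of_lpCutoff_ne_zero' (by omega) hk
  have e : ∀ j, j + 2 < k → (2 : ℝ) ^ j * 8 ≤ 2 ^ k := by
    intro j hj
    calc (2 : ℝ) ^ j * 8 = 2 ^ (j + 3) := by rw [pow_add]; norm_num
      _ ≤ _ := pow_le_pow_right₀ (by norm_num) (by omega)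
  have e1 := e k₁ hc.1
  have e2 := e k₂ hc.2.1
  have e3 := e k₃ hc.2.2
  have : (0 : ℝ) < 2 ^ k := by positivity
  linarith

lemma exists_of_triBlock_ne_zero {k₁ k₂ k₃ : ℕ} {ξ : ℝ} (h : triBlock M η f k₁ k₂ k₃ ξ ≠ 0) :
    ∃ ξ₁ ξ₂ ξ₃ : ℝ, ξ = ξ₁ + ξ₂ + ξ₃ ∧ lpCutoff η k₁ ξ₁ ≠ 0 ∧ lpCutoff η k₂ ξ₂ ≠ 0 ∧
      lpCutoff η k₃ ξ₃ ≠ 0 := by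
  obtain ⟨ζ, h1, h2⟩ := exists_of_fourierMul_ne_zero h
  obtain ⟨p, h3, h4⟩ := exists_of_fourierMul_ne_zero h1
  exact ⟨ξ - ζ - p, p, ζ, by ring, localize_ne_zero h3, localize_ne_zero h4,
    derivConj_localize_ne_zero h2⟩

lemma abs_le_of_eq_add {a b c d : ℝ} (h : a = b + c + d) : |a| ≤ |b| + |c| + |d| := by
  rw [h]; exact abs_add_three _ _ _

/-- The output and the input frequencies of a nonzero block: each is at most four times the largest
of the other ones. -/
lemma blocks_comparable (hη : IsCutoff η) {k k₁ k₂ k₃ : ℕ} {ξ : ℝ}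
    (h : localize η k (triBlock M η f k₁ k₂ k₃) ξ ≠ 0) :
    (k ≤ k₁ + 2 ∨ k ≤ k₂ + 2 ∨ k ≤ k₃ + 2) ∧ (k₁ ≤ k + 2 ∨ k₁ ≤ k₂ + 2 ∨ k₁ ≤ k₃ + 2) ∧
      (k₂ ≤ k + 2 ∨ k₂ ≤ k₁ + 2 ∨ k₂ ≤ k₃ + 2) ∧ (k₃ ≤ k + 2 ∨ k₃ ≤ k₁ + 2 ∨ k₃ ≤ k₂ + 2) := by
  have h0 := localize_ne_zero h
  have ht : triBlock M η f k₁ k₂ k₃ ξ ≠ 0 := fun h1 => h (by simp [localize, h1])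
  obtain ⟨ξ₁, ξ₂, ξ₃, e, h1, h2, h3⟩ := exists_of_triBlock_ne_zero ht
  have b0 := hη.abs_le_of_lpCutoff_ne_zero h0
  have b1 := hη.abs_le_of_lpCutoff_ne_zero h1
  have b2 := hη.abs_le_of_lpCutoff_ne_zero h2
  have b3 := hη.abs_le_of_lpCutoff_ne_zero h3
  -- The relation ξ = ξ₁ + ξ₂ + ξ₃ can be solved for each of the four frequencies, so the same
  -- estimate applies four times.
  refine ⟨le_add_two_of_lpCutoff_ne_zero hη (abs_le_of_eq_add e) h0 b1 b2 b3,
    le_add_two_of_lpCutoff_ne_zero hη (ξ₁ := ξ) (ξ₂ := -ξ₂) (ξ₃ := -ξ₃)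
      (abs_le_of_eq_add (by linarith)) h1 b0 (by rwa [abs_neg]) (by rwa [abs_neg]),
    le_add_two_of_lpCutoff_ne_zero hη (ξ₁ := ξ) (ξ₂ := -ξ₁) (ξ₃ := -ξ₃)
      (abs_le_of_eq_add (by linarith)) h2 b0 (by rwa [abs_neg]) (by rwa [abs_neg]),
    le_add_two_of_lpCutoff_ne_zero hη (ξ₁ := ξ) (ξ₂ := -ξ₁) (ξ₃ := -ξ₂)
      (abs_le_of_eq_add (by linarith)) h3 b0 (by rwa [abs_neg]) (by rwa [abs_neg])⟩

lemma IsCutoff.hasSum_lpCutoff (hη : IsCutoff η) (ξ : ℝ) :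
    HasSum (fun k => (lpCutoff η k ξ : ℂ)) 1 := by
  obtain ⟨j, hj⟩ := hη.exists_lpCutoff_eq_zero ξ
  have h := hasSum_sum_of_ne_finset_zero (f := fun k => (lpCutoff η k ξ : ℂ)) (s := {j, j + 1})
    (L := SummationFilter.unconditional ℕ) (by
    intro k hk
    simp only [Finset.mem_insert, Finset.mem_singleton, not_or] at hk
    simp [hj k hk.1 hk.2])
  rw [Finset.sum_pair (by omega)] at h
  have e : (lpCutoff η j ξ : ℂ) + lpCutoff η (j + 1) ξ = 1 := by
    exact_mod_cast hη.sum_lpCutoff_eq_one hj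
  rwa [e] at h

lemma IsCutoff.hasSum_localize (hη : IsCutoff η) (f : ℝ → ℂ) (ξ : ℝ) :
    HasSum (fun k => localize η k f ξ) (f ξ) := by
  simpa [localize] using (hη.hasSum_lpCutoff ξ).mul_right (f ξ)

lemma IsCutoff.tsum_enorm_localize_le (hη : IsCutoff η) (f : ℝ → ℂ) (ξ : ℝ) :
    ∑' k, ‖localize η k f ξ‖ₑ ≤ 2 * ‖f ξ‖ₑ := by
  obtain ⟨j, hj⟩ := hη.exists_lpCutoff_eq_zero ξ
  rw [tsum_eq_sum (s := {j, j + 1}), Finset.sum_pair (by omega), two_mul]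
  · exact add_le_add (enorm_localize_le hη _ _ _) (enorm_localize_le hη _ _ _)
  · intro k hk
    simp only [Finset.mem_insert, Finset.mem_singleton, not_or] at hk
    simp [localize, hj k hk.1 hk.2]

lemma HasSum.mul_complex {ι κ : Type*} {a : ι → ℂ} {b : κ → ℂ} {x y : ℂ} (ha : HasSum a x)
    (hb : HasSum b y) : HasSum (fun p : ι × κ => a p.1 * b p.2) (x * y) :=
  ha.mul hb (summable_mul_of_summable_norm ha.summable.norm hb.summable.norm)

/-- Decomposition of a product into dyadic blocks. -/
lemma hasSum_fourierMul_localize (hη : IsCutoff η) (hf : MemLp f 2 M.freq) {ξ : ℝ}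
    (hξ : IsFreq M ξ) :
    HasSum (fun p : ℕ × ℕ => fourierMul M (localize η p.1 f) (localize η p.2 f) ξ)
      (fourierMul M f f ξ) := by
  unfold fourierMul
  refine HasSum.mul_left _ ?_
  have hm : ∀ p : ℕ × ℕ, AEStronglyMeasurable
      (fun ζ => localize η p.1 f (ξ - ζ) * localize η p.2 f ζ) M.freq := fun p =>
    ((hη.localize_bddL2 hf p.1).aesm.comp_measurePreserving
      (measurePreserving_sub_left_freq hξ)).mul (hη.localize_bddL2 hf p.2).aesm
  have hs : ∑' p : ℕ × ℕ, ∫⁻ ζ, ‖localize η p.1 f (ξ - ζ) * localize η p.2 f ζ‖ₑ ∂M.freq ≠ ∞ := by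
    rw [← lintegral_tsum fun p => (hm p).enorm]
    refine ne_top_of_le_ne_top ?_ (lintegral_mono (g := fun ζ => 4 * (‖f (ξ - ζ)‖ₑ * ‖f ζ‖ₑ))
      fun ζ => ?_)
    · rw [lintegral_const_mul' _ _ (by norm_num)]
      exact ENNReal.mul_ne_top (by norm_num) (ne_top_of_le_ne_top
        (ENNReal.mul_ne_top hf.2.ne hf.2.ne) (lintegral_conv_le hf.1 hf.1 hξ))
    · rw [ENNReal.tsum_prod (f := fun a b => ‖localize η a f (ξ - ζ) * localize η b f ζ‖ₑ)]
      simp only [enorm_mul, ENNReal.tsum_mul_left, ENNReal.tsum_mul_right]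
      calc _ ≤ (2 * ‖f (ξ - ζ)‖ₑ) * (2 * ‖f ζ‖ₑ) :=
            mul_le_mul' (hη.tsum_enorm_localize_le f _) (hη.tsum_enorm_localize_le f _)
        _ = _ := by ring
  have e := integral_tsum hm hs
  have e2 : (fun ζ => ∑' p : ℕ × ℕ, localize η p.1 f (ξ - ζ) * localize η p.2 f ζ) =
      fun ζ => f (ξ - ζ) * f ζ := by
    funext ζ
    exact ((hη.hasSum_localize f (ξ - ζ)).mul_complex (hη.hasSum_localize f ζ)).tsum_eq
  rw [e2] at e
  rw [e]
  apply Summable.hasSum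
  rw [← summable_norm_iff]
  have h3 : ∑' p : ℕ × ℕ, ‖∫ ζ, localize η p.1 f (ξ - ζ) * localize η p.2 f ζ ∂M.freq‖ₑ ≠ ∞ :=
    ne_top_of_le_ne_top hs (ENNReal.tsum_le_tsum fun p => enorm_integral_le_lintegral_enorm _)
  have := ENNReal.summable_toReal h3
  simpa using this

end

/-! ### Summation over dyadic frequencies, and decomposition of the cubic nonlinearity -/

section

variable {M : Domain} {η : ℝ → ℝ} {f : ℝ → ℂ}

/-- The bound for `triSize` that estimates `P_{N₂}u` in `L^∞`. -/
noncomputable def sizeBound (M : Domain) (η : ℝ → ℝ) (f : ℝ → ℂ) (k₁ k₂ k₃ : ℕ) : ℝ≥0∞ :=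
  2 * ((sqrtTwo ^ k₃ * blockHalf M η f k₃) * (sqrtTwo⁻¹ ^ k₁ * blockHalf M η f k₁)) *
    blockSup M η f k₂

/-- The constant in `tsum_schur_le`. -/
noncomputable def schurConst (a : ℕ) : ℝ≥0∞ := sqrtTwo ^ a * (2 * ∑' s : ℕ, sqrtTwo⁻¹ ^ s)

lemma schurConst_ne_top (a : ℕ) : schurConst a ≠ ∞ :=
  ENNReal.mul_ne_top (ENNReal.pow_ne_top sqrtTwo_ne_top)
    (ENNReal.mul_ne_top (by norm_num) (tsum_geometric_ne_top sqrtTwo_inv_lt_one))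

/-- The sum over k₂ separates from the Schur sum over k₁ and k₃. The weight g is 1 for plain
convergence and a power of N₂ when a loss in the output frequency has to be paid for. -/
lemma tsum_sizeBound_le (g : ℕ → ℝ≥0∞) (a : ℕ) :
    ∑' k₁ : ℕ, ∑' k₂ : ℕ, ∑' k₃ : ℕ, (if k₃ ≤ k₁ + a then g k₂ * sizeBound M η f k₁ k₂ k₃ else 0) ≤
      2 * schurConst a * (∑' k, blockHalf M η f k ^ 2) * ∑' k, g k * blockSup M η f k := by
  calc _ = ∑' k₂ : ℕ, ∑' k₃ : ℕ, ∑' k₁ : ℕ, (2 * (g k₂ * blockSup M η f k₂)) *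
        (if k₃ ≤ k₁ + a then (sqrtTwo ^ k₃ * blockHalf M η f k₃) *
          (sqrtTwo⁻¹ ^ k₁ * blockHalf M η f k₁) else 0) := by
        rw [ENNReal.tsum_comm]
        refine tsum_congr fun k₂ => ?_
        rw [ENNReal.tsum_comm]
        refine tsum_congr fun k₃ => tsum_congr fun k₁ => ?_
        split_ifs
        · rw [sizeBound]; ring
        · simp
    _ ≤ ∑' k₂ : ℕ, (2 * (g k₂ * blockSup M η f k₂)) *
        (schurConst a * ∑' k, blockHalf M η f k ^ 2) := by
        refine ENNReal.tsum_le_tsum fun k₂ => ?_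
        simp only [ENNReal.tsum_mul_left]
        gcongr
        exact tsum_schur_le _ a
    _ = _ := by
        rw [ENNReal.tsum_mul_right, ENNReal.tsum_mul_left]
        ring

lemma triSize_le_sizeBound (hη : IsCutoff η) (hf : MemLp f 2 M.freq) (k₁ k₂ k₃ : ℕ) :
    triSize M η f k₁ k₂ k₃ ≤ sizeBound M η f k₁ k₂ k₃ := triSize_le_half hη hf k₁ k₂ k₃

lemma triSize_le_sizeBound' (hη : IsCutoff η) (hf : MemLp f 2 M.freq) (k₁ k₂ k₃ : ℕ) :
    triSize M η f k₁ k₂ k₃ ≤ sizeBound M η f k₂ k₁ k₃ := by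
  rw [triSize_comm]; exact triSize_le_half hη hf k₂ k₁ k₃

lemma tsum_lintegral_triBlock_ne_top (hη : IsCutoff η) (hf : MemLp f 2 M.freq)
    (hh : ∑' k, blockHalf M η f k ^ 2 ≠ ∞) (hl : ∑' k, blockSup M η f k ≠ ∞) {ξ : ℝ}
    (hξ : IsFreq M ξ) :
    ∑' p : (ℕ × ℕ) × ℕ, ∫⁻ ζ, ‖fourierMul M (localize η p.1.1 f) (localize η p.1.2 f) (ξ - ζ)‖ₑ *
      ‖derivConj (localize η p.2 f) ζ‖ₑ ∂M.freq ≠ ∞ := by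
  -- The fixed output ξ acts as a frequency of size 2^κ. A nonzero integrand forces k₃ ≤ max(κ, k₁,
  -- k₂) + 2, hence k₃ ≤ k₁ + a or k₃ ≤ k₂ + a, where the Schur bound applies.
  obtain ⟨κ, hκ⟩ := pow_unbounded_of_one_lt |ξ| (one_lt_two (α := ℝ))
  set a := κ + 2 with ha
  have hterm : ∀ k₁ k₂ k₃ : ℕ,
      ∫⁻ ζ, ‖fourierMul M (localize η k₁ f) (localize η k₂ f) (ξ - ζ)‖ₑ *
        ‖derivConj (localize η k₃ f) ζ‖ₑ ∂M.freq ≤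
      (if k₃ ≤ k₁ + a then sizeBound M η f k₁ k₂ k₃ else 0) +
        (if k₃ ≤ k₂ + a then sizeBound M η f k₂ k₁ k₃ else 0) := by
    intro k₁ k₂ k₃
    have hle := lintegral_conv_le
      ((hη.localize_bddL2 hf k₁).fourierMul (hη.localize_bddL2 hf k₂)).aesm
      (bddL2_derivConj_localize hη hf k₃).aesm hξ
    by_cases h1 : k₃ ≤ k₁ + a
    · rw [if_pos h1]
      exact (hle.trans (triSize_le_sizeBound hη hf k₁ k₂ k₃)).trans le_self_add
    by_cases h2 : k₃ ≤ k₂ + a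
    · rw [if_pos h2]
      exact (hle.trans (triSize_le_sizeBound' hη hf k₁ k₂ k₃)).trans le_add_self
    · have h0 : ∀ ζ, ‖fourierMul M (localize η k₁ f) (localize η k₂ f) (ξ - ζ)‖ₑ *
          ‖derivConj (localize η k₃ f) ζ‖ₑ = 0 := by
        intro ζ
        by_contra hc
        have hc1 := left_ne_zero_of_mul hc
        have hc2 := right_ne_zero_of_mul hc
        rw [enorm_ne_zero] at hc1 hc2
        obtain ⟨p, h3, h4⟩ := exists_of_fourierMul_ne_zero hc1
        have b1 := hη.abs_le_of_lpCutoff_ne_zero (localize_ne_zero h3)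
        have b2 := hη.abs_le_of_lpCutoff_ne_zero (localize_ne_zero h4)
        have hpos : (0 : ℝ) < 2 ^ κ := by positivity
        have := le_add_two_of_lpCutoff_ne_zero hη (k₁ := κ) (ξ₁ := ξ) (ξ₂ := -(ξ - ζ - p))
          (ξ₃ := -p) (abs_le_of_eq_add (by ring)) (derivConj_localize_ne_zero hc2) (by linarith)
          (by rwa [abs_neg]) (by rwa [abs_neg])
        omega
      simp [h0]
  have hsum : ∀ S : ℕ → ℕ → ℕ → ℝ≥0∞, S = (fun k₁ k₂ k₃ =>
      if k₃ ≤ k₁ + a then sizeBound M η f k₁ k₂ k₃ else 0) →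
      ∑' k₁ : ℕ, ∑' k₂ : ℕ, ∑' k₃ : ℕ, S k₁ k₂ k₃ ≠ ∞ := by
    rintro S rfl
    have := tsum_sizeBound_le (M := M) (η := η) (f := f) (fun _ => 1) a
    simp only [one_mul] at this
    exact ne_top_of_le_ne_top (ENNReal.mul_ne_top (ENNReal.mul_ne_top
      (ENNReal.mul_ne_top (by norm_num) (schurConst_ne_top a)) hh) hl) this
  rw [ENNReal.tsum_prod (f := fun (p : ℕ × ℕ) k₃ =>
    ∫⁻ ζ, ‖fourierMul M (localize η p.1 f) (localize η p.2 f) (ξ - ζ)‖ₑ *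
      ‖derivConj (localize η k₃ f) ζ‖ₑ ∂M.freq),
    ENNReal.tsum_prod (f := fun k₁ k₂ => ∑' k₃,
    ∫⁻ ζ, ‖fourierMul M (localize η k₁ f) (localize η k₂ f) (ξ - ζ)‖ₑ *
      ‖derivConj (localize η k₃ f) ζ‖ₑ ∂M.freq)]
  refine ne_top_of_le_ne_top ?_ (ENNReal.tsum_le_tsum fun k₁ => ENNReal.tsum_le_tsum fun k₂ =>
    ENNReal.tsum_le_tsum fun k₃ => hterm k₁ k₂ k₃)
  simp only [ENNReal.tsum_add]
  refine ENNReal.add_ne_top.2 ⟨hsum _ rfl, ?_⟩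
  rw [ENNReal.tsum_comm]
  exact hsum _ rfl

lemma hasSum_derivConj_localize (hη : IsCutoff η) (f : ℝ → ℂ) (ζ : ℝ) :
    HasSum (fun k => derivConj (localize η k f) ζ) (derivConj f ζ) := by
  have h := (hη.hasSum_lpCutoff ζ).mul_right (derivConj f ζ)
  rw [one_mul] at h
  have e : (fun k => derivConj (localize η k f) ζ) =
      fun k => (lpCutoff η k ζ : ℂ) * derivConj f ζ := by
    funext k
    simp only [derivConj, conjReflect, localize, lpCutoff_neg, map_mul, Complex.conj_ofReal]
    ring
  rwa [e]

lemma hasSum_integral_of_tsum_lintegral {α ι : Type*} [MeasurableSpace α] {μ : Measure α}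
    [Countable ι] {F : ι → α → ℂ} (hm : ∀ i, AEStronglyMeasurable (F i) μ)
    (hs : ∑' i, ∫⁻ x, ‖F i x‖ₑ ∂μ ≠ ∞) :
    HasSum (fun i => ∫ x, F i x ∂μ) (∫ x, ∑' i, F i x ∂μ) := by
  rw [integral_tsum hm hs]
  apply Summable.hasSum
  rw [← summable_norm_iff]
  have h3 : ∑' i, ‖∫ x, F i x ∂μ‖ₑ ≠ ∞ :=
    ne_top_of_le_ne_top hs (ENNReal.tsum_le_tsum fun p => enorm_integral_le_lintegral_enorm _)
  have := ENNReal.summable_toReal h3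
  simpa using this

/-- Decomposition of the cubic nonlinearity into dyadic blocks. -/
lemma hasSum_triBlock (hη : IsCutoff η) (hf : MemLp f 2 M.freq)
    (hh : ∑' k, blockHalf M η f k ^ 2 ≠ ∞) (hl : ∑' k, blockSup M η f k ≠ ∞) {ξ : ℝ}
    (hξ : IsFreq M ξ) :
    HasSum (fun p : (ℕ × ℕ) × ℕ => triBlock M η f p.1.1 p.1.2 p.2 ξ) (cubicFourier M f ξ) := by
  have hm : ∀ p : (ℕ × ℕ) × ℕ, AEStronglyMeasurable
      (fun ζ => fourierMul M (localize η p.1.1 f) (localize η p.1.2 f) (ξ - ζ) *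
        derivConj (localize η p.2 f) ζ) M.freq := fun p =>
    (((hη.localize_bddL2 hf p.1.1).fourierMul
      (hη.localize_bddL2 hf p.1.2)).aesm.comp_measurePreserving
      (measurePreserving_sub_left_freq hξ)).mul (bddL2_derivConj_localize hη hf p.2).aesm
  have hs := tsum_lintegral_triBlock_ne_top hη hf hh hl hξ
  simp only [← enorm_mul] at hs
  have h := (hasSum_integral_of_tsum_lintegral hm hs).mul_left
    ((Real.sqrt (2 * Real.pi))⁻¹ : ℂ)
  have e : ∫ ζ, ∑' p : (ℕ × ℕ) × ℕ, fourierMul M (localize η p.1.1 f) (localize η p.1.2 f) (ξ - ζ) *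
        derivConj (localize η p.2 f) ζ ∂M.freq =
      ∫ ζ, fourierMul M f f (ξ - ζ) * derivConj f ζ ∂M.freq := by
    apply integral_congr_ae
    filter_upwards [ae_isFreq M] with ζ hζ
    exact ((hasSum_fourierMul_localize hη hf (hξ.sub hζ)).mul_complex
      (hasSum_derivConj_localize hη f ζ)).tsum_eq
  rw [e] at h
  exact h

/-- The dyadic block of the cubic nonlinearity without restriction to nonresonant frequencies. -/
noncomputable def quadBlock (M : Domain) (η : ℝ → ℝ) (f : ℝ → ℂ) (Q : Quad) : ℝ → ℂ :=
  localize η Q.k (triBlock M η f Q.k₁ Q.k₂ Q.k₃)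

/-- A quadruple of dyadic integers as a tuple. -/
def quadEquiv : Quad ≃ ℕ × ((ℕ × ℕ) × ℕ) where
  toFun Q := (Q.k, ((Q.k₁, Q.k₂), Q.k₃))
  invFun p := ⟨p.1, p.2.1.1, p.2.1.2, p.2.2⟩
  left_inv _ := rfl
  right_inv _ := rfl

instance countable_quad : Countable Quad := quadEquiv.countable_iff.2 inferInstance

lemma hasSum_quadBlock (hη : IsCutoff η) (hf : MemLp f 2 M.freq)
    (hh : ∑' k, blockHalf M η f k ^ 2 ≠ ∞) (hl : ∑' k, blockSup M η f k ≠ ∞) {ξ : ℝ}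
    (hξ : IsFreq M ξ) :
    HasSum (fun Q : Quad => quadBlock M η f Q ξ) (cubicFourier M f ξ) := by
  have h := (hη.hasSum_lpCutoff ξ).mul_complex (hasSum_triBlock hη hf hh hl hξ)
  rw [one_mul] at h
  exact (quadEquiv.hasSum_iff (f := fun p : ℕ × ((ℕ × ℕ) × ℕ) => (lpCutoff η p.1 ξ : ℂ) *
    triBlock M η f p.2.1.1 p.2.1.2 p.2.2 ξ)).2 h

lemma tsum_quad_eq (F : Quad → ℝ≥0∞) :
    ∑' Q, F Q = ∑' k : ℕ, ∑' k₁ : ℕ, ∑' k₂ : ℕ, ∑' k₃ : ℕ, F ⟨k, k₁, k₂, k₃⟩ := by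
  rw [← quadEquiv.symm.tsum_eq,
    ENNReal.tsum_prod (f := fun k (p : (ℕ × ℕ) × ℕ) => F (quadEquiv.symm (k, p)))]
  refine tsum_congr fun k => ?_
  rw [ENNReal.tsum_prod (f := fun (p : ℕ × ℕ) k₃ => F (quadEquiv.symm (k, (p, k₃)))),
    ENNReal.tsum_prod (f := fun k₁ k₂ => ∑' k₃, F (quadEquiv.symm (k, ((k₁, k₂), k₃))))]
  rfl

/-! ### Removal of the Schrödinger phases -/

lemma schrodinger_schrodinger_neg (t : ℝ) (f : ℝ → ℂ) :
    schrodinger t (schrodinger (-t) f) = f := by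
  funext ξ
  simp only [schrodinger]
  rw [← mul_assoc, ← Complex.exp_add]
  have : -(Complex.I * t * ξ ^ 2) + -(Complex.I * ((-t : ℝ) : ℂ) * ξ ^ 2) = 0 := by push_cast; ring
  rw [this, Complex.exp_zero, one_mul]

lemma localize_schrodinger (k : ℕ) (t : ℝ) (f : ℝ → ℂ) :
    localize η k (schrodinger t f) = schrodinger t (localize η k f) := by
  funext ξ
  simp only [localize, schrodinger]
  ring

/-- The oscillating factors of `trilinear` cancel those of the profiles. -/
lemma trilinear_schrodinger (t : ℝ) (R : ℝ → ℝ → ℝ → Prop) (f g h : ℝ → ℂ) (ξ : ℝ) :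
    trilinear M t R (schrodinger (-t) f) (schrodinger (-t) g) (schrodinger (-t) h) ξ =
      schrodinger (-t) (trilinear M 0 R f g h) ξ := by
  simp only [trilinear, schrodinger]
  rw [mul_left_comm, ← integral_const_mul (Complex.exp _)]
  congr 1
  refine integral_congr_ae (Filter.Eventually.of_forall fun p => ?_)
  simp only [conjReflect, schrodinger, map_mul, ← Complex.exp_conj]
  simp only [map_neg, map_mul, map_pow, Complex.conj_I, Complex.conj_ofReal]
  have e : Complex.exp (Complex.I * t * phase p.1 p.2 (ξ - p.1 - p.2)) *
      (Complex.exp (-(Complex.I * ((-t : ℝ) : ℂ) * p.1 ^ 2)) *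
      Complex.exp (-(Complex.I * ((-t : ℝ) : ℂ) * p.2 ^ 2)) *
      Complex.exp (-(-Complex.I * ((-t : ℝ) : ℂ) * ((-(ξ - p.1 - p.2) : ℝ) : ℂ) ^ 2))) =
      Complex.exp (-(Complex.I * ((-t : ℝ) : ℂ) * ξ ^ 2)) := by
    rw [← Complex.exp_add, ← Complex.exp_add, ← Complex.exp_add]
    congr 1
    simp only [phase]
    push_cast
    ring
  rw [← e]
  simp only [Complex.ofReal_zero, mul_zero, zero_mul, Complex.exp_zero]
  ring

end

/-! ### Blocks on which the nonresonance condition is automatic -/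

section

variable {M : Domain} {η : ℝ → ℝ} {f : ℝ → ℂ}

lemma integrable_prod_of_lintegral_le {F : ℝ × ℝ → ℂ} {b : ℝ → ℂ} {C : ℝ≥0∞}
    (hF : AEStronglyMeasurable F (M.freq.prod M.freq)) (hb : Integrable b M.freq) (hC : C ≠ ∞)
    (h : ∀ᵐ x ∂M.freq, ∫⁻ y, ‖F (x, y)‖ₑ ∂M.freq ≤ C * ‖b x‖ₑ) :
    Integrable F (M.freq.prod M.freq) := by
  refine ⟨hF, ?_⟩
  rw [HasFiniteIntegral, lintegral_prod _ hF.enorm]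
  refine (lintegral_mono_ae h).trans_lt ?_
  rw [lintegral_const_mul'' _ hb.1.enorm]
  exact ENNReal.mul_lt_top hC.lt_top hb.2

lemma lintegral_conv_le' {a b : ℝ → ℂ} (ha : AEStronglyMeasurable a M.freq)
    (hb : AEStronglyMeasurable b M.freq) {ξ : ℝ} (hξ : IsFreq M ξ) :
    ∫⁻ ζ, ‖a ζ‖ₑ * ‖b (ξ - ζ)‖ₑ ∂M.freq ≤ eLpNorm a 2 M.freq * eLpNorm b 2 M.freq := by
  rw [mul_comm]
  simp only [mul_comm (‖a _‖ₑ)]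
  exact lintegral_conv_le hb ha hξ

lemma quasiMeasurePreserving_const_sub_sub {ξ : ℝ} (hξ : IsFreq M ξ) :
    Measure.QuasiMeasurePreserving (fun p : ℝ × ℝ => ξ - p.1 - p.2) (M.freq.prod M.freq) M.freq := by
  refine ⟨by fun_prop, Measure.AbsolutelyContinuous.mk fun s hs h0 => ?_⟩
  rw [Measure.map_apply (by fun_prop) hs,
    Measure.measure_prod_null (measurableSet_preimage (by fun_prop) hs)]
  filter_upwards [ae_isFreq M] with p hp
  exact (measurePreserving_sub_left_freq (hξ.sub hp)).measure_preimage hs.nullMeasurableSet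
    |>.trans h0

/-- The iterated convolution as a double integral over the input frequencies. -/
lemma integral_trilinear_eq {a b g : ℝ → ℂ} (ha : BddL2 M a) (hb : BddL2 M b) (hg : BddL2 M g)
    {ξ : ℝ} (hξ : IsFreq M ξ) :
    ∫ p : ℝ × ℝ, a p.1 * b p.2 * g (ξ - p.1 - p.2) ∂(M.freq.prod M.freq) =
      ∫ ζ, (∫ p, a (ξ - ζ - p) * b p ∂M.freq) * g ζ ∂M.freq := by
  have hC : eLpNorm a 2 M.freq * eLpNorm g 2 M.freq ≠ ∞ :=
    ENNReal.mul_ne_top ha.memLp.2.ne hg.memLp.2.ne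
  -- The outer variable is the frequency of b, which is integrable; the inner integral of a against
  -- g is bounded by Cauchy–Schwarz. The same order serves after the change of variables in `i2`.
  have i1 : Integrable (fun p : ℝ × ℝ => a p.2 * b p.1 * g (ξ - p.1 - p.2))
      (M.freq.prod M.freq) := by
    refine integrable_prod_of_lintegral_le ((ha.aesm.comp_snd.mul hb.aesm.comp_fst).mul
      (hg.aesm.comp_quasiMeasurePreserving (quasiMeasurePreserving_const_sub_sub hξ)))
      hb.integrable hC ?_
    filter_upwards [ae_isFreq M] with p hp
    calc ∫⁻ y, ‖a y * b p * g (ξ - p - y)‖ₑ ∂M.freq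
        = ∫⁻ y, ‖b p‖ₑ * (‖a y‖ₑ * ‖g (ξ - p - y)‖ₑ) ∂M.freq := by
          refine lintegral_congr fun y => ?_
          simp only [enorm_mul]
          ring
      _ = ‖b p‖ₑ * ∫⁻ y, ‖a y‖ₑ * ‖g (ξ - p - y)‖ₑ ∂M.freq := lintegral_const_mul' _ _ (by simp)
      _ ≤ _ := by
          rw [mul_comm]
          gcongr
          exact lintegral_conv_le' ha.aesm hg.aesm (hξ.sub hp)
  have i2 : Integrable (fun p : ℝ × ℝ => a (p.2 - p.1) * b p.1 * g (ξ - p.2))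
      (M.freq.prod M.freq) := by
    have q := quasiMeasurePreserving_sub_freq M
    have qs : Measure.QuasiMeasurePreserving (fun p : ℝ × ℝ => p.2 - p.1)
        (M.freq.prod M.freq) M.freq :=
      q.comp (Measure.measurePreserving_swap (μ := M.freq) (ν := M.freq)).quasiMeasurePreserving
    refine integrable_prod_of_lintegral_le
      (((ha.aesm.comp_quasiMeasurePreserving qs).mul hb.aesm.comp_fst).mul
      (hg.aesm.comp_measurePreserving (measurePreserving_sub_left_freq hξ)).comp_snd)
      hb.integrable hC ?_
    filter_upwards [ae_isFreq M] with p hp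
    calc ∫⁻ y, ‖a (y - p) * b p * g (ξ - y)‖ₑ ∂M.freq
        = ∫⁻ y, ‖b p‖ₑ * (‖a (y - p)‖ₑ * ‖g (ξ - p - (y - p))‖ₑ) ∂M.freq := by
          refine lintegral_congr fun y => ?_
          simp only [enorm_mul]
          rw [show ξ - p - (y - p) = ξ - y by ring]
          ring
      _ = ‖b p‖ₑ * ∫⁻ y, ‖a (y - p)‖ₑ * ‖g (ξ - p - (y - p))‖ₑ ∂M.freq :=
          lintegral_const_mul' _ _ (by simp)
      _ = ‖b p‖ₑ * ∫⁻ y, ‖a y‖ₑ * ‖g (ξ - p - y)‖ₑ ∂M.freq := by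
          rw [(measurePreserving_sub_right_freq hp).lintegral_comp_emb
            (measurableEmbedding_sub_right p) (fun y => ‖a y‖ₑ * ‖g (ξ - p - y)‖ₑ)]
      _ ≤ _ := by
          rw [mul_comm]
          gcongr
          exact lintegral_conv_le' ha.aesm hg.aesm (hξ.sub hp)
  have e0 : ∫ p : ℝ × ℝ, a p.1 * b p.2 * g (ξ - p.1 - p.2) ∂(M.freq.prod M.freq) =
      ∫ p : ℝ × ℝ, a p.2 * b p.1 * g (ξ - p.1 - p.2) ∂(M.freq.prod M.freq) := by
    rw [← integral_prod_swap]
    refine integral_congr_ae (Filter.Eventually.of_forall fun p => ?_)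
    simp only [Prod.fst_swap, Prod.snd_swap]
    rw [sub_right_comm]
  have e1 : ∫ p : ℝ × ℝ, a p.2 * b p.1 * g (ξ - p.1 - p.2) ∂(M.freq.prod M.freq) =
      ∫ p : ℝ × ℝ, a (p.2 - p.1) * b p.1 * g (ξ - p.2) ∂(M.freq.prod M.freq) := by
    rw [integral_prod _ i1, integral_prod _ i2]
    apply integral_congr_ae
    filter_upwards [ae_isFreq M] with p hp
    rw [← (measurePreserving_sub_right_freq hp).integral_comp
      (measurableEmbedding_sub_right p) (fun y => a y * b p * g (ξ - p - y))]
    refine integral_congr_ae (Filter.Eventually.of_forall fun y => ?_)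
    simp only
    rw [show ξ - p - (y - p) = ξ - y by ring]
  rw [e0, e1, integral_prod_symm _ i2,
    ← (measurePreserving_sub_left_freq hξ).integral_comp (measurableEmbedding_sub_left ξ)]
  refine integral_congr_ae (Filter.Eventually.of_forall fun ζ => ?_)
  simp only [sub_sub_cancel]
  rw [integral_mul_const]

lemma sqrt_two_pi_inv_mul_self :
    ((Real.sqrt (2 * Real.pi))⁻¹ : ℂ) * ((Real.sqrt (2 * Real.pi))⁻¹ : ℂ) =
      ((2 * Real.pi)⁻¹ : ℂ) := by
  rw [← mul_inv, ← Complex.ofReal_mul, Real.mul_self_sqrt (by positivity)]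
  push_cast
  rfl

/-- `trilinear` as an iterated convolution, if the restriction is automatically satisfied. -/
lemma trilinear_eq_fourierMul {R : ℝ → ℝ → ℝ → Prop} {a b c : ℝ → ℂ} (ha : BddL2 M a)
    (hb : BddL2 M b) (hc : BddL2 M (derivConj c)) {ξ : ℝ} (hξ : IsFreq M ξ)
    (hR : ∀ p₁ p₂, a p₁ ≠ 0 → b p₂ ≠ 0 → derivConj c (ξ - p₁ - p₂) ≠ 0 →
      R p₁ p₂ (ξ - p₁ - p₂)) :
    trilinear M 0 R a b c ξ = fourierMul M (fourierMul M a b) (derivConj c) ξ := by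
  have e : ∀ p : ℝ × ℝ, Complex.exp (Complex.I * ((0 : ℝ) : ℂ) * phase p.1 p.2 (ξ - p.1 - p.2)) *
        (Complex.I * ((ξ - p.1 - p.2 : ℝ) : ℂ)) *
        a p.1 * b p.2 * conjReflect c (ξ - p.1 - p.2) =
      a p.1 * b p.2 * derivConj c (ξ - p.1 - p.2) := by
    intro p
    simp only [Complex.ofReal_zero, mul_zero, zero_mul, Complex.exp_zero, derivConj]
    ring
  unfold trilinear
  simp only [e]
  rw [setIntegral_eq_integral_of_forall_compl_eq_zero, integral_trilinear_eq ha hb hc hξ]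
  · simp only [fourierMul]
    rw [← sqrt_two_pi_inv_mul_self, mul_assoc]
    congr 1
    rw [← integral_const_mul]
    congr 1
    funext ζ
    ring
  · intro p hp
    by_contra h0
    exact hp (hR p.1 p.2 (left_ne_zero_of_mul (left_ne_zero_of_mul h0))
      (right_ne_zero_of_mul (left_ne_zero_of_mul h0)) (right_ne_zero_of_mul h0))

lemma nonlinPiece_schrodinger (t : ℝ) (Q : Quad) (ξ : ℝ) :
    nonlinPiece M η t Q (schrodinger (-t) f) ξ =
      schrodinger (-t) (nonlinPiece M η 0 Q f) ξ := by
  simp only [nonlinPiece]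
  rw [← localize_schrodinger, localize_schrodinger Q.k₁, localize_schrodinger Q.k₂,
    localize_schrodinger Q.k₃]
  congr 1
  exact funext fun ζ => trilinear_schrodinger t _ _ _ _ ζ

/-- The interactions for which the restriction to nonresonant frequencies is void. -/
def IsNonresonant (Q : Quad) : Prop :=
  (Q.k₁ + 10 ≤ Q.k₃ ∧ Q.k₂ + 10 ≤ Q.k₃) ∨ (Q.k₂ + 10 ≤ Q.k ∧ Q.k + 10 ≤ Q.k₃) ∨
    (Q.k₁ + 10 ≤ Q.k ∧ Q.k + 10 ≤ Q.k₃)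

lemma one_le_abs_add (hη : IsCutoff η) {k m : ℕ} {x y : ℝ} (hk : lpCutoff η k x ≠ 0)
    (hm : lpCutoff η m y ≠ 0) (hkm : m + 10 ≤ k) : 1 ≤ |x + y| := by
  have h1 := hη.le_abs_of_lpCutoff_ne_zero' (by omega) hk
  have h2 := hη.abs_le_of_lpCutoff_ne_zero hm
  have h3 : (2 : ℝ) ^ (m + 10) ≤ 2 ^ k := pow_le_pow_right₀ (by norm_num) hkm
  rw [pow_add] at h3
  have h4 : (1 : ℝ) ≤ 2 ^ m := one_le_pow₀ (by norm_num)
  have h5 := abs_sub_abs_le_abs_sub x (-y)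
  rw [abs_neg, sub_neg_eq_add] at h5
  linarith

/-- If N₃ ≫ N₁, N₂, then ξ₃ dominates both sums ξ₁ + ξ₃ and ξ₂ + ξ₃. If N₃ ≫ N ≫ N₂, it dominates ξ₂
+ ξ₃, while ξ₁ + ξ₃ = ξ - ξ₂ is dominated by the output ξ; the last case is symmetric. The support
of the integrand thus lies in the nonresonant region. -/
lemma nonlinPiece_eq_quadBlock (hη : IsCutoff η) (hf : MemLp f 2 M.freq) {Q : Quad}
    (hQ : IsNonresonant Q) {ξ : ℝ} (hξ : IsFreq M ξ) :
    nonlinPiece M η 0 Q f ξ = quadBlock M η f Q ξ := by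
  unfold nonlinPiece quadBlock
  rw [localize, localize]
  by_cases h0 : lpCutoff η Q.k ξ = 0
  · simp [h0]
  congr 1
  refine trilinear_eq_fourierMul (hη.localize_bddL2 hf _) (hη.localize_bddL2 hf _)
    (bddL2_derivConj_localize hη hf _) hξ fun p₁ p₂ h1 h2 h3 => ?_
  have h1 := localize_ne_zero h1
  have h2 := localize_ne_zero h2
  have h3 := derivConj_localize_ne_zero h3
  rw [← lpCutoff_neg] at h1 h2
  refine le_min ?_ ?_
  · rcases hQ with ⟨h, h'⟩ | ⟨h, h'⟩ | ⟨h, h'⟩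
    · rw [← lpCutoff_neg, neg_neg] at h1
      rw [add_comm]; exact one_le_abs_add hη h3 h1 h
    · have := one_le_abs_add hη h0 h2 h
      rwa [show p₁ + (ξ - p₁ - p₂) = ξ + -p₂ by ring]
    · rw [← lpCutoff_neg, neg_neg] at h1
      rw [add_comm]; exact one_le_abs_add hη h3 h1 (by omega)
  · rcases hQ with ⟨h, h'⟩ | ⟨h, h'⟩ | ⟨h, h'⟩
    · rw [← lpCutoff_neg, neg_neg] at h2
      rw [add_comm]; exact one_le_abs_add hη h3 h2 h'
    · rw [← lpCutoff_neg, neg_neg] at h2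
      rw [add_comm]; exact one_le_abs_add hη h3 h2 (by omega)
    · have := one_le_abs_add hη h0 h1 h
      rwa [show p₂ + (ξ - p₁ - p₂) = ξ + -p₁ by ring]

/-! ### From ≫ and ∼ to dyadic exponents, and the classification of interactions -/

lemma MuchGreater.add_ten_le {A : ℝ} (hA : 1024 ≤ A) {j k : ℕ}
    (h : MuchGreater A (2 ^ k) (2 ^ j)) : j + 10 ≤ k := by
  have h0 : (0 : ℝ) < 2 ^ j := by positivity
  have h1 : (2 : ℝ) ^ (j + 10) ≤ 2 ^ k := by
    calc (2 : ℝ) ^ (j + 10) = 1024 * 2 ^ j := by rw [pow_add]; norm_num; ring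
      _ ≤ A * 2 ^ j := by gcongr
      _ ≤ _ := h
  exact (pow_le_pow_iff_right₀ (by norm_num)).1 h1

/-- The negation of ≫ needs an upper bound for A, here a power of two; the constants of the
remainder depend on A through a. -/
lemma le_add_of_not_muchGreater {A : ℝ} {a : ℕ} (ha : A ≤ 2 ^ a) {j k : ℕ}
    (h : ¬MuchGreater A (2 ^ k) (2 ^ j)) : k ≤ j + a := by
  have h0 : (0 : ℝ) < 2 ^ j := by positivity
  unfold MuchGreater at h
  rw [not_le] at h
  have h1 : (2 : ℝ) ^ k < 2 ^ (j + a) := by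
    calc (2 : ℝ) ^ k < A * 2 ^ j := h
      _ ≤ 2 ^ a * 2 ^ j := by gcongr
      _ = _ := by rw [← pow_add, add_comm]
  exact ((pow_lt_pow_iff_right₀ (by norm_num)).1 h1).le

lemma comparable_of_le {D : ℝ} (hD : 1024 ≤ D) {j k : ℕ} (h1 : j ≤ k + 10) (h2 : k ≤ j + 10) :
    Comparable D (2 ^ j) (2 ^ k) := by
  have key : ∀ m n : ℕ, m ≤ n + 10 → (2 : ℝ) ^ m ≤ D * 2 ^ n := by
    intro m n h
    have h0 : (0 : ℝ) < 2 ^ n := by positivity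
    calc (2 : ℝ) ^ m ≤ 2 ^ (n + 10) := pow_le_pow_right₀ (by norm_num) h
      _ = 1024 * 2 ^ n := by rw [pow_add]; norm_num; ring
      _ ≤ _ := by gcongr
  exact ⟨key j k h1, key k j h2⟩

lemma Comparable.le_add {D : ℝ} {d : ℕ} (hd : D ≤ 2 ^ d) {j k : ℕ}
    (h : Comparable D (2 ^ j) (2 ^ k)) : j ≤ k + d ∧ k ≤ j + d := by
  have key : ∀ m n : ℕ, (2 : ℝ) ^ m ≤ D * 2 ^ n → m ≤ n + d := by
    intro m n h
    have h0 : (0 : ℝ) < 2 ^ n := by positivity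
    have h1 : (2 : ℝ) ^ m ≤ 2 ^ (n + d) := by
      calc (2 : ℝ) ^ m ≤ D * 2 ^ n := h
        _ ≤ 2 ^ d * 2 ^ n := by gcongr
        _ = _ := by rw [← pow_add, add_comm]
    exact (pow_le_pow_iff_right₀ (by norm_num)).1 h1
  exact ⟨key j k h.1, key k j h.2⟩

lemma max_two_pow (j k : ℕ) : max ((2 : ℝ) ^ j) (2 ^ k) = 2 ^ max j k :=
  ((pow_right_mono₀ (by norm_num : (1 : ℝ) ≤ 2)).map_max).symm

lemma min_two_pow (j k : ℕ) : min ((2 : ℝ) ^ j) (2 ^ k) = 2 ^ min j k :=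
  ((pow_right_mono₀ (by norm_num : (1 : ℝ) ≤ 2)).map_min).symm

lemma highOutput_le {A D : ℝ} (hA : 1024 ≤ A) {d : ℕ} (hd : D ≤ 2 ^ d) {Q : Quad}
    (hQ : Q ∈ highOutput A D) :
    Q.k ≤ Q.k₃ + d ∧ Q.k₃ ≤ Q.k + d ∧ Q.k₁ + 10 ≤ Q.k₃ ∧ Q.k₂ + 10 ≤ Q.k₃ := by
  obtain ⟨h1, h2, h3⟩ := hQ
  have := Comparable.le_add hd h1
  exact ⟨this.1, this.2, MuchGreater.add_ten_le hA h2, MuchGreater.add_ten_le hA h3⟩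

lemma midOutput_le {A D : ℝ} (hA : 1024 ≤ A) {d : ℕ} (hd : D ≤ 2 ^ d) {Q : Quad}
    (hQ : Q ∈ midOutput A D) :
    max Q.k₁ Q.k₂ ≤ Q.k₃ + d ∧ Q.k₃ ≤ max Q.k₁ Q.k₂ + d ∧ Q.k + 10 ≤ Q.k₃ ∧
      min Q.k₁ Q.k₂ + 10 ≤ Q.k := by
  obtain ⟨h1, h2, h3⟩ := hQ
  simp only [Quad.N₁, Quad.N₂, max_two_pow, min_two_pow] at h1 h3
  have := Comparable.le_add hd h1
  exact ⟨this.1, this.2, MuchGreater.add_ten_le hA h2, MuchGreater.add_ten_le hA h3⟩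

lemma isNonresonant_of_mem_highOutput {A D : ℝ} (hA : 1024 ≤ A) {Q : Quad}
    (hQ : Q ∈ highOutput A D) : IsNonresonant Q := by
  obtain ⟨h1, h2, h3⟩ := hQ
  exact Or.inl ⟨MuchGreater.add_ten_le hA h2, MuchGreater.add_ten_le hA h3⟩

lemma isNonresonant_of_mem_midOutput {A D : ℝ} (hA : 1024 ≤ A) {Q : Quad}
    (hQ : Q ∈ midOutput A D) : IsNonresonant Q := by
  obtain ⟨h1, h2, h3⟩ := hQ
  simp only [Quad.N₁, Quad.N₂, min_two_pow] at h3
  have h4 := MuchGreater.add_ten_le hA h2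
  have h5 := MuchGreater.add_ten_le hA h3
  rcases le_total Q.k₁ Q.k₂ with h | h
  · rw [min_eq_left h] at h5
    exact Or.inr (Or.inr ⟨h5, h4⟩)
  · rw [min_eq_right h] at h5
    exact Or.inr (Or.inl ⟨h5, h4⟩)

/-- The interactions with two comparable large frequencies `N₁`, `N₃` or with a large `N₂`. -/
def IsLowOutput (a : ℕ) (Q : Quad) : Prop := Q.k₃ ≤ Q.k₁ + a ∧ Q.k ≤ Q.k₂ + a

/-- The interactions in which the output frequency is not small compared to `N₃`. -/
def IsBalanced (a : ℕ) (Q : Quad) : Prop := Q.k₃ ≤ Q.k + a ∧ Q.k ≤ max Q.k₁ Q.k₂ + a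

/-- Every nonzero block is of one of the above types. -/
lemma quad_cases (hη : IsCutoff η) {A D : ℝ} (hD : 1024 ≤ D) {a : ℕ} (ha : A ≤ 2 ^ a)
    {Q : Quad} {ξ : ℝ} (hQ : quadBlock M η f Q ξ ≠ 0) (h1 : Q ∉ highOutput A D)
    (h2 : Q ∉ midOutput A D) :
    IsLowOutput (a + 2) Q ∨ IsLowOutput (a + 2) ⟨Q.k, Q.k₂, Q.k₁, Q.k₃⟩ ∨
      IsBalanced (a + 2) Q := by
  obtain ⟨b0, b1, b2, b3⟩ := blocks_comparable hη hQ
  -- This and `c2` express, in exponents, how the conditions defining the two excluded sets fail. As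
  -- D ≥ 1024 = 2^10, frequencies whose exponents differ by at most 10 are comparable.
  have c1 : ¬(Q.k ≤ Q.k₃ + 10 ∧ Q.k₃ ≤ Q.k + 10) ∨ Q.k₃ ≤ Q.k₁ + a ∨ Q.k₃ ≤ Q.k₂ + a := by
    by_contra hc
    push Not at hc
    obtain ⟨hc1, hc2, hc3⟩ := hc
    refine h1 ⟨comparable_of_le hD hc1.1 hc1.2, ?_, ?_⟩
    · by_contra hn; exact absurd (le_add_of_not_muchGreater ha hn) (by omega)
    · by_contra hn; exact absurd (le_add_of_not_muchGreater ha hn) (by omega)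
  have c2 : ¬(max Q.k₁ Q.k₂ ≤ Q.k₃ + 10 ∧ Q.k₃ ≤ max Q.k₁ Q.k₂ + 10) ∨ Q.k₃ ≤ Q.k + a ∨
      Q.k ≤ min Q.k₁ Q.k₂ + a := by
    by_contra hc
    push Not at hc
    obtain ⟨hc1, hc2, hc3⟩ := hc
    refine h2 ⟨?_, ?_, ?_⟩
    · simp only [Quad.N₁, Quad.N₂, Quad.N₃, max_two_pow]
      exact comparable_of_le hD hc1.1 hc1.2
    · by_contra hn; exact absurd (le_add_of_not_muchGreater ha hn) (by omega)
    · simp only [Quad.N₁, Quad.N₂, min_two_pow]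
      by_contra hn; exact absurd (le_add_of_not_muchGreater ha hn) (by omega)
  -- By `c1` and the support relations, N₃ ≲ N₁ or N₃ ≲ N₂; say the former. If N ≲ N₂, the output is
  -- low. Otherwise N₂ ≪ N, and `c2` with the support relations leaves only N₃ ≲ N ≲ max(N₁, N₂).
  -- The 2 in a + 2 absorbs the factor four of `blocks_comparable`.
  simp only [IsLowOutput, IsBalanced]
  omega

end

/-! ### Weighted L² norms -/

/-- `⟨ξ⟩^s f(ξ)`. -/
noncomputable def bracketMul (s : ℝ) (f : ℝ → ℂ) (ξ : ℝ) : ℂ :=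
  (((1 + ξ ^ 2) ^ (s / 2) : ℝ) : ℂ) * f ξ

section

variable {M : Domain} {η : ℝ → ℝ} {f : ℝ → ℂ}

lemma hatSobolevNorm_eq {s : ℝ} (hf : AEStronglyMeasurable f M.freq) :
    hatSobolevNorm M s f = eLpNorm (bracketMul s f) 2 M.freq := by
  rw [hatSobolevNorm, if_pos hf]; rfl

lemma aesm_of_hatSobolevNorm_lt_top {s : ℝ} (h : hatSobolevNorm M s f < ∞) :
    AEStronglyMeasurable f M.freq := by
  by_contra hc
  rw [hatSobolevNorm, if_neg hc] at h
  exact lt_irrefl _ h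

lemma continuous_bracket (s : ℝ) : Continuous fun ξ : ℝ => (1 + ξ ^ 2) ^ (s / 2) :=
  Continuous.rpow_const (by fun_prop) fun ξ => Or.inl (by positivity)

lemma aesm_bracketMul (s : ℝ) (hf : AEStronglyMeasurable f M.freq) :
    AEStronglyMeasurable (bracketMul s f) M.freq :=
  (Complex.continuous_ofReal.comp (continuous_bracket s)).aestronglyMeasurable.mul hf

lemma enorm_bracketMul (s : ℝ) (f : ℝ → ℂ) (ξ : ℝ) :
    ‖bracketMul s f ξ‖ₑ = ENNReal.ofReal ((1 + ξ ^ 2) ^ (s / 2)) * ‖f ξ‖ₑ := by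
  rw [bracketMul, enorm_mul, ← ofReal_norm, Complex.norm_real,
    Real.norm_of_nonneg (by positivity)]

lemma hatSobolevNorm_mono {s t : ℝ} (hst : s ≤ t) :
    hatSobolevNorm M s f ≤ hatSobolevNorm M t f := by
  by_cases hf : AEStronglyMeasurable f M.freq
  · rw [hatSobolevNorm_eq hf, hatSobolevNorm_eq hf]
    refine eLpNorm_mono_enorm fun ξ => ?_
    rw [enorm_bracketMul, enorm_bracketMul]
    gcongr
    nlinarith [sq_nonneg ξ]
  · rw [hatSobolevNorm, hatSobolevNorm, if_neg hf, if_neg hf]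

lemma eLpNorm_le_hatSobolevNorm {s : ℝ} (hs : 0 ≤ s) :
    eLpNorm f 2 M.freq ≤ hatSobolevNorm M s f := by
  by_cases hf : AEStronglyMeasurable f M.freq
  · refine le_trans (le_of_eq ?_) (hatSobolevNorm_mono hs)
    rw [hatSobolevNorm_eq hf]
    congr 1
    funext ξ
    simp [bracketMul]
  · rw [hatSobolevNorm, if_neg hf]
    exact le_top

lemma hatSobolevNorm_le_eLpNorm {s : ℝ} (hs : s ≤ 0) (hf : AEStronglyMeasurable f M.freq) :
    hatSobolevNorm M s f ≤ eLpNorm f 2 M.freq := by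
  refine (hatSobolevNorm_mono hs).trans_eq ?_
  rw [hatSobolevNorm_eq hf]
  congr 1
  funext ξ
  simp [bracketMul]

lemma memLp_of_hatSobolevNorm_lt_top {s : ℝ} (hs : 0 ≤ s) (h : hatSobolevNorm M s f < ∞) :
    MemLp f 2 M.freq :=
  ⟨aesm_of_hatSobolevNorm_lt_top h, (eLpNorm_le_hatSobolevNorm hs).trans_lt h⟩

lemma hatSobolevNorm_congr {s : ℝ} {g : ℝ → ℂ} (h : f =ᵐ[M.freq] g) :
    hatSobolevNorm M s f = hatSobolevNorm M s g := by
  by_cases hf : AEStronglyMeasurable f M.freq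
  · rw [hatSobolevNorm_eq hf, hatSobolevNorm_eq (hf.congr h)]
    apply eLpNorm_congr_ae
    filter_upwards [h] with ξ hξ
    rw [bracketMul, bracketMul, hξ]
  · rw [hatSobolevNorm, hatSobolevNorm, if_neg hf, if_neg fun hg => hf (hg.congr h.symm)]

/-! ### The resonant part -/

/-- Two frequencies that are opposite up to an error 1 have comparable brackets, so one derivative
can be shared as half a derivative on each. -/
lemma abs_le_bracket_mul {p x : ℝ} (h : |p + x| ≤ 1) :
    |x| ≤ 2 * ((1 + p ^ 2) ^ ((1 / 2 : ℝ) / 2) * (1 + x ^ 2) ^ ((1 / 2 : ℝ) / 2)) := by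
  have hx : x ^ 2 ≤ 3 * (1 + p ^ 2) := by
    have h1 : (p + x) ^ 2 ≤ 1 := by rw [← sq_abs]; nlinarith [abs_nonneg (p + x)]
    nlinarith [sq_nonneg (2 * p + x)]
  have h4 : x ^ 4 ≤ 2 ^ 4 * ((1 + p ^ 2) * (1 + x ^ 2)) := by nlinarith [sq_nonneg x, sq_nonneg p]
  rw [← Real.mul_rpow (by positivity) (by positivity)]
  have e : ((1 + p ^ 2) * (1 + x ^ 2)) ^ ((1 / 2 : ℝ) / 2) =
      ((1 + p ^ 2) * (1 + x ^ 2)) ^ ((4 : ℕ) : ℝ)⁻¹ := by norm_num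
  rw [e]
  refine le_of_pow_le_pow_left₀ (n := 4) (by norm_num) (by positivity) ?_
  rw [mul_pow, Real.rpow_inv_natCast_pow (by positivity) (by norm_num), ← abs_pow,
    abs_of_nonneg (by positivity)]
  exact h4

lemma lintegral_resonant_inner_le (hf : AEStronglyMeasurable f M.freq) {a : ℝ} (ha : IsFreq M a)
    (h1 : |a| < 1) :
    ∫⁻ p, ‖f p‖ₑ * ‖derivConj f (a - p)‖ₑ ∂M.freq ≤ 2 * hatSobolevNorm M (1 / 2) f ^ 2 := by
  have hw := aesm_bracketMul (1 / 2) hf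
  have hw' : AEStronglyMeasurable (fun ζ => bracketMul (1 / 2) f (-ζ)) M.freq :=
    hw.comp_measurePreserving (measurePreserving_neg_freq M)
  calc ∫⁻ p, ‖f p‖ₑ * ‖derivConj f (a - p)‖ₑ ∂M.freq
      ≤ ∫⁻ p, 2 * (‖bracketMul (1 / 2) f p‖ₑ * ‖bracketMul (1 / 2) f (-(a - p))‖ₑ) ∂M.freq := by
        refine lintegral_mono fun p => ?_
        rw [enorm_derivConj, enorm_bracketMul, enorm_bracketMul]
        have h2 : ‖a - p‖ₑ ≤ 2 * (ENNReal.ofReal ((1 + p ^ 2) ^ ((1 / 2 : ℝ) / 2)) *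
            ENNReal.ofReal ((1 + (-(a - p)) ^ 2) ^ ((1 / 2 : ℝ) / 2))) := by
          rw [neg_sq, ← ENNReal.ofReal_mul (by positivity), ← ofReal_norm, Real.norm_eq_abs,
            show (2 : ℝ≥0∞) = ENNReal.ofReal 2 by norm_num, ← ENNReal.ofReal_mul (by norm_num)]
          refine ENNReal.ofReal_le_ofReal (abs_le_bracket_mul ?_)
          rw [add_sub_cancel]; exact h1.le
        calc ‖f p‖ₑ * (‖a - p‖ₑ * ‖f (-(a - p))‖ₑ)
            ≤ ‖f p‖ₑ * ((2 * (ENNReal.ofReal ((1 + p ^ 2) ^ ((1 / 2 : ℝ) / 2)) *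
            ENNReal.ofReal ((1 + (-(a - p)) ^ 2) ^ ((1 / 2 : ℝ) / 2)))) * ‖f (-(a - p))‖ₑ) := by
              gcongr
          _ = _ := by ring
    _ = 2 * ∫⁻ p, ‖bracketMul (1 / 2) f p‖ₑ * ‖bracketMul (1 / 2) f (-(a - p))‖ₑ ∂M.freq :=
        lintegral_const_mul' _ _ (by norm_num)
    _ ≤ _ := by
        rw [hatSobolevNorm_eq hf, sq]
        gcongr
        refine (lintegral_conv_le' hw hw' ha).trans_eq ?_
        rw [eLpNorm_neg_freq hw]

/-- Convolution with the indicator of a unit ball. Cauchy–Schwarz and Fubini each cost the measure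
of a ball, which is at most 3. -/
lemma sq_lintegral_ball_le (hf : AEStronglyMeasurable f M.freq) :
    ∫⁻ ξ, (∫⁻ p, (if |ξ - p| < 1 then ‖f p‖ₑ else 0) ∂M.freq) ^ 2 ∂M.freq ≤
      9 * eLpNorm f 2 M.freq ^ 2 := by
  have hmeas : MeasurableSet {p : ℝ × ℝ | |p.1 - p.2| < 1} :=
    measurableSet_lt (by fun_prop) (by fun_prop)
  have hmeas1 : ∀ ξ : ℝ, MeasurableSet {p : ℝ | |ξ - p| < 1} := fun ξ =>
    measurableSet_lt (by fun_prop) (by fun_prop)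
  have h1 : ∀ ξ : ℝ, (∫⁻ p, (if |ξ - p| < 1 then ‖f p‖ₑ else 0) ∂M.freq) ^ 2 ≤
      3 * ∫⁻ p, (if |ξ - p| < 1 then ‖f p‖ₑ ^ 2 else 0) ∂M.freq := by
    intro ξ
    set S : Set ℝ := {p | |ξ - p| < 1} with hS
    have hfin : M.freq S ≠ ∞ := ne_top_of_le_ne_top (by norm_num) (freq_Ioo_unit_le M ξ)
    have e1 : ∫⁻ p, (if |ξ - p| < 1 then ‖f p‖ₑ else 0) ∂M.freq =
        ∫⁻ p, ‖S.indicator (fun _ => (1 : ℂ)) p‖ₑ * ‖S.indicator f p‖ₑ ∂M.freq := by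
      refine lintegral_congr fun p => ?_
      by_cases h : |ξ - p| < 1
      · have : p ∈ S := h
        simp [h, this]
      · have : p ∉ S := h
        simp [h, this]
    have e2 : eLpNorm (S.indicator fun _ => (1 : ℂ)) 2 M.freq ^ 2 = M.freq S := by
      rw [eLpNorm_two_sq, ← lintegral_indicator_one (hmeas1 ξ)]
      refine lintegral_congr fun p => ?_
      by_cases h : p ∈ S <;> simp [h, ← hS]
    have e3 : eLpNorm (S.indicator f) 2 M.freq ^ 2 =
        ∫⁻ p, (if |ξ - p| < 1 then ‖f p‖ₑ ^ 2 else 0) ∂M.freq := by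
      rw [eLpNorm_two_sq]
      refine lintegral_congr fun p => ?_
      by_cases h : |ξ - p| < 1
      · have : p ∈ S := h
        simp [h, this]
      · have : p ∉ S := h
        simp [h, this]
    rw [e1, ← e3]
    calc _ ≤ (eLpNorm (S.indicator fun _ => (1 : ℂ)) 2 M.freq *
          eLpNorm (S.indicator f) 2 M.freq) ^ 2 := by
          gcongr
          exact lintegral_mul_le_eLpNorm_two
            (memLp_indicator_const 2 (hmeas1 ξ) 1 (Or.inr hfin)).1 (hf.indicator (hmeas1 ξ))
      _ ≤ _ := by
          rw [mul_pow, e2]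
          gcongr
          exact freq_Ioo_unit_le M ξ
  calc _ ≤ ∫⁻ ξ, 3 * ∫⁻ p, (if |ξ - p| < 1 then ‖f p‖ₑ ^ 2 else 0) ∂M.freq ∂M.freq :=
        lintegral_mono h1
    _ = 3 * ∫⁻ p, ∫⁻ ξ, (if |ξ - p| < 1 then ‖f p‖ₑ ^ 2 else 0) ∂M.freq ∂M.freq := by
        rw [lintegral_const_mul' _ _ (by norm_num), lintegral_lintegral_swap]
        have : AEMeasurable (fun p : ℝ × ℝ => ‖f p.2‖ₑ ^ 2) (M.freq.prod M.freq) :=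
          (hf.comp_snd (μ := M.freq)).enorm.pow_const 2
        refine (this.indicator hmeas).congr (Filter.Eventually.of_forall fun p => ?_)
        by_cases h : |p.1 - p.2| < 1 <;> simp [Set.indicator, Function.uncurry_def, h]
    _ ≤ 3 * ∫⁻ p, 3 * ‖f p‖ₑ ^ 2 ∂M.freq := by
        gcongr with p
        have e : ∀ ξ : ℝ, (if |ξ - p| < 1 then ‖f p‖ₑ ^ 2 else 0) =
            {ξ : ℝ | |p - ξ| < 1}.indicator (fun _ => ‖f p‖ₑ ^ 2) ξ := by
          intro ξ
          simp only [Set.indicator, Set.mem_ofPred_eq, abs_sub_comm]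
        simp only [e]
        rw [lintegral_indicator_const (hmeas1 p), mul_comm]
        gcongr
        exact freq_Ioo_unit_le M p
    _ = _ := by
        rw [lintegral_const_mul' _ _ (by norm_num), eLpNorm_two_sq, ← mul_assoc]
        norm_num

/-- The part of the cubic nonlinearity with `min(|ξ₁ + ξ₃|, |ξ₂ + ξ₃|) < 1`. -/
noncomputable def resonantPart (M : Domain) (f : ℝ → ℂ) : ℝ → ℂ :=
  trilinear M 0 (fun ξ₁ ξ₂ ξ₃ => resonance ξ₁ ξ₂ ξ₃ < 1) f f f

lemma trilinear_zero_eq (R : ℝ → ℝ → ℝ → Prop) (ξ : ℝ) :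
    trilinear M 0 R f f f ξ = ((2 * Real.pi)⁻¹ : ℂ) *
      ∫ p in {p : ℝ × ℝ | R p.1 p.2 (ξ - p.1 - p.2)},
        f p.1 * f p.2 * derivConj f (ξ - p.1 - p.2) ∂(M.freq.prod M.freq) := by
  unfold trilinear
  congr 1
  congr 1
  funext p
  simp only [Complex.ofReal_zero, mul_zero, zero_mul, Complex.exp_zero, derivConj]
  ring

lemma measurableSet_resonance : MeasurableSet
    {q : ℝ × (ℝ × ℝ) | resonance q.2.1 q.2.2 (q.1 - q.2.1 - q.2.2) < 1} := by
  unfold resonance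
  exact measurableSet_lt (by fun_prop) (by fun_prop)

lemma quasiMeasurePreserving_sub_sub (M : Domain) :
    Measure.QuasiMeasurePreserving (fun q : ℝ × (ℝ × ℝ) => q.1 - q.2.1 - q.2.2)
      (M.freq.prod (M.freq.prod M.freq)) M.freq := by
  refine ⟨by fun_prop, Measure.AbsolutelyContinuous.mk fun s hs h0 => ?_⟩
  rw [Measure.map_apply (by fun_prop) hs,
    Measure.measure_prod_null (measurableSet_preimage (by fun_prop) hs)]
  filter_upwards [ae_isFreq M] with ξ hξ
  have := quasiMeasurePreserving_const_sub_sub (M := M) hξ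
  exact this.preimage_null h0

lemma aesm_resonantPart (hf : AEStronglyMeasurable f M.freq) :
    AEStronglyMeasurable (resonantPart M f) M.freq := by
  have h : resonantPart M f = fun ξ => ((2 * Real.pi)⁻¹ : ℂ) * ∫ p,
      {q : ℝ × (ℝ × ℝ) | resonance q.2.1 q.2.2 (q.1 - q.2.1 - q.2.2) < 1}.indicator
        (fun q => f q.2.1 * f q.2.2 * derivConj f (q.1 - q.2.1 - q.2.2)) (ξ, p)
        ∂(M.freq.prod M.freq) := by
    funext ξ
    rw [resonantPart, trilinear_zero_eq, ← integral_indicator]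
    · rfl
    · exact measurable_prodMk_left measurableSet_resonance
  rw [h]
  refine AEStronglyMeasurable.const_mul (AEStronglyMeasurable.integral_prod_right'
    (AEStronglyMeasurable.indicator ?_ measurableSet_resonance)) _
  exact (hf.comp_fst.comp_snd.mul hf.comp_snd.comp_snd).mul
    ((aesm_derivConj hf).comp_quasiMeasurePreserving (quasiMeasurePreserving_sub_sub M))

lemma enorm_two_pi_inv_le : ‖((2 * Real.pi)⁻¹ : ℂ)‖ₑ ≤ 1 := by
  rw [← sqrt_two_pi_inv_mul_self, enorm_mul]
  exact mul_le_one' norm_sqrt_two_pi_inv_le norm_sqrt_two_pi_inv_le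

/-- Since ξ₁ + ξ₃ = ξ - ξ₂ and ξ₂ + ξ₃ = ξ - ξ₁, the resonant region is covered by the strips |ξ -
ξ₂| < 1 and |ξ - ξ₁| < 1, interchanged by the symmetry of ξ₁ and ξ₂. In the second, the integral
over ξ₂ costs two H^{1/2} norms and the unit average of |f(ξ₁)| is left. -/
lemma enorm_resonantPart_le (hf : AEStronglyMeasurable f M.freq) {ξ : ℝ} (hξ : IsFreq M ξ) :
    ‖resonantPart M f ξ‖ₑ ≤ 4 * hatSobolevNorm M (1 / 2) f ^ 2 *
      ∫⁻ p, (if |ξ - p| < 1 then ‖f p‖ₑ else 0) ∂M.freq := by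
  set μ := M.freq with hμ
  set G : ℝ × ℝ → ℝ≥0∞ := fun p => ‖f p.1‖ₑ * ‖f p.2‖ₑ * ‖derivConj f (ξ - p.1 - p.2)‖ₑ with hG
  have hGm : AEMeasurable G (μ.prod μ) :=
    (hf.comp_fst.enorm.mul hf.comp_snd.enorm).mul ((aesm_derivConj hf).comp_quasiMeasurePreserving
      (quasiMeasurePreserving_const_sub_sub hξ)).enorm
  set S₁ : Set (ℝ × ℝ) := {p | |ξ - p.1| < 1} with hS₁
  have hS₁m : MeasurableSet S₁ := measurableSet_lt (by fun_prop) (by fun_prop)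
  have key : ∫⁻ p in S₁, G p ∂(μ.prod μ) ≤ 2 * hatSobolevNorm M (1 / 2) f ^ 2 *
      ∫⁻ p, (if |ξ - p| < 1 then ‖f p‖ₑ else 0) ∂μ := by
    rw [← lintegral_indicator hS₁m, lintegral_prod _ (hGm.indicator hS₁m)]
    have hfm : AEMeasurable (fun p => if |ξ - p| < 1 then ‖f p‖ₑ else 0) μ := by
      refine (hf.enorm.indicator (measurableSet_lt (f := fun p => |ξ - p|)
        (g := fun _ => (1 : ℝ)) (by fun_prop) (by fun_prop))).congr
        (Filter.Eventually.of_forall fun p => ?_)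
      by_cases h : |ξ - p| < 1 <;> simp [Set.indicator, h]
    rw [← lintegral_const_mul'' _ hfm]
    refine lintegral_mono_ae ?_
    filter_upwards [ae_isFreq M] with p hp
    by_cases h : |ξ - p| < 1
    · have e : ∀ y, S₁.indicator G (p, y) = ‖f p‖ₑ * (‖f y‖ₑ * ‖derivConj f (ξ - p - y)‖ₑ) := by
        intro y
        rw [Set.indicator_of_mem (show (p, y) ∈ S₁ from h)]
        simp only [hG]
        ring
      simp only [e, if_pos h]
      rw [lintegral_const_mul' _ _ (by simp), mul_comm]
      gcongr
      exact lintegral_resonant_inner_le hf (hξ.sub hp) h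
    · have e : ∀ y, S₁.indicator G (p, y) = 0 := fun y =>
        Set.indicator_of_notMem (show (p, y) ∉ S₁ from h) _
      simp [e]
  have key2 : ∫⁻ p in Prod.swap ⁻¹' S₁, G p ∂(μ.prod μ) = ∫⁻ p in S₁, G p ∂(μ.prod μ) := by
    rw [← (Measure.measurePreserving_swap (μ := μ) (ν := μ)).setLIntegral_comp_preimage_emb
      MeasurableEquiv.prodComm.measurableEmbedding G S₁]
    refine lintegral_congr fun p => ?_
    simp only [hG, Prod.fst_swap, Prod.snd_swap]
    rw [sub_right_comm, mul_comm (‖f p.2‖ₑ)]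
  calc ‖resonantPart M f ξ‖ₑ
      ≤ 1 * ∫⁻ p in {p : ℝ × ℝ | resonance p.1 p.2 (ξ - p.1 - p.2) < 1},
          ‖f p.1 * f p.2 * derivConj f (ξ - p.1 - p.2)‖ₑ ∂(μ.prod μ) := by
        rw [resonantPart, trilinear_zero_eq, enorm_mul]
        gcongr
        · exact enorm_two_pi_inv_le
        · exact enorm_integral_le_lintegral_enorm _
    _ ≤ ∫⁻ p in Prod.swap ⁻¹' S₁ ∪ S₁, G p ∂(μ.prod μ) := by
        simp only [one_mul, enorm_mul]
        refine lintegral_mono_set fun p hp => ?_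
        simp only [Set.mem_ofPred_eq, resonance, min_lt_iff] at hp
        rcases hp with h | h
        · left
          rwa [show p.1 + (ξ - p.1 - p.2) = ξ - p.2 by ring] at h
        · right
          rwa [show p.2 + (ξ - p.1 - p.2) = ξ - p.1 by ring] at h
    _ ≤ ∫⁻ p in Prod.swap ⁻¹' S₁, G p ∂(μ.prod μ) + ∫⁻ p in S₁, G p ∂(μ.prod μ) :=
        lintegral_union_le _ _ _
    _ = ∫⁻ p in S₁, G p ∂(μ.prod μ) + ∫⁻ p in S₁, G p ∂(μ.prod μ) := by rw [key2]
    _ ≤ _ := by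
        refine (add_le_add key key).trans_eq ?_
        ring

lemma eLpNorm_resonantPart_le (hf : AEStronglyMeasurable f M.freq) :
    eLpNorm (resonantPart M f) 2 M.freq ≤ 12 * hatSobolevNorm M (1 / 2) f ^ 3 := by
  set H := hatSobolevNorm M (1 / 2) f with hH
  have h : eLpNorm (resonantPart M f) 2 M.freq ^ 2 ≤ (12 * H ^ 3) ^ 2 := by
    by_cases hH' : H = ∞
    · rw [hH']; simp
    rw [eLpNorm_two_sq]
    calc _ ≤ ∫⁻ ξ, (4 * H ^ 2) ^ 2 *
          (∫⁻ p, (if |ξ - p| < 1 then ‖f p‖ₑ else 0) ∂M.freq) ^ 2 ∂M.freq := by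
          refine lintegral_mono_ae ?_
          filter_upwards [ae_isFreq M] with ξ hξ
          rw [← mul_pow]
          gcongr
          exact enorm_resonantPart_le hf hξ
      _ = (4 * H ^ 2) ^ 2 * ∫⁻ ξ,
          (∫⁻ p, (if |ξ - p| < 1 then ‖f p‖ₑ else 0) ∂M.freq) ^ 2 ∂M.freq :=
          lintegral_const_mul' _ _ (ENNReal.pow_ne_top (ENNReal.mul_ne_top (by norm_num)
            (ENNReal.pow_ne_top hH')))
      _ ≤ (4 * H ^ 2) ^ 2 * (9 * H ^ 2) := by
          gcongr
          refine (sq_lintegral_ball_le hf).trans ?_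
          gcongr
          exact eLpNorm_le_hatSobolevNorm (by norm_num)
      _ = _ := by ring
  exact (ENNReal.pow_le_pow_left_iff (by norm_num)).1 h

end

/-! ### Square sums of blocks, and interpolation of the L^∞ norms -/

/-- Minkowski's inequality in `L²` for countable sums of nonnegative functions. -/
lemma lintegral_tsum_sq_le {α ι : Type*} [MeasurableSpace α] {μ : Measure α} [Countable ι]
    {F : ι → α → ℝ≥0∞} (hF : ∀ i, AEMeasurable (F i) μ) {N : ι → ℝ≥0∞}
    (hN : ∀ i, ∫⁻ x, F i x ^ 2 ∂μ ≤ N i ^ 2) :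
    ∫⁻ x, (∑' i, F i x) ^ 2 ∂μ ≤ (∑' i, N i) ^ 2 := by
  have hrt : ∀ i, (∫⁻ x, F i x ^ (2 : ℝ) ∂μ) ^ (1 / 2 : ℝ) ≤ N i := by
    intro i
    have e : ∫⁻ x, F i x ^ (2 : ℝ) ∂μ ≤ N i ^ (2 : ℝ) := by simpa using hN i
    calc _ ≤ (N i ^ (2 : ℝ)) ^ (1 / 2 : ℝ) := by gcongr
      _ = N i := by rw [← ENNReal.rpow_mul]; norm_num
  -- The square of the sum is expanded into a double sum, and each mixed term is bounded by
  -- Cauchy–Schwarz.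
  have hcs : ∀ i j, ∫⁻ x, F i x * F j x ∂μ ≤ N i * N j := fun i j =>
    (ENNReal.lintegral_mul_le_Lp_mul_Lq μ Real.HolderConjugate.two_two (hF i) (hF j)).trans
      (mul_le_mul' (hrt i) (hrt j))
  simp only [sq, ← ENNReal.tsum_mul_left, ← ENNReal.tsum_mul_right]
  have hm : ∀ i j, AEMeasurable (fun x => F j x * F i x) μ := fun i j => (hF j).mul (hF i)
  rw [lintegral_tsum fun i => AEMeasurable.tsum fun j => hm i j]
  refine ENNReal.tsum_le_tsum fun i => ?_
  rw [lintegral_tsum fun j => hm i j]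
  exact ENNReal.tsum_le_tsum fun j => hcs j i

/-- A substitute for orthogonality: every frequency meets at most two consecutive output blocks, so
ℓ² sums over the output replace ℓ¹ sums. -/
lemma sq_tsum_le_of_two {P : ℕ → ℝ≥0∞} {j : ℕ} (hj : ∀ k, k ≠ j → k ≠ j + 1 → P k = 0) :
    (∑' k, P k) ^ 2 ≤ 4 * ∑' k, P k ^ 2 := by
  have h1 : ∑' k, P k = P j + P (j + 1) := by
    rw [tsum_eq_sum (s := {j, j + 1}), Finset.sum_pair (by omega)]
    intro k hk
    simp only [Finset.mem_insert, Finset.mem_singleton, not_or] at hk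
    exact hj k hk.1 hk.2
  have h2 : P j ^ 2 + P (j + 1) ^ 2 ≤ ∑' k, P k ^ 2 := by
    rw [← Finset.sum_pair (f := fun k => P k ^ 2) (show j ≠ j + 1 by omega)]
    exact ENNReal.sum_le_tsum _
  rw [h1]
  calc (P j + P (j + 1)) ^ 2 = P j ^ 2 + P (j + 1) ^ 2 + 2 * (P j * P (j + 1)) := by ring
    _ ≤ P j ^ 2 + P (j + 1) ^ 2 + 2 * (P j ^ 2 + P (j + 1) ^ 2) := by
        gcongr
        exact ENNReal.mul_le_sq_add_sq _ _
    _ = 3 * (P j ^ 2 + P (j + 1) ^ 2) := by ring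
    _ ≤ 4 * ∑' k, P k ^ 2 := by
        gcongr
        norm_num

section

variable {M : Domain} {η : ℝ → ℝ} {f : ℝ → ℂ}

lemma two_pow_le_bracket (hη : IsCutoff η) {k : ℕ} {ξ : ℝ} (h : lpCutoff η k ξ ≠ 0) :
    (2 : ℝ) ^ k ≤ 2 * (1 + ξ ^ 2) ^ (1 / 2 : ℝ) := by
  rw [← Real.sqrt_eq_rpow]
  have h1 : 1 ≤ Real.sqrt (1 + ξ ^ 2) := Real.one_le_sqrt.2 (by nlinarith [sq_nonneg ξ])
  have h2 : |ξ| ≤ Real.sqrt (1 + ξ ^ 2) := Real.abs_le_sqrt (by linarith)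
  cases k with
  | zero => rw [pow_zero]; linarith
  | succ k =>
    have := hη.le_abs_of_lpCutoff_ne_zero h
    linarith

/-- The weight of `Ĥ^s` on a dyadic block. -/
lemma bracket_le (hη : IsCutoff η) {k : ℕ} {ξ s : ℝ} (hs : -1 ≤ s) (hs0 : s ≤ 0)
    (h : lpCutoff η k ξ ≠ 0) :
    ENNReal.ofReal ((1 + ξ ^ 2) ^ (s / 2)) ≤ 2 * ((2 : ℝ≥0∞) ^ s) ^ k := by
  have h1 := two_pow_le_bracket hη h
  have hb : 0 < (1 + ξ ^ 2) ^ (1 / 2 : ℝ) := by positivity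
  have h2 : (1 + ξ ^ 2) ^ (s / 2) ≤ 2 * ((2 : ℝ) ^ s) ^ k := by
    calc (1 + ξ ^ 2) ^ (s / 2) = ((1 + ξ ^ 2) ^ (1 / 2 : ℝ)) ^ s := by
          rw [← Real.rpow_mul (by positivity)]; congr 1; ring
      _ ≤ (2⁻¹ * 2 ^ k : ℝ) ^ s :=
          Real.rpow_le_rpow_of_nonpos (by positivity) (by linarith) hs0
      _ = (2 : ℝ) ^ (-s) * ((2 : ℝ) ^ s) ^ k := by
          rw [Real.mul_rpow (by positivity) (by positivity), Real.inv_rpow (by norm_num),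
            Real.rpow_neg (by norm_num), ← Real.rpow_natCast, ← Real.rpow_natCast,
            ← Real.rpow_mul (by norm_num), ← Real.rpow_mul (by norm_num), mul_comm (k : ℝ)]
      _ ≤ (2 : ℝ) ^ (1 : ℝ) * ((2 : ℝ) ^ s) ^ k := by
          gcongr
          · norm_num
          · linarith
      _ = _ := by norm_num
  refine (ENNReal.ofReal_le_ofReal h2).trans_eq ?_
  rw [ENNReal.ofReal_mul (by norm_num), ENNReal.ofReal_pow (by positivity),
    ← ENNReal.ofReal_rpow_of_pos (by norm_num)]
  norm_num

lemma tsum_sq_blockHalf_le (hη : IsCutoff η) (hf : AEStronglyMeasurable f M.freq) :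
    ∑' k, blockHalf M η f k ^ 2 ≤ 8 * hatSobolevNorm M (1 / 2) f ^ 2 := by
  have hm : ∀ k, AEStronglyMeasurable (localize η k f) M.freq := fun k => by
    have hc := hη.continuous_lpCutoff k
    exact (Continuous.aestronglyMeasurable (by fun_prop)).mul hf
  have e : ∀ k, blockHalf M η f k ^ 2 = ∫⁻ ξ, 2 ^ k * ‖localize η k f ξ‖ₑ ^ 2 ∂M.freq := by
    intro k
    rw [blockHalf, mul_pow, blockL2, eLpNorm_two_sq, sq, sqrtTwo_pow_sq,
      lintegral_const_mul' _ _ (ENNReal.pow_ne_top (by norm_num))]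
  simp only [e]
  rw [← lintegral_tsum fun k => ((hm k).enorm.pow_const 2).const_mul _, hatSobolevNorm_eq hf,
    eLpNorm_two_sq, ← lintegral_const_mul' _ _ (by norm_num)]
  refine lintegral_mono fun ξ => ?_
  obtain ⟨j, hj⟩ := hη.exists_lpCutoff_eq_zero ξ
  have hb : ∀ k, 2 ^ k * ‖localize η k f ξ‖ₑ ^ 2 ≤ 2 * ‖bracketMul (1 / 2) f ξ‖ₑ ^ 2 := by
    intro k
    by_cases h0 : lpCutoff η k ξ = 0
    · simp [localize, h0]
    · have h1 : (2 : ℝ≥0∞) ^ k ≤ 2 * ENNReal.ofReal ((1 + ξ ^ 2) ^ ((1 / 2 : ℝ) / 2)) ^ 2 := by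
        rw [← ENNReal.ofReal_pow (by positivity), ← Real.rpow_natCast,
          ← Real.rpow_mul (by positivity)]
        have := ENNReal.ofReal_le_ofReal (two_pow_le_bracket hη h0)
        rw [ENNReal.ofReal_mul (by norm_num), ENNReal.ofReal_pow (by norm_num)] at this
        norm_num at this ⊢
        exact this
      rw [enorm_bracketMul, mul_pow, ← mul_assoc]
      gcongr
      exact enorm_localize_le hη k f ξ
  rw [tsum_eq_sum (s := {j, j + 1}), Finset.sum_pair (by omega)]
  · calc _ ≤ 2 * ‖bracketMul (1 / 2) f ξ‖ₑ ^ 2 + 2 * ‖bracketMul (1 / 2) f ξ‖ₑ ^ 2 :=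
          add_le_add (hb _) (hb _)
      _ = 4 * ‖bracketMul (1 / 2) f ξ‖ₑ ^ 2 := by ring
      _ ≤ _ := by gcongr; norm_num
  · intro k hk
    simp only [Finset.mem_insert, Finset.mem_singleton, not_or] at hk
    simp [localize, hj k hk.1 hk.2]

lemma blockHalf_le (hη : IsCutoff η) (hf : AEStronglyMeasurable f M.freq) (k : ℕ) :
    blockHalf M η f k ≤ 3 * hatSobolevNorm M (1 / 2) f := by
  refine (ENNReal.pow_le_pow_left_iff (two_ne_zero)).1 ?_
  calc blockHalf M η f k ^ 2 ≤ ∑' k, blockHalf M η f k ^ 2 := ENNReal.le_tsum k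
    _ ≤ 8 * hatSobolevNorm M (1 / 2) f ^ 2 := tsum_sq_blockHalf_le hη hf
    _ ≤ 9 * hatSobolevNorm M (1 / 2) f ^ 2 := by gcongr; norm_num
    _ = _ := by ring

lemma blockSup_le_half (hη : IsCutoff η) (hf : MemLp f 2 M.freq) (k : ℕ) :
    blockSup M η f k ≤ 3 * blockHalf M η f k := by
  refine (ENNReal.pow_le_pow_left_iff (two_ne_zero)).1 ?_
  refine (sq_blockSup_le hη hf k).trans ?_
  calc 5 * 2 ^ k * blockL2 M η f k ^ 2 ≤ 9 * 2 ^ k * blockL2 M η f k ^ 2 := by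
        gcongr; norm_num
    _ = _ := by rw [blockHalf, ← sqrtTwo_pow_sq]; ring

lemma two_pow_mul_blockSup_le {ε : ℝ} (k : ℕ) :
    ((2 : ℝ≥0∞) ^ k) ^ ε * blockSup M η f k ≤ besovNorm M η ε ∞ 1 f := by
  unfold besovNorm
  split_ifs with h
  · have : AEStronglyMeasurable
        (fun k : ℕ => ((2 : ℝ≥0∞) ^ k) ^ ε * eLpNorm (lpProj M η k f) ∞ M.space)
        Measure.count := (measurable_of_countable _).aestronglyMeasurable
    rw [eLpNorm_one_eq_lintegral_enorm, lintegral_count]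
    exact ENNReal.le_tsum (f := fun k : ℕ =>
      ‖((2 : ℝ≥0∞) ^ k) ^ ε * eLpNorm (lpProj M η k f) ∞ M.space‖ₑ) k
  · exact le_top

/-- The geometric mean of the `H^{1/2}` norm and the norm of `H^{1/2} ∩ B^ε_{∞,1}`. -/
noncomputable def meanNorm (M : Domain) (η : ℝ → ℝ) (ε : ℝ) (f : ℝ → ℂ) : ℝ≥0∞ :=
  (hatSobolevNorm M (1 / 2) f *
    (hatSobolevNorm M (1 / 2) f + besovNorm M η ε ∞ 1 f)) ^ (1 / 2 : ℝ)

lemma meanNorm_sq (ε : ℝ) : meanNorm M η ε f ^ 2 = hatSobolevNorm M (1 / 2) f *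
    (hatSobolevNorm M (1 / 2) f + besovNorm M η ε ∞ 1 f) := by
  rw [meanNorm, ← ENNReal.rpow_natCast, ← ENNReal.rpow_mul]
  norm_num

lemma meanNorm_le (ε : ℝ) : meanNorm M η ε f ≤
    hatSobolevNorm M (1 / 2) f + besovNorm M η ε ∞ 1 f := by
  refine (ENNReal.pow_le_pow_left_iff (two_ne_zero)).1 ?_
  rw [meanNorm_sq, sq]
  gcongr
  exact le_self_add

/-- Interpolation between Bernstein's inequality and the Besov norm. -/
lemma blockSup_le (hη : IsCutoff η) (hf : MemLp f 2 M.freq) {ε δ : ℝ} (hδ : 8 * δ ≤ ε) (k : ℕ) :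
    blockSup M η f k ≤ 3 * meanNorm M η ε f * (((2 : ℝ≥0∞) ^ δ)⁻¹ ^ 4) ^ k := by
  set b : ℝ≥0∞ := 2 ^ δ with hb
  have hb0 : b ≠ 0 := by simp [hb]
  have hbt : b ≠ ∞ := by simp [hb]
  refine (ENNReal.pow_le_pow_left_iff (two_ne_zero)).1 ?_
  -- The Besov norm gives the decay 2^{-8δk}, because 8δ ≤ ε. Below, one factor of the square takes
  -- this bound and the other takes Bernstein's bound by H; the square root keeps the decay
  -- 2^{-4δk}.
  have h1 : b ^ (8 * k) * blockSup M η f k ≤ besovNorm M η ε ∞ 1 f := by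
    refine le_trans ?_ (two_pow_mul_blockSup_le (ε := ε) k)
    gcongr
    rw [hb, ← ENNReal.rpow_natCast, ← ENNReal.rpow_natCast, ← ENNReal.rpow_mul,
      ← ENNReal.rpow_mul]
    refine ENNReal.rpow_le_rpow_of_exponent_le (by norm_num) ?_
    push_cast
    nlinarith [(Nat.cast_nonneg k : (0 : ℝ) ≤ k)]
  have h2 : blockSup M η f k ≤ 9 * hatSobolevNorm M (1 / 2) f := by
    refine (blockSup_le_half hη hf k).trans ?_
    calc _ ≤ 3 * (3 * hatSobolevNorm M (1 / 2) f) := by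
          gcongr; exact blockHalf_le hη hf.1 k
      _ = _ := by ring
  have h3 : b⁻¹ ^ (8 * k) * b ^ (8 * k) = 1 := by
    rw [← mul_pow, ENNReal.inv_mul_cancel hb0 hbt, one_pow]
  calc blockSup M η f k ^ 2 = blockSup M η f k * (b⁻¹ ^ (8 * k) * (b ^ (8 * k) *
        blockSup M η f k)) := by rw [← mul_assoc (b⁻¹ ^ _), h3, one_mul, sq]
    _ ≤ (9 * hatSobolevNorm M (1 / 2) f) * (b⁻¹ ^ (8 * k) *
        (hatSobolevNorm M (1 / 2) f + besovNorm M η ε ∞ 1 f)) := by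
        gcongr
        exact h1.trans le_add_self
    _ = 9 * (hatSobolevNorm M (1 / 2) f *
        (hatSobolevNorm M (1 / 2) f + besovNorm M η ε ∞ 1 f)) * b⁻¹ ^ (8 * k) := by ring
    _ = _ := by
        rw [← meanNorm_sq, mul_pow, mul_pow, ← pow_mul, ← pow_mul]
        congr 1
        · norm_num
        · congr 1; ring

/-- The Fourier transform is bounded by `triSize` on a set of measure at most 5N. The passage to L²
costs N^{1/2}, exactly what the weight of Ĥ^{-1/2} returns. -/
lemma eLpNorm_quadBlock_le_half (hη : IsCutoff η) (hf : MemLp f 2 M.freq) (Q : Quad) :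
    eLpNorm (quadBlock M η f Q) 2 M.freq ≤
      3 * sqrtTwo ^ Q.k * triSize M η f Q.k₁ Q.k₂ Q.k₃ := by
  refine (ENNReal.pow_le_pow_left_iff (two_ne_zero)).1 ?_
  refine (sq_eLpNorm_localize_le_of_bound hη Q.k
    fun ξ hξ => enorm_triBlock_le hη hf Q.k₁ Q.k₂ Q.k₃ hξ).trans ?_
  calc _ ≤ triSize M η f Q.k₁ Q.k₂ Q.k₃ ^ 2 * (9 * 2 ^ Q.k) := by gcongr; norm_num
    _ = _ := by rw [← sqrtTwo_pow_sq]; ring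

lemma eLpNorm_triBlock_le_half (hη : IsCutoff η) (hf : MemLp f 2 M.freq) (k₁ k₂ k₃ : ℕ) :
    eLpNorm (triBlock M η f k₁ k₂ k₃) 2 M.freq ≤
      blockSup M η f k₁ * blockSup M η f k₂ * (2 * (sqrtTwo ^ k₃ * blockHalf M η f k₃)) := by
  refine (eLpNorm_triBlock_le hη hf k₁ k₂ k₃).trans_eq ?_
  rw [mul_assoc 2, two_pow_mul_blockL2]

lemma eLpNorm_quadBlock_le (hη : IsCutoff η) (hf : MemLp f 2 M.freq) (Q : Quad) :
    eLpNorm (quadBlock M η f Q) 2 M.freq ≤ blockSup M η f Q.k₁ * blockSup M η f Q.k₂ *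
      (2 * (sqrtTwo ^ Q.k₃ * blockHalf M η f Q.k₃)) :=
  (eLpNorm_mono_enorm fun ξ => enorm_localize_le hη Q.k _ ξ).trans
    (eLpNorm_triBlock_le_half hη hf _ _ _)

end

/-! ### Banded sums -/

lemma tsum_ite_band_le (d k : ℕ) :
    ∑' m : ℕ, (if m ≤ k + d ∧ k ≤ m + d then (1 : ℝ≥0∞) else 0) ≤ (2 * d + 1 : ℕ) := by
  rw [tsum_eq_sum (s := Finset.Icc (k - d) (k + d))]
  · calc _ ≤ ∑ m ∈ Finset.Icc (k - d) (k + d), (1 : ℝ≥0∞) := by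
          gcongr
          split_ifs <;> simp
      _ ≤ _ := by
          rw [Finset.sum_const, nsmul_eq_mul, mul_one, Nat.card_Icc]
          exact_mod_cast (by omega : k + d + 1 - (k - d) ≤ 2 * d + 1)
  · intro m hm
    rw [Finset.mem_Icc] at hm
    rw [if_neg (by omega)]

/-- A banded matrix is bounded on ℓ², since its rows and columns have at most 2d + 1 entries. This
sums over N ∼ N₃ in Σ₁. -/
lemma tsum_sq_band_le (h : ℕ → ℝ≥0∞) (d : ℕ) :
    ∑' k : ℕ, (∑' m : ℕ, if m ≤ k + d ∧ k ≤ m + d then h m else 0) ^ 2 ≤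
      2 * (2 * d + 1 : ℕ) ^ 2 * ∑' m, h m ^ 2 := by
  set I : ℕ → ℕ → ℝ≥0∞ := fun k m => if m ≤ k + d ∧ k ≤ m + d then 1 else 0 with hI
  have e : ∀ k m, (if m ≤ k + d ∧ k ≤ m + d then h m else 0) = I k m * h m := by
    intro k m; simp [hI]
  have h1 : ∀ k, (∑' m, I k m * h m) ^ 2 ≤ 2 * (2 * d + 1 : ℕ) * ∑' m, I k m * h m ^ 2 := by
    intro k
    calc (∑' m, I k m * h m) ^ 2 = ∑' m, ∑' n, I k m * h m * (I k n * h n) := by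
          simp only [sq, ← ENNReal.tsum_mul_left, ← ENNReal.tsum_mul_right]
          rw [ENNReal.tsum_comm]
      _ ≤ ∑' m, ∑' n, (I k n * (I k m * h m ^ 2) + I k m * (I k n * h n ^ 2)) := by
          refine ENNReal.tsum_le_tsum fun m => ENNReal.tsum_le_tsum fun n => ?_
          calc _ = I k m * I k n * (h m * h n) := by ring
            _ ≤ I k m * I k n * (h m ^ 2 + h n ^ 2) := by
                gcongr
                exact ENNReal.mul_le_sq_add_sq _ _
            _ = _ := by ring
      _ = 2 * ((∑' n, I k n) * ∑' m, I k m * h m ^ 2) := by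
          simp only [ENNReal.tsum_add, ENNReal.tsum_mul_left, ENNReal.tsum_mul_right]
          ring
      _ ≤ 2 * ((2 * d + 1 : ℕ) * ∑' m, I k m * h m ^ 2) := by
          gcongr
          exact tsum_ite_band_le d k
      _ = _ := by ring
  simp only [e]
  calc _ ≤ ∑' k, 2 * (2 * d + 1 : ℕ) * ∑' m, I k m * h m ^ 2 := ENNReal.tsum_le_tsum h1
    _ = 2 * (2 * d + 1 : ℕ) * ∑' m, ∑' k, I k m * h m ^ 2 := by
        rw [ENNReal.tsum_mul_left, ENNReal.tsum_comm]
    _ ≤ 2 * (2 * d + 1 : ℕ) * ∑' m, (2 * d + 1 : ℕ) * h m ^ 2 := by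
        gcongr with m
        rw [ENNReal.tsum_mul_right]
        gcongr
        refine le_trans (ENNReal.tsum_le_tsum fun k => le_of_eq ?_) (tsum_ite_band_le d m)
        simp only [hI, and_comm]
    _ = _ := by rw [ENNReal.tsum_mul_left]; ring

/-! ### Majorants for the low output and the balanced interactions -/

section

variable {M : Domain} {η : ℝ → ℝ} {f : ℝ → ℂ}

lemma two_rpow_ne_zero (δ : ℝ) : (2 : ℝ≥0∞) ^ δ ≠ 0 := by simp

lemma two_rpow_ne_top (δ : ℝ) : (2 : ℝ≥0∞) ^ δ ≠ ∞ := by simp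

lemma one_le_two_rpow {δ : ℝ} (hδ : 0 < δ) : 1 ≤ (2 : ℝ≥0∞) ^ δ :=
  ENNReal.one_le_rpow (by norm_num) hδ

lemma inv_pow_mul_pow {b : ℝ≥0∞} (h0 : b ≠ 0) (ht : b ≠ ∞) (k : ℕ) : b⁻¹ ^ k * b ^ k = 1 := by
  rw [← mul_pow, ENNReal.inv_mul_cancel h0 ht, one_pow]

/-- Of the four powers of N^{-δ} in `blockSup_le`, up to three may be spent on losses elsewhere; one
is kept for the sum over N. -/
lemma pow_mul_blockSup_le (hη : IsCutoff η) (hf : MemLp f 2 M.freq) {ε δ : ℝ} (hδ0 : 0 < δ)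
    (hδ : 8 * δ ≤ ε) {j : ℕ} (hj : j ≤ 3) (k : ℕ) :
    (((2 : ℝ≥0∞) ^ δ) ^ k) ^ j * blockSup M η f k ≤
      3 * meanNorm M η ε f * ((2 : ℝ≥0∞) ^ δ)⁻¹ ^ k := by
  set b : ℝ≥0∞ := 2 ^ δ with hb
  have h1 : 1 ≤ b := one_le_two_rpow hδ0
  have h3 : (b⁻¹ ^ k) ^ 3 * (b ^ k) ^ 3 = 1 := by
    rw [← mul_pow, inv_pow_mul_pow (two_rpow_ne_zero δ) (two_rpow_ne_top δ), one_pow]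
  calc (b ^ k) ^ j * blockSup M η f k
      ≤ (b ^ k) ^ 3 * (3 * meanNorm M η ε f * (b⁻¹ ^ 4) ^ k) := by
        gcongr
        · exact one_le_pow₀ h1
        · exact blockSup_le hη hf hδ k
    _ = 3 * meanNorm M η ε f * b⁻¹ ^ k * ((b⁻¹ ^ k) ^ 3 * (b ^ k) ^ 3) := by ring
    _ = _ := by rw [h3, mul_one]

/-- The sum of the geometric series with ratio `2^{-δ}`. -/
noncomputable def geomConst (δ : ℝ) : ℝ≥0∞ := ∑' k : ℕ, ((2 : ℝ≥0∞) ^ δ)⁻¹ ^ k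

lemma geomConst_ne_top {δ : ℝ} (hδ : 0 < δ) : geomConst δ ≠ ∞ :=
  tsum_geometric_ne_top (ENNReal.inv_lt_one.2 (ENNReal.one_lt_rpow (by norm_num) hδ))

lemma tsum_pow_mul_blockSup_le (hη : IsCutoff η) (hf : MemLp f 2 M.freq) {ε δ : ℝ} (hδ0 : 0 < δ)
    (hδ : 8 * δ ≤ ε) {j : ℕ} (hj : j ≤ 3) :
    ∑' k, (((2 : ℝ≥0∞) ^ δ) ^ k) ^ j * blockSup M η f k ≤
      3 * meanNorm M η ε f * geomConst δ := by
  rw [geomConst, ← ENNReal.tsum_mul_left]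
  exact ENNReal.tsum_le_tsum fun k => pow_mul_blockSup_le hη hf hδ0 hδ hj k

lemma tsum_blockSup_le (hη : IsCutoff η) (hf : MemLp f 2 M.freq) {ε δ : ℝ} (hδ0 : 0 < δ)
    (hδ : 8 * δ ≤ ε) : ∑' k, blockSup M η f k ≤ 3 * meanNorm M η ε f * geomConst δ := by
  simpa using tsum_pow_mul_blockSup_le hη hf hδ0 hδ (j := 0) (by norm_num)

lemma aesm_quadBlock (hη : IsCutoff η) (hf : MemLp f 2 M.freq) (Q : Quad) :
    AEStronglyMeasurable (quadBlock M η f Q) M.freq :=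
  (hη.localize_bddL2 (bddL2_triBlock hη hf _ _ _).memLp Q.k).aesm

/-- A majorant of the low output interactions. -/
noncomputable def lowMajorant (M : Domain) (η : ℝ → ℝ) (f : ℝ → ℂ) (δ : ℝ) (a : ℕ) (Q : Quad) :
    ℝ≥0∞ :=
  3 * ((2 : ℝ≥0∞) ^ δ) ^ (2 * a) * (((2 : ℝ≥0∞) ^ δ)⁻¹ ^ Q.k *
    (if Q.k₃ ≤ Q.k₁ + a then (((2 : ℝ≥0∞) ^ δ) ^ Q.k₂) ^ 2 * sizeBound M η f Q.k₁ Q.k₂ Q.k₃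
      else 0))

/-- If N ≲ N₂, the growth N^δ is exchanged for the decay N^{-δ}, summable over outputs, at the price
of N₂^{2δ}. -/
lemma pow_le_of_le_add {b : ℝ≥0∞} (h1 : 1 ≤ b) (ht : b ≠ ∞) {k m a : ℕ} (h : k ≤ m + a) :
    b ^ k ≤ b⁻¹ ^ k * b ^ (2 * a) * (b ^ m) ^ 2 := by
  have h0 : b ≠ 0 := (zero_lt_one.trans_le h1).ne'
  calc b ^ k = b⁻¹ ^ k * b ^ k * b ^ k := by rw [inv_pow_mul_pow h0 ht, one_mul]
    _ ≤ b⁻¹ ^ k * b ^ (m + a) * b ^ (m + a) := by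
        gcongr
    _ = _ := by rw [pow_add, two_mul, pow_add]; ring

lemma low_le (hη : IsCutoff η) (hf : MemLp f 2 M.freq) {δ : ℝ} (hδ0 : 0 < δ) {a : ℕ} {Q : Quad}
    {S : ℝ≥0∞} (hS : triSize M η f Q.k₁ Q.k₂ Q.k₃ ≤ S) {m : ℕ} (hm : Q.k ≤ m + a) :
    (sqrtTwo⁻¹ * 2 ^ δ) ^ Q.k * eLpNorm (quadBlock M η f Q) 2 M.freq ≤
      3 * ((2 : ℝ≥0∞) ^ δ) ^ (2 * a) * (((2 : ℝ≥0∞) ^ δ)⁻¹ ^ Q.k *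
        ((((2 : ℝ≥0∞) ^ δ) ^ m) ^ 2 * S)) := by
  set b : ℝ≥0∞ := 2 ^ δ with hb
  calc (sqrtTwo⁻¹ * b) ^ Q.k * eLpNorm (quadBlock M η f Q) 2 M.freq
      ≤ (sqrtTwo⁻¹ * b) ^ Q.k * (3 * sqrtTwo ^ Q.k * S) := by
        gcongr
        refine (eLpNorm_quadBlock_le_half hη hf Q).trans ?_
        gcongr
    _ = 3 * (sqrtTwo⁻¹ ^ Q.k * sqrtTwo ^ Q.k) * b ^ Q.k * S := by rw [mul_pow]; ring
    _ ≤ 3 * (b⁻¹ ^ Q.k * b ^ (2 * a) * (b ^ m) ^ 2) * S := by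
        rw [sqrtTwo_inv_mul_pow, mul_one]
        gcongr
        exact pow_le_of_le_add (one_le_two_rpow hδ0) (two_rpow_ne_top δ) hm
    _ = _ := by ring

lemma low_le_lowMajorant (hη : IsCutoff η) (hf : MemLp f 2 M.freq) {δ : ℝ} (hδ0 : 0 < δ) {a : ℕ}
    {Q : Quad} (hQ : IsLowOutput a Q) :
    (sqrtTwo⁻¹ * 2 ^ δ) ^ Q.k * eLpNorm (quadBlock M η f Q) 2 M.freq ≤
      lowMajorant M η f δ a Q := by
  rw [lowMajorant, if_pos hQ.1]
  exact low_le hη hf hδ0 (triSize_le_sizeBound hη hf _ _ _) hQ.2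

lemma low_le_lowMajorant' (hη : IsCutoff η) (hf : MemLp f 2 M.freq) {δ : ℝ} (hδ0 : 0 < δ) {a : ℕ}
    {Q : Quad} (hQ : IsLowOutput a ⟨Q.k, Q.k₂, Q.k₁, Q.k₃⟩) :
    (sqrtTwo⁻¹ * 2 ^ δ) ^ Q.k * eLpNorm (quadBlock M η f Q) 2 M.freq ≤
      lowMajorant M η f δ a ⟨Q.k, Q.k₂, Q.k₁, Q.k₃⟩ := by
  have h1 := hQ.1
  simp only at h1
  simp only [lowMajorant, if_pos h1]
  exact low_le hη hf hδ0 (triSize_le_sizeBound' hη hf _ _ _) hQ.2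

lemma tsum_lowMajorant_le (hη : IsCutoff η) (hf : MemLp f 2 M.freq) {ε δ : ℝ} (hδ0 : 0 < δ)
    (hδ : 8 * δ ≤ ε) (a : ℕ) :
    ∑' Q, lowMajorant M η f δ a Q ≤ 3 * ((2 : ℝ≥0∞) ^ δ) ^ (2 * a) * (geomConst δ *
      (2 * schurConst a * (8 * hatSobolevNorm M (1 / 2) f ^ 2) *
        (3 * meanNorm M η ε f * geomConst δ))) := by
  rw [tsum_quad_eq]
  simp only [lowMajorant, ENNReal.tsum_mul_left, ENNReal.tsum_mul_right]
  rw [← geomConst]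
  gcongr
  refine (tsum_sizeBound_le (fun k => (((2 : ℝ≥0∞) ^ δ) ^ k) ^ 2) a).trans ?_
  gcongr
  · exact tsum_sq_blockHalf_le hη hf.1
  · exact tsum_pow_mul_blockSup_le hη hf hδ0 hδ (by norm_num)

lemma tsum_lowMajorant_swap (δ : ℝ) (a : ℕ) :
    ∑' Q : Quad, lowMajorant M η f δ a ⟨Q.k, Q.k₂, Q.k₁, Q.k₃⟩ =
      ∑' Q, lowMajorant M η f δ a Q := by
  rw [tsum_quad_eq, tsum_quad_eq]
  refine tsum_congr fun k => ?_
  rw [ENNReal.tsum_comm]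

/-- A majorant of the balanced interactions. -/
noncomputable def balancedMajorant (δ : ℝ) (a : ℕ) (Q : Quad) : ℝ≥0∞ :=
  54 * sqrtTwo ^ a * ((2 : ℝ≥0∞) ^ δ) ^ (4 * a) *
    (((2 : ℝ≥0∞) ^ δ)⁻¹ ^ Q.k * (((2 : ℝ≥0∞) ^ δ)⁻¹ ^ Q.k₁ *
      (((2 : ℝ≥0∞) ^ δ)⁻¹ ^ Q.k₂ * ((2 : ℝ≥0∞) ^ δ)⁻¹ ^ Q.k₃)))

lemma tsum_balancedMajorant (δ : ℝ) (a : ℕ) :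
    ∑' Q, balancedMajorant δ a Q =
      54 * sqrtTwo ^ a * ((2 : ℝ≥0∞) ^ δ) ^ (4 * a) * geomConst δ ^ 4 := by
  rw [tsum_quad_eq]
  simp only [balancedMajorant, ENNReal.tsum_mul_left, ENNReal.tsum_mul_right]
  rw [← geomConst]
  ring

lemma balanced_le (hη : IsCutoff η) (hf : MemLp f 2 M.freq) {ε δ : ℝ} (hδ0 : 0 < δ)
    (hδ : 8 * δ ≤ ε) {a : ℕ} {Q : Quad} (hQ : IsBalanced a Q) :
    (sqrtTwo⁻¹ * 2 ^ δ) ^ Q.k * eLpNorm (quadBlock M η f Q) 2 M.freq ≤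
      balancedMajorant δ a Q * (meanNorm M η ε f ^ 2 * hatSobolevNorm M (1 / 2) f) := by
  set b : ℝ≥0∞ := 2 ^ δ with hb
  set H := hatSobolevNorm M (1 / 2) f with hH
  set L := meanNorm M η ε f with hL
  have h1b : 1 ≤ b := one_le_two_rpow hδ0
  have h0b := two_rpow_ne_zero δ
  have htb := two_rpow_ne_top δ
  obtain ⟨k, k₁, k₂, k₃⟩ := Q
  obtain ⟨hQ1, hQ2⟩ := hQ
  simp only at hQ1 hQ2 ⊢
  have c1 : sqrtTwo⁻¹ ^ k * sqrtTwo ^ k₃ ≤ sqrtTwo ^ a := by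
    calc sqrtTwo⁻¹ ^ k * sqrtTwo ^ k₃ ≤ sqrtTwo⁻¹ ^ k * sqrtTwo ^ (k + a) := by
          gcongr
          exact one_lt_sqrtTwo.le
      _ = sqrtTwo ^ a := by rw [pow_add, ← mul_assoc, sqrtTwo_inv_mul_pow, one_mul]
  -- With m = max(k₁, k₂), k ≤ m + a and k₃ ≤ m + 2a, so 2k + k₃ ≤ 3m + 4a. Three powers on each L^∞
  -- factor thus pay for N^δ and leave decay in both N and N₃.
  have c2 : b ^ k ≤ b⁻¹ ^ k * b⁻¹ ^ k₃ * (b ^ (4 * a) * ((b ^ k₁) ^ 3 * (b ^ k₂) ^ 3)) := by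
    calc b ^ k = (b⁻¹ ^ k * b ^ k) * (b⁻¹ ^ k₃ * b ^ k₃) * b ^ k := by
          rw [inv_pow_mul_pow h0b htb, inv_pow_mul_pow h0b htb, one_mul, one_mul]
      _ = b⁻¹ ^ k * b⁻¹ ^ k₃ * b ^ (k + k₃ + k) := by rw [pow_add, pow_add]; ring
      _ ≤ b⁻¹ ^ k * b⁻¹ ^ k₃ * b ^ (4 * a + (3 * k₁ + 3 * k₂)) := by
          refine mul_le_mul' le_rfl (pow_le_pow_right₀ h1b ?_)
          omega
      _ = _ := by rw [pow_add, pow_add]; ring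
  have s1 := pow_mul_blockSup_le hη hf hδ0 hδ (le_refl 3) k₁
  have s2 := pow_mul_blockSup_le hη hf hδ0 hδ (le_refl 3) k₂
  rw [← hb, ← hL] at s1 s2
  calc (sqrtTwo⁻¹ * b) ^ k * eLpNorm (quadBlock M η f ⟨k, k₁, k₂, k₃⟩) 2 M.freq
      ≤ (sqrtTwo⁻¹ * b) ^ k * (blockSup M η f k₁ * blockSup M η f k₂ *
          (2 * (sqrtTwo ^ k₃ * blockHalf M η f k₃))) := by
        gcongr
        exact eLpNorm_quadBlock_le hη hf ⟨k, k₁, k₂, k₃⟩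
    _ = 2 * (sqrtTwo⁻¹ ^ k * sqrtTwo ^ k₃) * b ^ k * (blockSup M η f k₁ * blockSup M η f k₂) *
          blockHalf M η f k₃ := by rw [mul_pow]; ring
    _ ≤ 2 * sqrtTwo ^ a * (b⁻¹ ^ k * b⁻¹ ^ k₃ * (b ^ (4 * a) * ((b ^ k₁) ^ 3 * (b ^ k₂) ^ 3))) *
          (blockSup M η f k₁ * blockSup M η f k₂) * (3 * H) := by
        gcongr
        exact blockHalf_le hη hf.1 k₃
    _ = 6 * sqrtTwo ^ a * b ^ (4 * a) * (b⁻¹ ^ k * b⁻¹ ^ k₃) * (((b ^ k₁) ^ 3 * blockSup M η f k₁) *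
          ((b ^ k₂) ^ 3 * blockSup M η f k₂)) * H := by ring
    _ ≤ 6 * sqrtTwo ^ a * b ^ (4 * a) * (b⁻¹ ^ k * b⁻¹ ^ k₃) *
          ((3 * L * b⁻¹ ^ k₁) * (3 * L * b⁻¹ ^ k₂)) * H := by gcongr
    _ = _ := by rw [balancedMajorant]; ring

end

/-! ### The remainder in Ĥ^{-1/2+δ} -/

section sums

variable {M : Domain} {η : ℝ → ℝ} {f : ℝ → ℂ}

lemma two_rpow_neg_half_add (δ : ℝ) : (2 : ℝ≥0∞) ^ (-(1 / 2) + δ) = sqrtTwo⁻¹ * 2 ^ δ := by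
  rw [ENNReal.rpow_add _ _ two_ne_zero ENNReal.ofNat_ne_top, ENNReal.rpow_neg, sqrtTwo]

lemma two_rpow_neg_half : (2 : ℝ≥0∞) ^ (-(1 / 2 : ℝ)) = sqrtTwo⁻¹ := by
  rw [ENNReal.rpow_neg, sqrtTwo]

lemma quadBlock_apply (Q : Quad) (ξ : ℝ) :
    quadBlock M η f Q ξ = lpCutoff η Q.k ξ * triBlock M η f Q.k₁ Q.k₂ Q.k₃ ξ := rfl

/-- The sum of the blocks over a set of interactions. -/
noncomputable def quadSum (M : Domain) (η : ℝ → ℝ) (f : ℝ → ℂ) (S : Set Quad) (ξ : ℝ) : ℂ :=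
  ∑' Q : S, quadBlock M η f Q.1 ξ

lemma aesm_of_hasSum {α ι : Type*} [MeasurableSpace α] {μ : Measure α} [Countable ι]
    {F : ι → α → ℂ} {g : α → ℂ} (hF : ∀ i, AEStronglyMeasurable (F i) μ)
    (h : ∀ᵐ x ∂μ, HasSum (fun i => F i x) (g x)) : AEStronglyMeasurable g μ :=
  aestronglyMeasurable_of_tendsto_ae Filter.atTop (f := fun (s : Finset ι) x => ∑ i ∈ s, F i x)
    (fun s => Finset.aestronglyMeasurable_fun_sum s fun i _ => hF i) h

/-- On a block the weight ⟨ξ⟩^s is at most 2N^s, and Minkowski's inequality sums over blocks. A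
majorant is required only for blocks that are not identically zero, because only these obey the
classification of `quad_cases`. -/
lemma lintegral_bracket_tsum_sq_le (hη : IsCutoff η) (hf : MemLp f 2 M.freq) {s : ℝ}
    (hs : -1 ≤ s) (hs0 : s ≤ 0) (T : Set Quad) {N : Quad → ℝ≥0∞}
    (hN : ∀ Q ∈ T, (∃ ξ, quadBlock M η f Q ξ ≠ 0) →
      ((2 : ℝ≥0∞) ^ s) ^ Q.k * eLpNorm (quadBlock M η f Q) 2 M.freq ≤ N Q) :
    ∫⁻ ξ, (ENNReal.ofReal ((1 + ξ ^ 2) ^ (s / 2)) * ∑' Q : T, ‖quadBlock M η f Q.1 ξ‖ₑ) ^ 2 ∂M.freq ≤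
      (2 * ∑' Q : T, N Q.1) ^ 2 := by
  rw [← ENNReal.tsum_mul_left]
  simp only [← ENNReal.tsum_mul_left]
  have hc := (continuous_bracket s).measurable
  refine lintegral_tsum_sq_le (fun Q => ?_) fun Q => ?_
  · exact hc.ennreal_ofReal.aemeasurable.mul (aesm_quadBlock hη hf Q.1).enorm
  · by_cases h0 : ∃ ξ, quadBlock M η f Q.1 ξ ≠ 0
    · calc _ ≤ ∫⁻ ξ, (2 * ((2 : ℝ≥0∞) ^ s) ^ Q.1.k) ^ 2 * ‖quadBlock M η f Q.1 ξ‖ₑ ^ 2 ∂M.freq := by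
            refine lintegral_mono fun ξ => ?_
            simp only
            by_cases hξ : quadBlock M η f Q.1 ξ = 0
            · simp [hξ]
            · rw [← mul_pow]
              gcongr
              exact bracket_le hη hs hs0 (localize_ne_zero hξ)
        _ = (2 * (((2 : ℝ≥0∞) ^ s) ^ Q.1.k * eLpNorm (quadBlock M η f Q.1) 2 M.freq)) ^ 2 := by
            rw [lintegral_const_mul'' _ ((aesm_quadBlock hη hf Q.1).enorm.pow_const 2),
              ← eLpNorm_two_sq]
            ring
        _ ≤ _ := by
            gcongr
            exact hN Q.1 Q.2 h0
    · push Not at h0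
      simp [h0]

lemma sq_hatSobolevNorm_le {s : ℝ} {g : ℝ → ℂ} (hg : AEStronglyMeasurable g M.freq)
    {G : ℝ → ℝ≥0∞} (h : ∀ᵐ ξ ∂M.freq, ‖g ξ‖ₑ ≤ G ξ) :
    hatSobolevNorm M s g ^ 2 ≤
      ∫⁻ ξ, (ENNReal.ofReal ((1 + ξ ^ 2) ^ (s / 2)) * G ξ) ^ 2 ∂M.freq := by
  rw [hatSobolevNorm_eq hg, eLpNorm_two_sq]
  refine lintegral_mono_ae ?_
  filter_upwards [h] with ξ hξ
  rw [enorm_bracketMul]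
  gcongr

/-- The square integrable functions with finite Besov and Sobolev norms, in terms of blocks. -/
structure Admissible (M : Domain) (η : ℝ → ℝ) (f : ℝ → ℂ) : Prop where
  memLp : MemLp f 2 M.freq
  half : ∑' k, blockHalf M η f k ^ 2 ≠ ∞
  sup : ∑' k, blockSup M η f k ≠ ∞

lemma Admissible.hasSum_quadSum (hf : Admissible M η f) (hη : IsCutoff η) (S : Set Quad) {ξ : ℝ}
    (hξ : IsFreq M ξ) : HasSum (fun Q : S => quadBlock M η f Q.1 ξ) (quadSum M η f S ξ) :=
  ((hasSum_quadBlock hη hf.memLp hf.half hf.sup hξ).summable.subtype S).hasSum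

lemma Admissible.aesm_quadSum (hf : Admissible M η f) (hη : IsCutoff η) (S : Set Quad) :
    AEStronglyMeasurable (quadSum M η f S) M.freq :=
  aesm_of_hasSum (fun Q : S => aesm_quadBlock hη hf.memLp Q.1) (by
    filter_upwards [ae_isFreq M] with ξ hξ
    exact hf.hasSum_quadSum hη S hξ)

lemma Admissible.aesm_cubicFourier (hf : Admissible M η f) (hη : IsCutoff η) :
    AEStronglyMeasurable (cubicFourier M f) M.freq :=
  aesm_of_hasSum (fun Q : Quad => aesm_quadBlock hη hf.memLp Q) (by
    filter_upwards [ae_isFreq M] with ξ hξ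
    exact hasSum_quadBlock hη hf.memLp hf.half hf.sup hξ)

/-- The two sets of interactions may intersect. On the intersection N₃ is far larger than the other
three frequencies, which no nonzero block allows, so Σ₁ + Σ₂ counts no block twice. -/
lemma quadBlock_eq_zero_of_mem_inter (hη : IsCutoff η) {A D : ℝ} (hA : 1024 ≤ A) {Q : Quad}
    (h1 : Q ∈ highOutput A D) (h2 : Q ∈ midOutput A D) (ξ : ℝ) : quadBlock M η f Q ξ = 0 := by
  obtain ⟨d, hd⟩ := pow_unbounded_of_one_lt D (one_lt_two (α := ℝ))
  have e1 := highOutput_le hA hd.le h1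
  have e2 := midOutput_le hA hd.le h2
  by_contra h
  have e3 := blocks_comparable hη h
  omega

/-- The interactions that contribute to the remainder. -/
def remainderSet (A D : ℝ) : Set Quad := {Q | Q ∉ highOutput A D ∧ Q ∉ midOutput A D}

lemma Admissible.enorm_remainder_le (hf : Admissible M η f) (hη : IsCutoff η) {A D : ℝ}
    (hA : 1024 ≤ A) {ξ : ℝ} (hξ : IsFreq M ξ) :
    ‖cubicFourier M f ξ - (quadSum M η f (highOutput A D) ξ +
      quadSum M η f (midOutput A D) ξ)‖ₑ ≤
      ∑' Q : remainderSet A D, ‖quadBlock M η f Q.1 ξ‖ₑ := by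
  have h0 := hasSum_quadBlock hη hf.memLp hf.half hf.sup hξ
  have h1 : HasSum ((highOutput A D).indicator fun Q => quadBlock M η f Q ξ)
      (quadSum M η f (highOutput A D) ξ) :=
    hasSum_subtype_iff_indicator.1 (hf.hasSum_quadSum hη (highOutput A D) hξ)
  have h2 : HasSum ((midOutput A D).indicator fun Q => quadBlock M η f Q ξ)
      (quadSum M η f (midOutput A D) ξ) :=
    hasSum_subtype_iff_indicator.1 (hf.hasSum_quadSum hη (midOutput A D) hξ)
  have h3 := tsum_subtype (remainderSet A D) fun Q => ‖quadBlock M η f Q ξ‖ₑ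
  rw [← (h0.sub (h1.add h2)).tsum_eq, h3]
  refine enorm_tsum_le_tsum_enorm.trans (ENNReal.tsum_le_tsum fun Q => ?_)
  by_cases m1 : Q ∈ highOutput A D
  · rw [Set.indicator_of_mem m1]
    by_cases m2 : Q ∈ midOutput A D
    · rw [Set.indicator_of_mem m2, quadBlock_eq_zero_of_mem_inter hη hA m1 m2, add_zero, sub_zero,
        enorm_zero]
      exact zero_le
    · rw [Set.indicator_of_notMem m2, add_zero, sub_self, enorm_zero]
      exact zero_le
  · rw [Set.indicator_of_notMem m1]
    by_cases m2 : Q ∈ midOutput A D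
    · rw [Set.indicator_of_mem m2, zero_add, sub_self, enorm_zero]
      exact zero_le
    · rw [Set.indicator_of_notMem m2, add_zero, sub_zero,
        Set.indicator_of_mem (show Q ∈ remainderSet A D from ⟨m1, m2⟩)]

/-- The constant in the estimate of the remainder. -/
noncomputable def remainderConst (δ : ℝ) (a : ℕ) : ℝ≥0∞ :=
  2 * (2 * (3 * ((2 : ℝ≥0∞) ^ δ) ^ (2 * a) * (geomConst δ *
      (2 * schurConst a * 8 * (3 * geomConst δ)))) +
    54 * sqrtTwo ^ a * ((2 : ℝ≥0∞) ^ δ) ^ (4 * a) * geomConst δ ^ 4)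

lemma remainderConst_ne_top {δ : ℝ} (hδ : 0 < δ) (a : ℕ) : remainderConst δ a ≠ ∞ := by
  have h1 := geomConst_ne_top hδ
  have h2 := schurConst_ne_top a
  have h3 := two_rpow_ne_top δ
  have h4 := sqrtTwo_ne_top
  unfold remainderConst
  finiteness

lemma Admissible.hatSobolevNorm_remainder_le (hf : Admissible M η f) (hη : IsCutoff η) {A D : ℝ}
    (hA : 1024 ≤ A) (hD : 1024 ≤ D) {ε δ : ℝ} (hδ0 : 0 < δ) (hδ : 8 * δ ≤ ε) (hδ1 : 8 * δ ≤ 1)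
    {a : ℕ} (ha : A ≤ 2 ^ a) :
    hatSobolevNorm M (-(1 / 2) + δ) (fun ξ => cubicFourier M f ξ -
      (quadSum M η f (highOutput A D) ξ + quadSum M η f (midOutput A D) ξ)) ≤
      remainderConst δ (a + 2) * (hatSobolevNorm M (1 / 2) f ^ 2 * meanNorm M η ε f +
        meanNorm M η ε f ^ 2 * hatSobolevNorm M (1 / 2) f) := by
  set H := hatSobolevNorm M (1 / 2) f with hH
  set L := meanNorm M η ε f with hL
  -- The majorants of the three cases are added and summed over all quadruples, so the cases need
  -- not be disjoint.
  set N : Quad → ℝ≥0∞ := fun Q => lowMajorant M η f δ (a + 2) Q +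
    lowMajorant M η f δ (a + 2) ⟨Q.k, Q.k₂, Q.k₁, Q.k₃⟩ +
    balancedMajorant δ (a + 2) Q * (L ^ 2 * H) with hN
  have h1 := sq_hatSobolevNorm_le (s := -(1 / 2) + δ)
    ((hf.aesm_cubicFourier hη).sub ((hf.aesm_quadSum hη (highOutput A D)).add
      (hf.aesm_quadSum hη (midOutput A D)))) (G := _) (by
        filter_upwards [ae_isFreq M] with ξ hξ
        exact hf.enorm_remainder_le hη hA hξ)
  have h2 := h1.trans (lintegral_bracket_tsum_sq_le hη hf.memLp (by linarith) (by linarith) _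
    (N := N) fun Q hQ ⟨ξ, hξ⟩ => by
      rw [two_rpow_neg_half_add]
      rcases quad_cases hη hD ha hξ hQ.1 hQ.2 with h | h | h
      · exact (low_le_lowMajorant hη hf.memLp hδ0 h).trans
          (le_add_right (le_add_right le_rfl))
      · exact (low_le_lowMajorant' hη hf.memLp hδ0 h).trans
          (le_add_right (le_add_left le_rfl))
      · exact (balanced_le hη hf.memLp hδ0 hδ h).trans (le_add_left le_rfl))
  refine ((ENNReal.pow_le_pow_left_iff (by norm_num)).1 h2).trans ?_
  calc 2 * ∑' Q : remainderSet A D, N Q.1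
      ≤ 2 * ∑' Q, N Q := by
        gcongr
        exact ENNReal.tsum_comp_le_tsum_of_injective Subtype.val_injective N
    _ = 2 * (∑' Q, lowMajorant M η f δ (a + 2) Q + ∑' Q, lowMajorant M η f δ (a + 2) Q +
          (∑' Q, balancedMajorant δ (a + 2) Q) * (L ^ 2 * H)) := by
        rw [ENNReal.tsum_add, ENNReal.tsum_add, tsum_lowMajorant_swap, ENNReal.tsum_mul_right]
    _ ≤ 2 * (2 * (3 * ((2 : ℝ≥0∞) ^ δ) ^ (2 * (a + 2)) * (geomConst δ *
          (2 * schurConst (a + 2) * (8 * H ^ 2) * (3 * L * geomConst δ)))) +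
          (54 * sqrtTwo ^ (a + 2) * ((2 : ℝ≥0∞) ^ δ) ^ (4 * (a + 2)) * geomConst δ ^ 4) *
            (L ^ 2 * H)) := by
        rw [← two_mul, tsum_balancedMajorant]
        gcongr
        exact tsum_lowMajorant_le hη hf.memLp hδ0 hδ _
    _ = 2 * (2 * (3 * ((2 : ℝ≥0∞) ^ δ) ^ (2 * (a + 2)) * (geomConst δ *
          (2 * schurConst (a + 2) * 8 * (3 * geomConst δ))))) * (H ^ 2 * L) +
        2 * (54 * sqrtTwo ^ (a + 2) * ((2 : ℝ≥0∞) ^ δ) ^ (4 * (a + 2)) * geomConst δ ^ 4) *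
          (L ^ 2 * H) := by ring
    _ ≤ remainderConst δ (a + 2) * (H ^ 2 * L) + remainderConst δ (a + 2) * (L ^ 2 * H) := by
        unfold remainderConst
        gcongr
        · exact le_self_add
        · exact le_add_self
    _ = _ := by ring

/-! ### The high output sum Σ₁ in Ĥ^{-1/2} -/

lemma tsum_quad_ite_eq (F : ℕ → ℕ → ℕ → ℝ≥0∞) (k : ℕ) :
    ∑' Q : Quad, (if Q.k = k then F Q.k₁ Q.k₂ Q.k₃ else 0) =
      ∑' k₁ : ℕ, ∑' k₂ : ℕ, ∑' k₃ : ℕ, F k₁ k₂ k₃ := by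
  rw [tsum_quad_eq, tsum_eq_single k]
  · simp
  · intro m hm
    simp [hm]

/-- The interactions in `S` whose output frequency is `2 ^ k`. -/
def outputSlice (S : Set Quad) (k : ℕ) : Set Quad := {Q | Q ∈ S ∧ Q.k = k}

lemma tsum_outputSlice (S : Set Quad) (F : Quad → ℝ≥0∞) :
    ∑' k, ∑' Q : outputSlice S k, F Q.1 = ∑' Q : S, F Q.1 := by
  classical
  simp only [tsum_subtype (outputSlice S _) F, tsum_subtype S F]
  rw [ENNReal.tsum_comm]
  refine tsum_congr fun Q => ?_
  rw [tsum_eq_single Q.k]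
  · simp [outputSlice, Set.indicator_apply]
  · intro k hk
    simp [outputSlice, hk.symm]

lemma tsum_outputSlice_le {S : Set Quad} {k : ℕ} {F : Quad → ℝ≥0∞} {G : ℕ → ℕ → ℕ → ℝ≥0∞}
    (h : ∀ Q ∈ S, Q.k = k → F Q ≤ G Q.k₁ Q.k₂ Q.k₃) :
    ∑' Q : outputSlice S k, F Q.1 ≤ ∑' k₁ : ℕ, ∑' k₂ : ℕ, ∑' k₃ : ℕ, G k₁ k₂ k₃ := by
  classical
  rw [tsum_subtype (outputSlice S k) F, ← tsum_quad_ite_eq G k]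
  refine ENNReal.tsum_le_tsum fun Q => ?_
  rw [Set.indicator_apply]
  split_ifs with h1 h2 h2
  · exact h Q h1.1 h1.2
  · exact absurd h1.2 h2
  · exact zero_le
  · exact le_rfl

/-- P_{N₁}w and P_{N₂}w are taken in L^∞ and summed in ℓ¹. The weight N^{-1/2} compensates N₃^{1/2}
as N ∼ N₃, and the outputs are summed in ℓ² by almost orthogonality. No power of N is left over, so
nothing beyond Ĥ^{-1/2} results. -/
lemma Admissible.hatSobolevNorm_highOutput_le (hf : Admissible M η f) (hη : IsCutoff η) {A D : ℝ}
    (hA : 1024 ≤ A) {d : ℕ} (hd : D ≤ 2 ^ d) :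
    hatSobolevNorm M (-(1 / 2)) (quadSum M η f (highOutput A D)) ≤
      32 * sqrtTwo ^ d * (2 * d + 1 : ℕ) * (∑' k, blockSup M η f k) ^ 2 *
        hatSobolevNorm M (1 / 2) f := by
  set H := hatSobolevNorm M (1 / 2) f with hH
  set Λ := ∑' k, blockSup M η f k with hΛ
  set S := highOutput A D with hS
  set P : ℕ → ℝ → ℝ≥0∞ := fun k ξ => ∑' Q : outputSlice S k, ‖quadBlock M η f Q.1 ξ‖ₑ with hP
  set B : ℕ → ℝ≥0∞ := fun k => ∑' m : ℕ, if m ≤ k + d ∧ k ≤ m + d then blockHalf M η f m else 0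
    with hB
  have hr : (1 : ℝ≥0∞) ≤ sqrtTwo := one_lt_sqrtTwo.le
  have h1 := sq_hatSobolevNorm_le (s := -(1 / 2)) (hf.aesm_quadSum hη S) (G := fun ξ => ∑' k, P k ξ)
    (Filter.Eventually.of_forall fun ξ => by
      simp only [hP]
      rw [tsum_outputSlice S fun Q => ‖quadBlock M η f Q ξ‖ₑ]
      exact enorm_tsum_le_tsum_enorm)
  have hsl : ∀ k, ∫⁻ ξ, (ENNReal.ofReal ((1 + ξ ^ 2) ^ ((-(1 / 2) : ℝ) / 2)) * P k ξ) ^ 2 ∂M.freq ≤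
      (4 * sqrtTwo ^ d * Λ ^ 2 * B k) ^ 2 := by
    intro k
    refine (lintegral_bracket_tsum_sq_le hη hf.memLp (by norm_num) (by norm_num) _
      (fun Q _ _ => le_rfl)).trans ?_
    have : ∑' Q : outputSlice S k, ((2 : ℝ≥0∞) ^ (-(1 / 2) : ℝ)) ^ Q.1.k *
        eLpNorm (quadBlock M η f Q.1) 2 M.freq ≤ ∑' k₁, ∑' k₂, ∑' k₃,
          2 * sqrtTwo ^ d * (blockSup M η f k₁ * (blockSup M η f k₂ *
            (if k₃ ≤ k + d ∧ k ≤ k₃ + d then blockHalf M η f k₃ else 0))) := by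
      refine tsum_outputSlice_le (F := fun Q => ((2 : ℝ≥0∞) ^ (-(1 / 2) : ℝ)) ^ Q.k *
        eLpNorm (quadBlock M η f Q) 2 M.freq) (G := fun k₁ k₂ k₃ => 2 * sqrtTwo ^ d *
          (blockSup M η f k₁ * (blockSup M η f k₂ *
            (if k₃ ≤ k + d ∧ k ≤ k₃ + d then blockHalf M η f k₃ else 0)))) fun Q hQ hk => ?_
      have hQ' := highOutput_le hA hd hQ
      rw [if_pos (by omega), two_rpow_neg_half]
      calc _ ≤ sqrtTwo⁻¹ ^ Q.k * (blockSup M η f Q.k₁ * blockSup M η f Q.k₂ *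
              (2 * (sqrtTwo ^ (Q.k + d) * blockHalf M η f Q.k₃))) := by
            gcongr
            refine (eLpNorm_quadBlock_le hη hf.memLp Q).trans ?_
            gcongr
            exact hQ'.2.1
        _ = 2 * sqrtTwo ^ d * (blockSup M η f Q.k₁ * (blockSup M η f Q.k₂ * blockHalf M η f Q.k₃)) *
              (sqrtTwo⁻¹ ^ Q.k * sqrtTwo ^ Q.k) := by rw [pow_add]; ring
        _ = _ := by rw [sqrtTwo_inv_mul_pow, mul_one]
    refine pow_le_pow_left' ((mul_le_mul' le_rfl this).trans (le_of_eq ?_)) 2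
    simp only [ENNReal.tsum_mul_left, ENNReal.tsum_mul_right]
    rw [← hΛ]
    ring
  have h2 : hatSobolevNorm M (-(1 / 2)) (quadSum M η f S) ^ 2 ≤
      (32 * sqrtTwo ^ d * (2 * d + 1 : ℕ) * Λ ^ 2 * H) ^ 2 := by
    refine h1.trans ?_
    calc _ ≤ ∫⁻ ξ, 4 * ∑' k, (ENNReal.ofReal ((1 + ξ ^ 2) ^ ((-(1 / 2) : ℝ) / 2)) * P k ξ) ^ 2
            ∂M.freq := by
          refine lintegral_mono fun ξ => ?_
          simp only
          rw [← ENNReal.tsum_mul_left]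
          obtain ⟨j, hj⟩ := hη.exists_lpCutoff_eq_zero ξ
          refine sq_tsum_le_of_two (j := j) fun k hk1 hk2 => ?_
          have : P k ξ = 0 := by
            refine ENNReal.tsum_eq_zero.2 fun Q => ?_
            rw [quadBlock_apply, Q.2.2, hj k hk1 hk2]
            simp
          rw [this, mul_zero]
      _ = 4 * ∑' k, ∫⁻ ξ, (ENNReal.ofReal ((1 + ξ ^ 2) ^ ((-(1 / 2) : ℝ) / 2)) * P k ξ) ^ 2
            ∂M.freq := by
          rw [lintegral_const_mul' _ _ (by norm_num), lintegral_tsum]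
          intro k
          refine AEMeasurable.pow_const (AEMeasurable.mul
            (continuous_bracket _).measurable.ennreal_ofReal.aemeasurable ?_) 2
          exact AEMeasurable.tsum fun Q => (aesm_quadBlock hη hf.memLp Q.1).enorm
      _ ≤ 4 * ∑' k, (4 * sqrtTwo ^ d * Λ ^ 2 * B k) ^ 2 := by
          gcongr with k
          exact hsl k
      _ = 4 * (4 * sqrtTwo ^ d * Λ ^ 2) ^ 2 * ∑' k, B k ^ 2 := by
          simp only [mul_pow _ (B _), ENNReal.tsum_mul_left]
          ring
      -- The numerical factors combine to 4 · 4² · 2 · 8 = 32².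
      _ ≤ 4 * (4 * sqrtTwo ^ d * Λ ^ 2) ^ 2 * (2 * (2 * d + 1 : ℕ) ^ 2 * (8 * H ^ 2)) := by
          gcongr
          refine (tsum_sq_band_le _ d).trans ?_
          gcongr
          exact tsum_sq_blockHalf_le hη hf.memLp.1
      _ = _ := by ring
  exact (ENNReal.pow_le_pow_left_iff (by norm_num)).1 h2

end sums

/-! ### The middle output sum Σ₂ in B^0_{1,∞} -/

section mid

variable {M : Domain} {η : ℝ → ℝ} {f : ℝ → ℂ}

/-- The sum of the sizes of the interactions in `S` with output frequency close to `2 ^ k`. -/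
noncomputable def nearSize (M : Domain) (η : ℝ → ℝ) (f : ℝ → ℂ) (S : Set Quad) (k : ℕ) : ℝ≥0∞ :=
  ∑' Q : S, if Q.1.k ≤ k + 1 ∧ k ≤ Q.1.k + 1 then triSize M η f Q.1.k₁ Q.1.k₂ Q.1.k₃ else 0

/-- For a fixed output, N₃ ≲ max(N₁, N₂): the factor with the larger frequency stays in L², the
other goes to L^∞, and the Schur test applies. The constant 12 consists of three neighbouring
outputs, two choices of the larger frequency and the 2 of `tsum_sizeBound_le`. -/
lemma nearSize_midOutput_le (hη : IsCutoff η) (hf : MemLp f 2 M.freq) {A D : ℝ}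
    (hA : 1024 ≤ A) {d : ℕ} (hd : D ≤ 2 ^ d) (k : ℕ) :
    nearSize M η f (midOutput A D) k ≤
      12 * schurConst d * (∑' k, blockHalf M η f k ^ 2) * ∑' k, blockSup M η f k := by
  set S := midOutput A D
  set Z := 2 * schurConst d * (∑' k, blockHalf M η f k ^ 2) * ∑' k, blockSup M η f k with hZ
  have h0 : ∑' k₁ : ℕ, ∑' k₂ : ℕ, ∑' k₃ : ℕ,
      (if k₃ ≤ k₁ + d then sizeBound M η f k₁ k₂ k₃ else 0) ≤ Z := by
    simpa using tsum_sizeBound_le (M := M) (η := η) (f := f) (fun _ => 1) d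
  have h1 : ∀ m, ∑' Q : outputSlice S m, triSize M η f Q.1.k₁ Q.1.k₂ Q.1.k₃ ≤ 2 * Z := by
    intro m
    refine (tsum_outputSlice_le (F := fun Q => triSize M η f Q.k₁ Q.k₂ Q.k₃)
      (G := fun k₁ k₂ k₃ => (if k₃ ≤ k₁ + d then sizeBound M η f k₁ k₂ k₃ else 0) +
        (if k₃ ≤ k₂ + d then sizeBound M η f k₂ k₁ k₃ else 0)) fun Q hQ _ => ?_).trans ?_
    · have hQ' := midOutput_le hA hd hQ
      rcases le_total Q.k₁ Q.k₂ with h | h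
      · rw [if_pos (show Q.k₃ ≤ Q.k₂ + d by omega)]
        exact (triSize_le_sizeBound' hη hf _ _ _).trans le_add_self
      · rw [if_pos (show Q.k₃ ≤ Q.k₁ + d by omega)]
        exact (triSize_le_sizeBound hη hf _ _ _).trans le_self_add
    · simp only [ENNReal.tsum_add]
      rw [two_mul]
      refine add_le_add h0 (le_trans (le_of_eq ?_) h0)
      rw [ENNReal.tsum_comm]
  calc nearSize M η f S k = ∑' m, ∑' Q : outputSlice S m,
        (if m ≤ k + 1 ∧ k ≤ m + 1 then 1 else 0) * triSize M η f Q.1.k₁ Q.1.k₂ Q.1.k₃ := by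
        rw [nearSize, ← tsum_outputSlice S fun Q => if Q.k ≤ k + 1 ∧ k ≤ Q.k + 1 then
          triSize M η f Q.k₁ Q.k₂ Q.k₃ else 0]
        refine tsum_congr fun m => tsum_congr fun Q => ?_
        rw [Q.2.2, ite_mul, one_mul, zero_mul]
    _ ≤ ∑' m, (if m ≤ k + 1 ∧ k ≤ m + 1 then 1 else 0) * (2 * Z) := by
        refine ENNReal.tsum_le_tsum fun m => ?_
        rw [ENNReal.tsum_mul_left]
        gcongr
        exact h1 m
    _ ≤ (2 * 1 + 1 : ℕ) * (2 * Z) := by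
        rw [ENNReal.tsum_mul_right]
        gcongr
        exact tsum_ite_band_le 1 k
    _ = _ := by rw [hZ]; push_cast; ring

lemma enorm_quadBlock_le (hη : IsCutoff η) (hf : MemLp f 2 M.freq) (Q : Quad) {ξ : ℝ}
    (hξ : IsFreq M ξ) : ‖quadBlock M η f Q ξ‖ₑ ≤ triSize M η f Q.k₁ Q.k₂ Q.k₃ :=
  (enorm_localize_le hη _ _ _).trans (enorm_triBlock_le hη hf _ _ _ hξ)

lemma near_of_localize_ne_zero (hη : IsCutoff η) {k : ℕ} {Q : Quad} {ξ : ℝ}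
    (h : localize η k (quadBlock M η f Q) ξ ≠ 0) : Q.k ≤ k + 1 ∧ k ≤ Q.k + 1 := by
  have h1 : lpCutoff η k ξ ≠ 0 := localize_ne_zero h
  have h2 : lpCutoff η Q.k ξ ≠ 0 := localize_ne_zero (right_ne_zero_of_mul h)
  exact ⟨hη.le_of_lpCutoff_ne_zero h2 h1, hη.le_of_lpCutoff_ne_zero h1 h2⟩

/-- This serves to make the sum locally integrable, without which `besovNorm` is infinite by
definition. -/
lemma enorm_quadSum_le (hη : IsCutoff η) (hf : MemLp f 2 M.freq) {S : Set Quad} {Z : ℝ≥0∞}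
    (hZ : ∀ k, nearSize M η f S k ≤ Z) {ξ : ℝ} (hξ : IsFreq M ξ) :
    ‖quadSum M η f S ξ‖ₑ ≤ Z := by
  by_cases h : ∃ k, lpCutoff η k ξ ≠ 0
  · obtain ⟨k, hk⟩ := h
    refine le_trans (enorm_tsum_le_tsum_enorm.trans (ENNReal.tsum_le_tsum fun Q => ?_)) (hZ k)
    by_cases h0 : quadBlock M η f Q.1 ξ = 0
    · simp [h0]
    · rw [if_pos (near_of_localize_ne_zero (M := M) (f := f) hη
        (mul_ne_zero (by exact_mod_cast hk) h0))]
      exact enorm_quadBlock_le hη hf Q.1 hξ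
  · push Not at h
    simp [quadSum, quadBlock_apply, h]

lemma lintegral_localize_quadBlock_le (hη : IsCutoff η) (hf : MemLp f 2 M.freq) (k : ℕ)
    (Q : Quad) : ∫⁻ ξ, ‖localize η k (quadBlock M η f Q) ξ‖ₑ ∂M.freq ≤
      (if Q.k ≤ k + 1 ∧ k ≤ Q.k + 1 then triSize M η f Q.k₁ Q.k₂ Q.k₃ else 0) * (5 * 2 ^ k) := by
  split_ifs with h
  · calc _ ≤ ∫⁻ ξ, (Set.Icc (-(8 / 5 * 2 ^ k)) (8 / 5 * 2 ^ k) : Set ℝ).indicator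
          (fun _ => triSize M η f Q.k₁ Q.k₂ Q.k₃) ξ ∂M.freq := by
          refine lintegral_mono_ae ?_
          filter_upwards [ae_isFreq M] with ξ hξ
          rw [localize_eq_indicator hη, enorm_indicator_eq_indicator_enorm]
          refine Set.indicator_le_indicator ?_
          exact (enorm_localize_le hη _ _ _).trans (enorm_quadBlock_le hη hf Q hξ)
      _ ≤ _ := by
          rw [lintegral_indicator_const measurableSet_Icc]
          gcongr
          exact freq_support_lpCutoff_le k
  · have h0 : ∀ ξ, localize η k (quadBlock M η f Q) ξ = 0 := fun ξ => by
      by_contra hc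
      exact h (near_of_localize_ne_zero hη hc)
    simp [h0]

lemma bddL2_quadBlock (hη : IsCutoff η) (hf : MemLp f 2 M.freq) (Q : Quad) :
    BddL2 M (quadBlock M η f Q) := hη.localize_bddL2 (bddL2_triBlock hη hf _ _ _).memLp _

/-- Only blocks with output close to 2^k contribute. Each is bounded by its `triSize` on a set of
finite measure, so a finite `nearSize` justifies the exchange of sum and integral. -/
lemma lpProj_quadSum (hη : IsCutoff η) (hf : MemLp f 2 M.freq) {S : Set Quad} {k : ℕ}
    (hZ : nearSize M η f S k ≠ ∞) (x : ℝ) :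
    lpProj M η k (quadSum M η f S) x = ∑' Q : S, lpProj M η k (quadBlock M η f Q.1) x := by
  have h := hasSum_integral_of_tsum_lintegral (μ := M.freq)
    (F := fun (Q : S) ξ => localize η k (quadBlock M η f Q.1) ξ * Complex.exp (Complex.I * ξ * x))
    (fun Q => (integrable_mul_cexp
      (hη.localize_bddL2 (bddL2_quadBlock hη hf Q.1).memLp k).integrable x).1) (by
    refine ne_top_of_le_ne_top (ENNReal.mul_ne_top hZ
      (by finiteness : (5 * 2 ^ k : ℝ≥0∞) ≠ ∞)) ?_
    rw [nearSize, ← ENNReal.tsum_mul_right]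
    refine ENNReal.tsum_le_tsum fun Q => le_trans (le_of_eq ?_)
      (lintegral_localize_quadBlock_le hη hf k Q.1)
    refine lintegral_congr fun ξ => ?_
    rw [enorm_mul, ← ofReal_norm (Complex.exp _), norm_cexp_I_mul]
    simp)
  simp only [lpProj]
  rw [tsum_mul_left, h.tsum_eq]
  simp only [localize, quadSum, tsum_mul_right, tsum_mul_left]

/-- Two Littlewood–Paley projections act, the one of the Besov norm and the one inside the block;
this gives C². -/
lemma eLpNorm_lpProj_quadSum_le (hη : IsCutoff η) (hf : MemLp f 2 M.freq) {C : ℝ≥0}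
    (hC : ∀ (h : ℝ → ℂ) (k : ℕ), Integrable h M.freq →
      eLpNorm (lpProj M η k h) 1 M.space ≤ C * eLpNorm (invFT M h) 1 M.space)
    {S : Set Quad} {k : ℕ} (hZ : nearSize M η f S k ≠ ∞) :
    eLpNorm (lpProj M η k (quadSum M η f S)) 1 M.space ≤ C ^ 2 * nearSize M η f S k := by
  rw [eLpNorm_one_eq_lintegral_enorm, nearSize, ← ENNReal.tsum_mul_left]
  calc _ ≤ ∫⁻ x, ∑' Q : S, ‖lpProj M η k (quadBlock M η f Q.1) x‖ₑ ∂M.space := by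
        refine lintegral_mono fun x => ?_
        rw [lpProj_quadSum hη hf hZ]
        exact enorm_tsum_le_tsum_enorm
    _ = ∑' Q : S, ∫⁻ x, ‖lpProj M η k (quadBlock M η f Q.1) x‖ₑ ∂M.space := by
        refine lintegral_tsum fun Q => ?_
        exact (continuous_invFT
          (hη.localize_bddL2 (bddL2_quadBlock hη hf Q.1).memLp k).integrable).enorm.aemeasurable
    _ ≤ _ := by
        refine ENNReal.tsum_le_tsum fun Q => ?_
        split_ifs with h
        · rw [← eLpNorm_one_eq_lintegral_enorm]
          refine (hC _ k (bddL2_quadBlock hη hf Q.1).integrable).trans ?_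
          rw [sq, mul_assoc]
          gcongr
          refine (hC _ Q.1.k (bddL2_triBlock hη hf _ _ _).integrable).trans ?_
          gcongr
          exact eLpNorm_one_invFT_triBlock_le hη hf _ _ _
        · have h0 : localize η k (quadBlock M η f Q.1) = 0 := by
            funext ξ
            by_contra hc
            exact h (near_of_localize_ne_zero hη hc)
          simp [lpProj_eq_invFT, h0, invFT]

lemma besovNorm_congr {s : ℝ} {p q : ℝ≥0∞} {g : ℝ → ℂ} (h : f =ᵐ[M.freq] g) :
    besovNorm M η s p q f = besovNorm M η s p q g := by
  have h1 : LocallyIntegrable f M.freq ↔ LocallyIntegrable g M.freq := by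
    rw [locallyIntegrable_iff, locallyIntegrable_iff]
    exact forall₂_congr fun K _ => integrableOn_congr_fun_ae (ae_restrict_of_ae h)
  have h2 : ∀ k, lpProj M η k f = lpProj M η k g := by
    intro k
    funext x
    simp only [lpProj]
    congr 1
    refine integral_congr_ae ?_
    filter_upwards [h] with ξ hξ
    rw [localize, localize, hξ]
  unfold besovNorm
  by_cases hf : LocallyIntegrable f M.freq
  · simp only [if_pos hf, if_pos (h1.1 hf), h2]
  · rw [if_neg hf, if_neg fun hg => hf (h1.2 hg)]

lemma locallyIntegrable_of_bound {g : ℝ → ℂ} (hg : AEStronglyMeasurable g M.freq) {Z : ℝ≥0∞}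
    (hZ : Z ≠ ∞) (h : ∀ᵐ ξ ∂M.freq, ‖g ξ‖ₑ ≤ Z) : LocallyIntegrable g M.freq := by
  rw [locallyIntegrable_iff]
  intro K hK
  refine Measure.integrableOn_of_bounded (M := Z.toReal) hK.measure_lt_top.ne hg ?_
  filter_upwards [ae_restrict_of_ae h] with ξ hξ
  rw [← toReal_enorm]
  exact ENNReal.toReal_mono hZ hξ

lemma Admissible.besovNorm_quadSum_le (hf : Admissible M η f) (hη : IsCutoff η) {C : ℝ≥0}
    (hC : ∀ (h : ℝ → ℂ) (k : ℕ), Integrable h M.freq →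
      eLpNorm (lpProj M η k h) 1 M.space ≤ C * eLpNorm (invFT M h) 1 M.space)
    {S : Set Quad} {Z : ℝ≥0∞} (hZ : Z ≠ ∞) (h : ∀ k, nearSize M η f S k ≤ Z) :
    besovNorm M η 0 1 ∞ (quadSum M η f S) ≤ C ^ 2 * Z := by
  rw [besovNorm, if_pos (locallyIntegrable_of_bound (hf.aesm_quadSum hη S) hZ (by
    filter_upwards [ae_isFreq M] with ξ hξ
    exact enorm_quadSum_le hη hf.memLp h hξ))]
  rw [eLpNorm_exponent_top]
  refine eLpNormEssSup_le_of_ae_enorm_bound (Filter.Eventually.of_forall fun k => ?_)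
  rw [ENNReal.rpow_zero, one_mul, enorm_eq_self]
  refine (eLpNorm_lpProj_quadSum_le hη hf.memLp hC (ne_top_of_le_ne_top hZ (h k))).trans ?_
  gcongr
  exact h k

end mid

/-! ### Return to the profile, and conclusion -/

section profile

variable {M : Domain} {η : ℝ → ℝ} {f : ℝ → ℂ}

lemma enorm_cexp_phase (t ξ : ℝ) : ‖Complex.exp (-(Complex.I * t * ξ ^ 2))‖ₑ = 1 := by
  rw [← ofReal_norm, show -(Complex.I * t * ξ ^ 2) = ((-(t * ξ ^ 2) : ℝ) : ℂ) * Complex.I by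
    push_cast; ring, Complex.norm_exp_ofReal_mul_I, ENNReal.ofReal_one]

lemma aesm_schrodinger (t : ℝ) (hf : AEStronglyMeasurable f M.freq) :
    AEStronglyMeasurable (schrodinger t f) M.freq :=
  AEStronglyMeasurable.mul (Continuous.aestronglyMeasurable (by fun_prop)) hf

lemma schrodinger_neg_schrodinger (t : ℝ) (f : ℝ → ℂ) :
    schrodinger (-t) (schrodinger t f) = f := by
  simpa using schrodinger_schrodinger_neg (-t) f

lemma hatSobolevNorm_schrodinger (s t : ℝ) (f : ℝ → ℂ) :
    hatSobolevNorm M s (schrodinger t f) = hatSobolevNorm M s f := by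
  have h1 : AEStronglyMeasurable (schrodinger t f) M.freq ↔ AEStronglyMeasurable f M.freq :=
    ⟨fun h => by simpa [schrodinger_neg_schrodinger] using aesm_schrodinger (-t) h,
      aesm_schrodinger t⟩
  unfold hatSobolevNorm
  by_cases hf : AEStronglyMeasurable f M.freq
  · rw [if_pos hf, if_pos (h1.2 hf)]
    refine eLpNorm_congr_enorm_ae (Filter.Eventually.of_forall fun ξ => ?_)
    rw [enorm_mul, enorm_mul, schrodinger, enorm_mul, enorm_cexp_phase, one_mul]
  · rw [if_neg hf, if_neg fun h => hf (h1.1 h)]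

lemma hatSobolevNorm_add_le (s : ℝ) (f g : ℝ → ℂ) :
    hatSobolevNorm M s (fun ξ => f ξ + g ξ) ≤ hatSobolevNorm M s f + hatSobolevNorm M s g := by
  by_cases hf : AEStronglyMeasurable f M.freq
  · by_cases hg : AEStronglyMeasurable g M.freq
    · rw [hatSobolevNorm_eq hf, hatSobolevNorm_eq hg, hatSobolevNorm_eq (f := fun ξ => f ξ + g ξ) (hf.add hg)]
      refine le_trans (le_of_eq ?_)
        (eLpNorm_add_le (aesm_bracketMul s hf) (aesm_bracketMul s hg) (by norm_num))
      congr 1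
      funext ξ
      exact mul_add _ _ _
    · simp [hatSobolevNorm, hg]
  · simp [hatSobolevNorm, hf]

lemma nonlin_schrodinger (t ξ : ℝ) : nonlin M t (schrodinger (-t) f) ξ =
    schrodinger (-t) (fun ξ => cubicFourier M f ξ - resonantPart M f ξ) ξ := by
  rw [nonlin, schrodinger_schrodinger_neg, trilinear_schrodinger]
  exact (mul_sub _ _ _).symm

lemma nonlinSum_schrodinger (hη : IsCutoff η) (hf : MemLp f 2 M.freq) {S : Set Quad}
    (hS : ∀ Q ∈ S, IsNonresonant Q) (t : ℝ) {ξ : ℝ} (hξ : IsFreq M ξ) :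
    nonlinSum M η t S (schrodinger (-t) f) ξ = schrodinger (-t) (quadSum M η f S) ξ := by
  rw [nonlinSum, schrodinger, quadSum, ← tsum_mul_left]
  refine tsum_congr fun Q => ?_
  rw [nonlinPiece_schrodinger, schrodinger, nonlinPiece_eq_quadBlock hη hf (hS Q.1 Q.2) hξ]

lemma Admissible.summable_nonlinPiece (hf : Admissible M η f) (hη : IsCutoff η) {S : Set Quad}
    (hS : ∀ Q ∈ S, IsNonresonant Q) (t : ℝ) {ξ : ℝ} (hξ : IsFreq M ξ) :
    Summable fun Q : S => nonlinPiece M η t Q.1 (schrodinger (-t) f) ξ := by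
  refine ((hf.hasSum_quadSum hη S hξ).summable.mul_left
    (Complex.exp (-(Complex.I * (-t : ℝ) * ξ ^ 2)))).congr fun Q => ?_
  rw [nonlinPiece_schrodinger, schrodinger, nonlinPiece_eq_quadBlock hη hf.memLp (hS Q.1 Q.2) hξ]

lemma admissible_of_lt_top (hη : IsCutoff η) {ε : ℝ} (hε : 0 < ε)
    (hH : hatSobolevNorm M (1 / 2) f < ∞) (hB : besovNorm M η ε ∞ 1 f < ∞) :
    Admissible M η f := by
  have hf : MemLp f 2 M.freq := memLp_of_hatSobolevNorm_lt_top (by norm_num) hH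
  have hL : meanNorm M η ε f ≠ ∞ :=
    ne_top_of_le_ne_top (ENNReal.add_ne_top.2 ⟨hH.ne, hB.ne⟩) (meanNorm_le ε)
  have hg := geomConst_ne_top (δ := ε / 8) (by positivity)
  have hH' := hH.ne
  refine ⟨hf, ne_top_of_le_ne_top ?_ (tsum_sq_blockHalf_le hη hf.1),
    ne_top_of_le_ne_top ?_ (tsum_blockSup_le hη hf (ε := ε) (δ := ε / 8) (by positivity) (by linarith))⟩
  · finiteness
  · finiteness

lemma Admissible.hatSobolevNorm_nonlin_sub_le (hf : Admissible M η f) (hη : IsCutoff η) {A D : ℝ}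
    (hA : 1024 ≤ A) (hD : 1024 ≤ D) {ε δ : ℝ} (hδ0 : 0 < δ) (hδ : 8 * δ ≤ ε) (hδ1 : 8 * δ ≤ 1)
    {a : ℕ} (ha : A ≤ 2 ^ a) (t : ℝ) :
    hatSobolevNorm M (-(1 / 2) + δ) (fun ξ => nonlin M t (schrodinger (-t) f) ξ -
      (nonlinSum M η t (highOutput A D) (schrodinger (-t) f) ξ +
        nonlinSum M η t (midOutput A D) (schrodinger (-t) f) ξ)) ≤
      remainderConst δ (a + 2) * (hatSobolevNorm M (1 / 2) f ^ 2 * meanNorm M η ε f +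
        meanNorm M η ε f ^ 2 * hatSobolevNorm M (1 / 2) f) +
      12 * hatSobolevNorm M (1 / 2) f ^ 3 := by
  have h1 : (fun ξ => nonlin M t (schrodinger (-t) f) ξ -
      (nonlinSum M η t (highOutput A D) (schrodinger (-t) f) ξ +
        nonlinSum M η t (midOutput A D) (schrodinger (-t) f) ξ)) =ᵐ[M.freq]
      schrodinger (-t) fun ξ => (cubicFourier M f ξ - (quadSum M η f (highOutput A D) ξ +
        quadSum M η f (midOutput A D) ξ)) + -resonantPart M f ξ := by
    filter_upwards [ae_isFreq M] with ξ hξ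
    rw [nonlin_schrodinger, nonlinSum_schrodinger hη hf.memLp
      (fun Q hQ => isNonresonant_of_mem_highOutput hA hQ) t hξ,
      nonlinSum_schrodinger hη hf.memLp
      (fun Q hQ => isNonresonant_of_mem_midOutput hA hQ) t hξ]
    simp only [schrodinger]
    ring
  rw [hatSobolevNorm_congr h1, hatSobolevNorm_schrodinger]
  refine (hatSobolevNorm_add_le _ _ _).trans (add_le_add
    (hf.hatSobolevNorm_remainder_le hη hA hD hδ0 hδ hδ1 ha) ?_)
  have hr := aesm_resonantPart hf.memLp.1
  -- Since -1/2 + δ ≤ 0, the L² bound of the resonant part is more than enough.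
  refine (hatSobolevNorm_le_eLpNorm (by linarith) hr.neg).trans ?_
  exact (eLpNorm_neg (resonantPart M f) 2 M.freq).le.trans (eLpNorm_resonantPart_le hf.memLp.1)

lemma Admissible.hatSobolevNorm_nonlinSum_high_le (hf : Admissible M η f) (hη : IsCutoff η)
    {A D : ℝ} (hA : 1024 ≤ A) {d : ℕ} (hd : D ≤ 2 ^ d) (t : ℝ) :
    hatSobolevNorm M (-(1 / 2)) (nonlinSum M η t (highOutput A D) (schrodinger (-t) f)) ≤
      32 * sqrtTwo ^ d * (2 * d + 1 : ℕ) * (∑' k, blockSup M η f k) ^ 2 *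
        hatSobolevNorm M (1 / 2) f := by
  have h1 : nonlinSum M η t (highOutput A D) (schrodinger (-t) f) =ᵐ[M.freq]
      schrodinger (-t) (quadSum M η f (highOutput A D)) := by
    filter_upwards [ae_isFreq M] with ξ hξ
    exact nonlinSum_schrodinger hη hf.memLp
      (fun Q hQ => isNonresonant_of_mem_highOutput hA hQ) t hξ
  rw [hatSobolevNorm_congr h1, hatSobolevNorm_schrodinger]
  exact hf.hatSobolevNorm_highOutput_le hη hA hd

lemma Admissible.schrodinger_nonlinSum_mid_ae_eq (hf : Admissible M η f) (hη : IsCutoff η)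
    {A D : ℝ} (hA : 1024 ≤ A) (t : ℝ) :
    schrodinger t (nonlinSum M η t (midOutput A D) (schrodinger (-t) f)) =ᵐ[M.freq]
      quadSum M η f (midOutput A D) := by
  filter_upwards [ae_isFreq M] with ξ hξ
  rw [schrodinger, nonlinSum_schrodinger hη hf.memLp
    (fun Q hQ => isNonresonant_of_mem_midOutput hA hQ) t hξ]
  exact congrFun (schrodinger_schrodinger_neg t _) ξ

/-- The decomposition of the nonlinearity into two leading parts and a smoother remainder. -/
theorem exists_decomposition_bound (hη : IsCutoff η) (M : Domain) {A D : ℝ} (hA : 1024 ≤ A)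
    (hD : 1024 ≤ D) {ε : ℝ} (hε : 0 < ε) :
    ∃ δ : ℝ, 0 < δ ∧ ∃ C : ℝ≥0, ∀ (f : ℝ → ℂ) (t : ℝ),
      hatSobolevNorm M (1 / 2) f < ∞ → besovNorm M η ε ∞ 1 f < ∞ →
      (∀ᵐ ξ ∂M.freq,
        Summable (fun Q : highOutput A D => nonlinPiece M η t Q.1 (schrodinger (-t) f) ξ) ∧
        Summable (fun Q : midOutput A D => nonlinPiece M η t Q.1 (schrodinger (-t) f) ξ)) ∧
      hatSobolevNorm M (-(1 / 2) + δ) (fun ξ => nonlin M t (schrodinger (-t) f) ξ -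
          (nonlinSum M η t (highOutput A D) (schrodinger (-t) f) ξ +
            nonlinSum M η t (midOutput A D) (schrodinger (-t) f) ξ)) +
        hatSobolevNorm M (-(1 / 2)) (nonlinSum M η t (highOutput A D) (schrodinger (-t) f)) +
        besovNorm M η 0 1 ∞
          (schrodinger t (nonlinSum M η t (midOutput A D) (schrodinger (-t) f))) ≤
        C * (hatSobolevNorm M (1 / 2) f + besovNorm M η ε ∞ 1 f) *
          hatSobolevNorm M (1 / 2) f ^ 2 := by
  obtain ⟨a, ha⟩ := pow_unbounded_of_one_lt A (one_lt_two (α := ℝ))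
  obtain ⟨d, hd⟩ := pow_unbounded_of_one_lt D (one_lt_two (α := ℝ))
  obtain ⟨C₀, hC₀⟩ := hη.exists_lpProj_bound M
  -- 8δ ≤ ε is what the interpolation of the L^∞ norms requires, and 8δ ≤ 1 keeps the exponent -1/2
  -- + δ in [-1, 0], where `bracket_le` applies.
  set δ : ℝ := min ε 1 / 8 with hδdef
  have hδ0 : 0 < δ := by positivity
  have hδ : 8 * δ ≤ ε := by linarith [min_le_left ε 1]
  have hδ1 : 8 * δ ≤ 1 := by linarith [min_le_right ε 1]
  have hR := remainderConst_ne_top hδ0 (a + 2)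
  have hg := geomConst_ne_top hδ0
  have hs := schurConst_ne_top d
  have hr := sqrtTwo_ne_top
  -- The three summands belong to the remainder, to Σ₁ with 288 = 32 · 3², and to Σ₂ with 288 = 12 ·
  -- 8 · 3.
  set K : ℝ≥0∞ := (2 * remainderConst δ (a + 2) + 12) +
    288 * sqrtTwo ^ d * (2 * d + 1 : ℕ) * geomConst δ ^ 2 +
    288 * (C₀ : ℝ≥0∞) ^ 2 * schurConst d * geomConst δ with hK
  have hKt : K ≠ ∞ := by
    rw [hK]
    finiteness
  refine ⟨δ, hδ0, K.toNNReal, fun f t hH hB => ?_⟩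
  have hf := admissible_of_lt_top hη hε hH hB
  refine ⟨?_, ?_⟩
  · filter_upwards [ae_isFreq M] with ξ hξ
    exact ⟨hf.summable_nonlinPiece hη (fun Q hQ => isNonresonant_of_mem_highOutput hA hQ) t hξ,
      hf.summable_nonlinPiece hη (fun Q hQ => isNonresonant_of_mem_midOutput hA hQ) t hξ⟩
  rw [ENNReal.coe_toNNReal hKt]
  have hΛ := tsum_blockSup_le hη hf.memLp hδ0 hδ
  have hL2 := meanNorm_sq (M := M) (η := η) (f := f) ε
  have hL1 := meanNorm_le (M := M) (η := η) (f := f) ε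
  have b1 := hf.hatSobolevNorm_nonlin_sub_le hη hA hD hδ0 hδ hδ1 ha.le t
  have b2 := hf.hatSobolevNorm_nonlinSum_high_le hη hA hd.le t
  have hh := tsum_sq_blockHalf_le hη hf.memLp.1
  set H := hatSobolevNorm M (1 / 2) f
  set L := meanNorm M η ε f
  set X := H + besovNorm M η ε ∞ 1 f
  have hZ : ∀ k, nearSize M η f (midOutput A D) k ≤
      12 * schurConst d * (8 * H ^ 2) * (3 * L * geomConst δ) := fun k =>
    (nearSize_midOutput_le hη hf.memLp hA hd.le k).trans (by gcongr)
  have hHt := hH.ne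
  have hLt : L ≠ ∞ := ne_top_of_le_ne_top (ENNReal.add_ne_top.2 ⟨hH.ne, hB.ne⟩) hL1
  have b3 := hf.besovNorm_quadSum_le hη hC₀ (by finiteness) hZ
  rw [besovNorm_congr (hf.schrodinger_nonlinSum_mid_ae_eq hη hA t)]
  -- The three cubic expressions that occur are reduced to X H², by L ≤ X, L² = H X and H ≤ X.
  have e1 : H ^ 2 * L ≤ X * H ^ 2 := by rw [mul_comm]; gcongr
  have e2 : L ^ 2 * H = X * H ^ 2 := by rw [hL2]; ring
  have e3 : H ^ 3 ≤ X * H ^ 2 := by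
    rw [pow_succ, mul_comm]
    gcongr
    exact le_self_add
  calc _ ≤ (remainderConst δ (a + 2) * (H ^ 2 * L + L ^ 2 * H) + 12 * H ^ 3) +
        32 * sqrtTwo ^ d * (2 * d + 1 : ℕ) * (3 * L * geomConst δ) ^ 2 * H +
        (C₀ : ℝ≥0∞) ^ 2 * (12 * schurConst d * (8 * H ^ 2) * (3 * L * geomConst δ)) := by
        gcongr
        exact b2.trans (by gcongr)
    _ = (remainderConst δ (a + 2) * (H ^ 2 * L + L ^ 2 * H) + 12 * H ^ 3) +
        288 * sqrtTwo ^ d * (2 * d + 1 : ℕ) * geomConst δ ^ 2 * (L ^ 2 * H) +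
        288 * (C₀ : ℝ≥0∞) ^ 2 * schurConst d * geomConst δ * (H ^ 2 * L) := by ring
    _ ≤ (remainderConst δ (a + 2) * (X * H ^ 2 + X * H ^ 2) + 12 * (X * H ^ 2)) +
        288 * sqrtTwo ^ d * (2 * d + 1 : ℕ) * geomConst δ ^ 2 * (X * H ^ 2) +
        288 * (C₀ : ℝ≥0∞) ^ 2 * schurConst d * geomConst δ * (X * H ^ 2) := by
        rw [e2]
        gcongr
    _ = _ := by rw [hK]; ring

/-- In the splitting, the remainder and the first sum form the Sobolev part and the second sum the
Besov part; the extra δ derivatives are discarded. -/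
lemma sumNorm_nonlin_le {s : ℝ} (S₁ S₂ : Set Quad) {δ : ℝ} (hδ : 0 < δ) (t : ℝ) (ω : ℝ → ℂ) :
    sumNorm M η s 0 1 ∞ (schrodinger t (nonlin M t ω)) ≤
      hatSobolevNorm M (s + δ) (fun ξ => nonlin M t ω ξ -
          (nonlinSum M η t S₁ ω ξ + nonlinSum M η t S₂ ω ξ)) +
        hatSobolevNorm M s (nonlinSum M η t S₁ ω) +
        besovNorm M η 0 1 ∞ (schrodinger t (nonlinSum M η t S₂ ω)) := by
  unfold sumNorm
  refine iInf_le_of_le (schrodinger t (fun ξ => (nonlin M t ω ξ -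
      (nonlinSum M η t S₁ ω ξ + nonlinSum M η t S₂ ω ξ)) + nonlinSum M η t S₁ ω ξ)) ?_
  refine iInf_le_of_le (schrodinger t (nonlinSum M η t S₂ ω)) ?_
  refine iInf_le_of_le (Filter.Eventually.of_forall fun ξ => ?_) ?_
  · simp only [schrodinger]
    ring
  · rw [hatSobolevNorm_schrodinger]
    gcongr
    refine (hatSobolevNorm_add_le _ _ _).trans ?_
    gcongr
    exact hatSobolevNorm_mono (by linarith)

end profile
theorem mainTheorem5 (M : Domain) (η : ℝ → ℝ) (hη : ContDiff ℝ ((⊤ : ℕ∞) : WithTop ℕ∞) η)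
    (hη_lower : ∀ x, (Set.Icc (-(5 / 4 : ℝ)) (5 / 4)).indicator (fun _ => (1 : ℝ)) x ≤ η x)
    (hη_upper : ∀ x, η x ≤ (Set.Icc (-(8 / 5 : ℝ)) (8 / 5)).indicator (fun _ => (1 : ℝ)) x) :
    (∀ ε : ℝ, 0 < ε → ∃ C : ℝ≥0, ∀ (w : Lp ℂ 2 M.space) (t : ℝ),
      hatSobolevNorm M (1 / 2) (fourierL2 M w) < ∞ →
      besovNorm M η ε ∞ 1 (fourierL2 M w) < ∞ →
      sumNorm M η (-(1 / 2)) 0 1 ∞ (schrodinger t (nonlin M t (profile M t w))) ≤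
        C * hatSobolevNorm M (1 / 2) (fourierL2 M w) ^ 2 *
          (hatSobolevNorm M (1 / 2) (fourierL2 M w) + besovNorm M η ε ∞ 1 (fourierL2 M w))) ∧
    (∃ K : ℝ, 1 ≤ K ∧ ∀ A : ℝ, K ≤ A → ∀ D : ℝ, K ≤ D → ∀ ε : ℝ, 0 < ε →
      ∃ δ : ℝ, 0 < δ ∧ ∃ C : ℝ≥0, ∀ (w : Lp ℂ 2 M.space) (t : ℝ),
      hatSobolevNorm M (1 / 2) (fourierL2 M w) < ∞ →
      besovNorm M η ε ∞ 1 (fourierL2 M w) < ∞ →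
      (∀ᵐ ξ ∂M.freq,
        Summable (fun Q : highOutput A D => nonlinPiece M η t Q.1 (profile M t w) ξ) ∧
        Summable (fun Q : midOutput A D => nonlinPiece M η t Q.1 (profile M t w) ξ)) ∧
      hatSobolevNorm M (-(1 / 2) + δ) (fun ξ => nonlin M t (profile M t w) ξ -
          (nonlinSum M η t (highOutput A D) (profile M t w) ξ +
            nonlinSum M η t (midOutput A D) (profile M t w) ξ)) +
        hatSobolevNorm M (-(1 / 2)) (nonlinSum M η t (highOutput A D) (profile M t w)) +
        besovNorm M η 0 1 ∞
          (schrodinger t (nonlinSum M η t (midOutput A D) (profile M t w))) ≤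
        C * (hatSobolevNorm M (1 / 2) (fourierL2 M w) + besovNorm M η ε ∞ 1 (fourierL2 M w)) *
          hatSobolevNorm M (1 / 2) (fourierL2 M w) ^ 2) := by
  have hη' : IsCutoff η := ⟨hη, hη_lower, hη_upper⟩
  refine ⟨fun ε hε => ?_, 1024, by norm_num, fun A hA D hD ε hε => ?_⟩
  -- Statement (1) does not involve A and D, so both take the smallest admissible value 2^10.
  · obtain ⟨δ, hδ, C, hC⟩ := exists_decomposition_bound hη' M (le_refl 1024) (le_refl 1024) hε
    refine ⟨C, fun w t hH hB => ?_⟩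
    refine (sumNorm_nonlin_le _ _ hδ t _).trans (((hC _ t hH hB).2).trans (le_of_eq ?_))
    ring
  · obtain ⟨δ, hδ, C, hC⟩ := exists_decomposition_bound hη' M hA hD hε
    exact ⟨δ, hδ, C, fun w t hH hB => hC _ t hH hB⟩
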